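/- A \emph{mixture of $k$ Gaussians} is a distribution $\mathcal M = w_1 N(\mu_1,\sigma_1^2)+\dots+w_kN(\mu_k,\sigma_k^2)$ on $\mathbb R$ with $w_i\ge 0$, $\sum_i w_i=1$ and $\sigma_i^2>0$; it is \emph{$\delta$-well-conditioned} if $|\mu_i|\le\delta$ and $|\sigma_i^2-1|\le\delta$ for all $i$. Let $d_{\mathrm{TV}}(\mu,\nu)=\sup_A|\mu(A)-\nu(A)|$, the supremum being over all Borel sets $A\subseteq\mathbb R$. We say that an algorithm has \emph{access} to a distribution $f$ on $\mathbb R$ if it may query an oracle which, for integers $a$ and $m\ge1$, returns an integer $z$ with $|f((-\infty,a/m])-z/m|\le 1/m$. Running time is bit complexity: the time, under the logarithmic cost criterion, of a random access machine on integers with such an oracle. \textbf{Lemma.} There is a single deterministic algorithm and constants $C>0$, $a,b\in\mathbb N$ with the following property. Let $\varepsilon>0$, and let $f$ be a probability distribution on $\mathbb R$ such that $d_{\mathrm{TV}}(f,\mathcal M)\le\varepsilon$ for some $0.5$-well-conditioned mixture $\mathcal M=w_1G_1+\dots+w_kG_k$ of Gaussians, with an arbitrary number $k$ of components. Given the integer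 $\lceil 1/\varepsilon\rceil$ and access to $f$ (and neither $k$ nor $\mathcal M$), the algorithm halts in time at most $C(1+1/\varepsilon)^b=\mathrm{poly}(1/\varepsilon)$ and outputs the weights, means and variances (as exact rational numbers with a common denominator) of a mixture $\widetilde{\mathcal M}$ of at most $C\log(2+1/\varepsilon)=O(\log 1/\varepsilon)$ Gaussians such that, for every such $\mathcal M$, $$d_{\mathrm{TV}}(\mathcal M,\widetilde{\mathcal M})\le C\,\varepsilon\,\log^a(2+1/\varepsilon)=\widetilde O(\varepsilon).$$ -/

import Mathlib

open MeasureTheory ProbabilityTheory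
open scoped NNReal ENNReal

/-! ### Gaussian mixtures and total variation -/

/-- A mixture `w₁ N(μ₁, σ₁²) + ⋯ + w_k N(μ_k, σ_k²)` of `k` (nondegenerate) Gaussians on `ℝ`:
nonnegative weights that sum to one, means, and positive variances. -/
structure GaussianMixture (k : ℕ) where
  weight : Fin k → ℝ
  mean : Fin k → ℝ
  variance : Fin k → ℝ≥0
  weight_nonneg : ∀ i, 0 ≤ weight i
  weight_sum : ∑ i, weight i = 1
  variance_pos : ∀ i, 0 < variance i

namespace GaussianMixture

/-- The probability distribution of a Gaussian mixture. -/
noncomputable def toMeasure {k : ℕ} (M : GaussianMixture k) : Measure ℝ :=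
  ∑ i, ENNReal.ofReal (M.weight i) • gaussianReal (M.mean i) (M.variance i)

instance {k : ℕ} (M : GaussianMixture k) : IsProbabilityMeasure M.toMeasure := by
  constructor
  simp only [toMeasure, Measure.finsetSum_apply, Measure.smul_apply, measure_univ, smul_eq_mul,
    mul_one]
  rw [← ENNReal.ofReal_sum_of_nonneg (fun i _ => M.weight_nonneg i), M.weight_sum,
    ENNReal.ofReal_one]

/-- `M` is `δ`-well-conditioned: every component `N(μ, σ²)` has `|μ| ≤ δ` and `|σ² - 1| ≤ δ`. -/
def WellConditioned {k : ℕ} (M : GaussianMixture k) (δ : ℝ) : Prop :=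
  ∀ i, |M.mean i| ≤ δ ∧ |(M.variance i : ℝ) - 1| ≤ δ

end GaussianMixture

/-- Total variation distance of two probability measures on `ℝ`: the supremum of
`|μ A - ν A|` over all measurable sets `A`. -/
noncomputable def tvDistance (μ ν : Measure ℝ) : ℝ :=
  ⨆ A : {A : Set ℝ // MeasurableSet A}, |μ.real A.1 - ν.real A.1|

/-! ### The machine model: a random access machine over the integers with an oracle

The memory consists of countably many infinite arrays of integers (a fixed program uses only
finitely many of them). Time is measured by the logarithmic cost criterion: every
operation is charged the bit lengths of the integers involved, so that time agrees, up to a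
polynomial, with that of (oracle) Turing machines. -/

/-- A memory: `s k j` is the content of cell `j` of array `k`. -/
abbrev Memory : Type := ℕ → ℤ → ℤ

/-- An oracle, answering a query consisting of two integers by an integer. -/
abbrev Oracle : Type := ℤ → ℤ → ℤ

/-- Integer expressions. Division is the floor division of integers (with value `0` if the
divisor is `0`). -/
inductive Expr : Type
  | const (z : ℤ)
  | get (k : ℕ) (index : Expr)
  | add (e₁ e₂ : Expr)
  | sub (e₁ e₂ : Expr)
  | mul (e₁ e₂ : Expr)
  | div (e₁ e₂ : Expr)
  | query (e₁ e₂ : Expr)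

/-- Programs. The conditional and the loop test whether an expression is positive. -/
inductive Program : Type
  | skip
  | store (k : ℕ) (index value : Expr)
  | seq (p q : Program)
  | ite (test : Expr) (p q : Program)
  | while (test : Expr) (p : Program)

/-- The number of binary digits of (the absolute value of) an integer. -/
def bitLength (z : ℤ) : ℕ := Nat.size z.natAbs

namespace Expr

/-- The value of an expression. -/
def eval (O : Oracle) (s : Memory) : Expr → ℤ
  | const z => z
  | get k e => s k (e.eval O s)
  | add e₁ e₂ => e₁.eval O s + e₂.eval O s
  | sub e₁ e₂ => e₁.eval O s - e₂.eval O s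
  | mul e₁ e₂ => e₁.eval O s * e₂.eval O s
  | div e₁ e₂ => Int.fdiv (e₁.eval O s) (e₂.eval O s)
  | query e₁ e₂ => O (e₁.eval O s) (e₂.eval O s)

/-- The time needed to evaluate an expression: each subexpression is charged one plus the bit length
of its value. -/
def cost (O : Oracle) (s : Memory) : Expr → ℕ
  | const z => 1 + bitLength z
  | get k e => 1 + bitLength ((get k e).eval O s) + e.cost O s
  | add e₁ e₂ => 1 + bitLength ((add e₁ e₂).eval O s) + e₁.cost O s + e₂.cost O s
  | sub e₁ e₂ => 1 + bitLength ((sub e₁ e₂).eval O s) + e₁.cost O s + e₂.cost O s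
  | mul e₁ e₂ => 1 + bitLength ((mul e₁ e₂).eval O s) + e₁.cost O s + e₂.cost O s
  | div e₁ e₂ => 1 + bitLength ((div e₁ e₂).eval O s) + e₁.cost O s + e₂.cost O s
  | query e₁ e₂ => 1 + bitLength ((query e₁ e₂).eval O s) + e₁.cost O s + e₂.cost O s

end Expr

/-- The memory obtained from `s` by writing `v` into cell `j` of array `k`. -/
def Memory.write (s : Memory) (k : ℕ) (j v : ℤ) : Memory :=
  Function.update s k (Function.update (s k) j v)

/-- `Exec O p s s' t`: with oracle `O`, the program `p`, started on the memory `s`, halts after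
exactly `t` time units with the memory `s'`. -/
inductive Exec (O : Oracle) : Program → Memory → Memory → ℕ → Prop
  | skip (s : Memory) : Exec O .skip s s 1
  | store (s : Memory) (k : ℕ) (i v : Expr) :
      Exec O (.store k i v) s (s.write k (i.eval O s) (v.eval O s))
        (1 + i.cost O s + v.cost O s)
  | seq {p q : Program} {s s₁ s₂ : Memory} {t₁ t₂ : ℕ} :
      Exec O p s s₁ t₁ → Exec O q s₁ s₂ t₂ → Exec O (.seq p q) s s₂ (t₁ + t₂)
  | ite_pos {e : Expr} {p q : Program} {s s' : Memory} {t : ℕ} :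
      0 < e.eval O s → Exec O p s s' t → Exec O (.ite e p q) s s' (1 + e.cost O s + t)
  | ite_nonpos {e : Expr} {p q : Program} {s s' : Memory} {t : ℕ} :
      e.eval O s ≤ 0 → Exec O q s s' t → Exec O (.ite e p q) s s' (1 + e.cost O s + t)
  | while_pos {e : Expr} {p : Program} {s s₁ s₂ : Memory} {t₁ t₂ : ℕ} :
      0 < e.eval O s → Exec O p s s₁ t₁ → Exec O (.while e p) s₁ s₂ t₂ →
        Exec O (.while e p) s s₂ (1 + e.cost O s + t₁ + t₂)
  | while_nonpos {e : Expr} {p : Program} {s : Memory} :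
      e.eval O s ≤ 0 → Exec O (.while e p) s s (1 + e.cost O s)

/-- Programs are deterministic: final memory and running time are unique. -/
theorem Exec.deterministic {O : Oracle} {p : Program} {s s₁ s₂ : Memory} {t₁ t₂ : ℕ}
    (h₁ : Exec O p s s₁ t₁) (h₂ : Exec O p s s₂ t₂) : s₁ = s₂ ∧ t₁ = t₂ := by
  induction h₁ generalizing s₂ t₂ with
  | skip s => cases h₂; exact ⟨rfl, rfl⟩
  | store s k i v => cases h₂; exact ⟨rfl, rfl⟩
  | seq _ _ ih₁ ih₂ =>
    cases h₂ with
    | seq a b =>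
      obtain ⟨rfl, rfl⟩ := ih₁ a
      obtain ⟨rfl, rfl⟩ := ih₂ b
      exact ⟨rfl, rfl⟩
  | ite_pos h _ ih =>
    cases h₂ with
    | ite_pos _ a => obtain ⟨rfl, rfl⟩ := ih a; exact ⟨rfl, rfl⟩
    | ite_nonpos h' _ => omega
  | ite_nonpos h _ ih =>
    cases h₂ with
    | ite_pos h' _ => omega
    | ite_nonpos _ a => obtain ⟨rfl, rfl⟩ := ih a; exact ⟨rfl, rfl⟩
  | while_pos h _ _ ih₁ ih₂ =>
    cases h₂ with
    | while_pos _ a b =>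
      obtain ⟨rfl, rfl⟩ := ih₁ a
      obtain ⟨rfl, rfl⟩ := ih₂ b
      exact ⟨rfl, rfl⟩
    | while_nonpos h' => omega
  | while_nonpos h =>
    cases h₂ with
    | while_pos h' _ _ => omega
    | while_nonpos _ => exact ⟨rfl, rfl⟩

/-! ### Input, access to a distribution, and output -/

/-- The initial memory on input `n`: cell `0` of array `0` contains `n`, every other cell is `0`. -/
def inputMemory (n : ℤ) : Memory := Memory.write (fun _ _ => 0) 0 0 n

/-- `O` gives access to the distribution `f`: on the query `(a, m)` with `m ≥ 1`, it answers with
an integer `z` such that `z / m` is within `1 / m` of `f((-∞, a / m])`. Nothing is required of the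
other answers. -/
def GivesAccessTo (O : Oracle) (f : Measure ℝ) : Prop :=
  ∀ a m : ℤ, 1 ≤ m → |f.real (Set.Iic ((a : ℝ) / m)) - (O a m : ℝ) / m| ≤ 1 / m

/-- The memory `s` holds the Gaussian mixture `M` with `k` components: cell `0` of array `0` is `k`,
cell `1` of array `0` is a common denominator `d ≥ 1`, and cells `i = 0, …, k - 1` of the
arrays `1`, `2`, `3` are the numerators over `d` of the weights, means and variances. -/
def Outputs (s : Memory) {k : ℕ} (M : GaussianMixture k) : Prop :=
  s 0 0 = k ∧ 1 ≤ s 0 1 ∧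
    ∀ i : Fin k, M.weight i = (s 1 i : ℝ) / s 0 1 ∧ M.mean i = (s 2 i : ℝ) / s 0 1 ∧
      (M.variance i : ℝ) = (s 3 i : ℝ) / s 0 1

/-! ### Reasoning about programs -/

namespace Memory

/-! Write N = ⌈1/ε⌉ and let r be least with N < 2^(r²), so that r² = O(log N) and exp(-r²) ≤ 1/N ≤
ε. The output always has variance 1/4 and means on the lattice of spacing 1/r in [-3r, 3r]; only its
6r² + 1 weights are learned.

This family is rich enough. A well-conditioned component N(μ, σ²) is the convolution of N(μ, σ² -
1/4) with N(0, 1/4), and σ² - 1/4 lies in [1/4, 5/4]. Replacing the first factor by its lattice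
sample costs O(exp(-r²)) in L¹: by Poisson summation the lattice sum of a Gaussian is almost exactly
its integral (`hasSum_gaussian_lattice`), and the part beyond 3r is a negligible tail. Averaging
over the components gives `exists_latticeMixture`, for any number of components.

The weights are found by a greedy method on distribution functions. A fine grid turns every lattice
component and the oracle into a vector. Each round adds the component whose inner product with the
accumulated discrepancy is least. Some convex combination of components is close to the oracle
vector, so the least inner product is nearly nonpositive relative to the target. The squared
discrepancy therefore grows only linearly, up to the approximation error, and T rounds give root
mean square error η + O(1/√T) (`sum_discrepancy_sq_le`). The weights are visit frequencies, hence
rational with denominator T.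

Closeness of distribution functions must then be turned into closeness of densities. For a
difference p of two lattice mixtures with distribution function P, integration by parts gives ∫p² =
-∫P p'. The Fourier transform of p has Gaussian decay, so p is essentially band-limited and ∫p'² ≤
36r²∫p² plus a term of order exp(-2r²) (`integral_gaussCombDeriv_sq_le`). Hence ∫p² is controlled by
r²∫P² (`integral_gaussComb_sq_le`), and since p essentially lives on [-5r, 5r], the L¹ norm follows.
Only powers of r are lost, which are powers of log(1/ε).

On the machine side, Gaussian distribution functions are tabulated in integer arithmetic by Euler's
method and left Riemann sums, with error O(r/N). All cells stay below a fixed power of N, so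
counting elementary steps bounds the logarithmic cost. The run depends only on N and the oracle,
which is why one output serves every admissible mixture. -/

theorem write_same (s : Memory) (k : ℕ) (j v : ℤ) : s.write k j v k j = v := by
  simp [write]

theorem write_array_ne (s : Memory) {k k' : ℕ} (h : k' ≠ k) (j v : ℤ) :
    s.write k j v k' = s k' := by
  simp [write, h]

theorem write_index_ne (s : Memory) (k : ℕ) {j j' : ℤ} (h : j' ≠ j) (v : ℤ) :
    s.write k j v k j' = s k j' := by
  simp [write, h]

/-- Every cell holds an integer of absolute value at most `B`. -/
def Bounded (s : Memory) (B : ℕ) : Prop := ∀ k j, |s k j| ≤ B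

theorem Bounded.write {s : Memory} {B : ℕ} (hs : s.Bounded B) (k : ℕ) (j : ℤ) {v : ℤ}
    (hv : |v| ≤ B) : (s.write k j v).Bounded B := by
  intro k' j'
  by_cases hk : k' = k
  · subst hk
    by_cases hj : j' = j
    · subst hj; rwa [write_same]
    · rw [write_index_ne _ _ hj]; exact hs _ _
  · rw [write_array_ne _ hk]; exact hs _ _

end Memory

/-- A crude bound of length by value. It is enough because all values occurring are polynomial in N,
and only a polynomial running time is wanted. -/
theorem bitLength_le (z : ℤ) {B : ℕ} (h : |z| ≤ B) : bitLength z ≤ B := by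
  have h1 : z.natAbs ≤ B := by rw [Int.abs_eq_natAbs] at h; exact_mod_cast h
  exact (Nat.size_le.2 z.natAbs.lt_two_pow_self).trans h1

theorem abs_fdiv_le (a b : ℤ) : |a.fdiv b| ≤ |a| := by
  rw [Int.abs_eq_natAbs, Int.abs_eq_natAbs]
  exact_mod_cast Int.natAbs_fdiv_le_natAbs a b

namespace Expr

/-- The number of nodes of an expression. -/
def size : Expr → ℕ
  | const _ => 1
  | get _ e => 1 + e.size
  | add e₁ e₂ => 1 + e₁.size + e₂.size
  | sub e₁ e₂ => 1 + e₁.size + e₂.size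
  | mul e₁ e₂ => 1 + e₁.size + e₂.size
  | div e₁ e₂ => 1 + e₁.size + e₂.size
  | query e₁ e₂ => 1 + e₁.size + e₂.size

/-- An expression without queries whose constants have absolute value at most `100`. -/
def plain : Expr → Bool
  | const z => decide (|z| ≤ 100)
  | get _ e => e.plain
  | add e₁ e₂ => e₁.plain && e₂.plain
  | sub e₁ e₂ => e₁.plain && e₂.plain
  | mul e₁ e₂ => e₁.plain && e₂.plain
  | div e₁ e₂ => e₁.plain && e₂.plain
  | query _ _ => false

/-- The scalar stored in cell `0` of array `k`. -/
def var (k : ℕ) : Expr := get k (const 0)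

instance : Add Expr := ⟨add⟩
instance : Sub Expr := ⟨sub⟩
instance : Mul Expr := ⟨mul⟩
instance : Div Expr := ⟨div⟩
instance (n : ℕ) : OfNat Expr n := ⟨const n⟩

variable (O : Oracle) (s : Memory)

theorem eval_get (k : ℕ) (e : Expr) : (get k e).eval O s = s k (e.eval O s) := rfl
theorem eval_var (k : ℕ) : (var k).eval O s = s k 0 := rfl
theorem eval_add (e₁ e₂ : Expr) : (e₁ + e₂).eval O s = e₁.eval O s + e₂.eval O s := rfl
theorem eval_sub (e₁ e₂ : Expr) : (e₁ - e₂).eval O s = e₁.eval O s - e₂.eval O s := rfl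
theorem eval_mul (e₁ e₂ : Expr) : (e₁ * e₂).eval O s = e₁.eval O s * e₂.eval O s := rfl
theorem eval_div (e₁ e₂ : Expr) :
    (e₁ / e₂).eval O s = (e₁.eval O s).fdiv (e₂.eval O s) := rfl
theorem eval_ofNat (n : ℕ) :
    (no_index (OfNat.ofNat n) : Expr).eval O s = ((OfNat.ofNat n : ℕ) : ℤ) := rfl
theorem eval_zero : (0 : Expr).eval O s = 0 := rfl
theorem eval_one : (1 : Expr).eval O s = 1 := rfl

variable {O s}

/-- Reading a cell brings the value back below B, floor division does not increase absolute values,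
products add exponents, and since B ≥ 2 one extra factor B absorbs a sum or difference. Every node
thus costs at most one unit of the exponent. -/
theorem abs_eval_le {e : Expr} {B : ℕ} (hB : 100 ≤ B) (hs : s.Bounded B) (he : e.plain = true) :
    |e.eval O s| ≤ (B : ℤ) ^ e.size := by
  have hB1 : (1 : ℤ) ≤ B := by exact_mod_cast (by omega : 1 ≤ B)
  have hB2 : (2 : ℤ) ≤ B := by exact_mod_cast (by omega : 2 ≤ B)
  have key : ∀ (a b : ℤ) (m n : ℕ), |a| ≤ (B : ℤ) ^ m → |b| ≤ (B : ℤ) ^ n →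
      |a| + |b| ≤ (B : ℤ) ^ (1 + m + n) := by
    intro a b m n ha hb
    have h1 : (B : ℤ) ^ m ≤ (B : ℤ) ^ (m + n) := pow_le_pow_right₀ hB1 (by omega)
    have h2 : (B : ℤ) ^ n ≤ (B : ℤ) ^ (m + n) := pow_le_pow_right₀ hB1 (by omega)
    have h3 : (B : ℤ) ^ (1 + m + n) = B * (B : ℤ) ^ (m + n) := by rw [add_assoc, pow_add, pow_one]
    have h4 : 2 * (B : ℤ) ^ (m + n) ≤ B * (B : ℤ) ^ (m + n) := by gcongr
    linarith
  induction e with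
  | const z =>
    simp only [plain, decide_eq_true_eq] at he
    simp only [eval, size, pow_one]
    have : (100 : ℤ) ≤ B := by exact_mod_cast hB
    omega
  | get k e _ =>
    simp only [eval, size]
    calc |s k (e.eval O s)| ≤ (B : ℤ) ^ 1 := by rw [pow_one]; exact hs _ _
      _ ≤ _ := pow_le_pow_right₀ hB1 (by omega)
  | add e₁ e₂ h₁ h₂ =>
    simp only [plain, Bool.and_eq_true] at he
    exact (abs_add_le _ _).trans (key _ _ _ _ (h₁ he.1) (h₂ he.2))
  | sub e₁ e₂ h₁ h₂ =>
    simp only [plain, Bool.and_eq_true] at he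
    exact (abs_sub _ _).trans (key _ _ _ _ (h₁ he.1) (h₂ he.2))
  | mul e₁ e₂ h₁ h₂ =>
    simp only [plain, Bool.and_eq_true] at he
    simp only [eval, size, abs_mul]
    calc |e₁.eval O s| * |e₂.eval O s| ≤ (B : ℤ) ^ e₁.size * (B : ℤ) ^ e₂.size := by
          gcongr
          exacts [h₁ he.1, h₂ he.2]
      _ = (B : ℤ) ^ (e₁.size + e₂.size) := (pow_add _ _ _).symm
      _ ≤ _ := pow_le_pow_right₀ hB1 (by omega)
  | div e₁ e₂ h₁ h₂ =>
    simp only [plain, Bool.and_eq_true] at he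
    simp only [eval, size]
    exact (abs_fdiv_le _ _).trans ((h₁ he.1).trans (pow_le_pow_right₀ hB1 (by omega)))
  | query e₁ e₂ => simp [plain] at he

theorem cost_le {e : Expr} {B : ℕ} (hB : 100 ≤ B) (hs : s.Bounded B) (he : e.plain = true)
    {n : ℕ} (hn : e.size ≤ n) : e.cost O s ≤ e.size * (1 + B ^ n) := by
  have bit : ∀ e : Expr, e.plain = true → e.size ≤ n → bitLength (e.eval O s) ≤ B ^ n := by
    intro e he hn
    apply bitLength_le
    push_cast
    exact (abs_eval_le hB hs he).trans
      (pow_le_pow_right₀ (by exact_mod_cast (by omega : 1 ≤ B)) hn)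
  induction e with
  | const z => 
    have := bit _ he hn
    simp only [cost, size, eval] at *; omega
  | get k e h =>
    have h0 := bit _ he hn
    simp only [plain] at he
    simp only [size] at hn
    have h1 := h he (by omega)
    simp only [cost, size]; nlinarith
  | add e₁ e₂ h₁ h₂ =>
    have h0 := bit _ he hn
    simp only [plain, Bool.and_eq_true] at he
    simp only [size] at hn
    have h1 := h₁ he.1 (by omega)
    have h2 := h₂ he.2 (by omega)
    simp only [cost, size]; nlinarith
  | sub e₁ e₂ h₁ h₂ =>
    have h0 := bit _ he hn
    simp only [plain, Bool.and_eq_true] at he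
    simp only [size] at hn
    have h1 := h₁ he.1 (by omega)
    have h2 := h₂ he.2 (by omega)
    simp only [cost, size]; nlinarith
  | mul e₁ e₂ h₁ h₂ =>
    have h0 := bit _ he hn
    simp only [plain, Bool.and_eq_true] at he
    simp only [size] at hn
    have h1 := h₁ he.1 (by omega)
    have h2 := h₂ he.2 (by omega)
    simp only [cost, size]; nlinarith
  | div e₁ e₂ h₁ h₂ =>
    have h0 := bit _ he hn
    simp only [plain, Bool.and_eq_true] at he
    simp only [size] at hn
    have h1 := h₁ he.1 (by omega)
    have h2 := h₂ he.2 (by omega)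
    simp only [cost, size]; nlinarith
  | query e₁ e₂ => simp [plain] at he

/-- An expression that can be evaluated within a polynomial budget. -/
def Simple (e : Expr) : Prop := e.plain = true ∧ e.size ≤ 50

end Expr

/-- The time budget of an elementary step if all cells are bounded by `B`. -/
def stepTime (B : ℕ) : ℕ := 200 * (1 + B ^ 50)

theorem Expr.Simple.cost_le {e : Expr} (he : e.Simple) {O : Oracle} {s : Memory} {B : ℕ}
    (hB : 100 ≤ B) (hs : s.Bounded B) : e.cost O s ≤ 50 * (1 + B ^ 50) :=
  (Expr.cost_le hB hs he.1 he.2).trans (Nat.mul_le_mul_right _ he.2)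

/-- Started on `s`, the program halts after at most `n` elementary steps on the memory `s'`, whose
cells are bounded by `B`. -/
def Runs (O : Oracle) (B : ℕ) (p : Program) (s s' : Memory) (n : ℕ) : Prop :=
  s'.Bounded B ∧ ∃ t ≤ n * stepTime B, Exec O p s s' t

namespace Runs

variable {O : Oracle} {B : ℕ} {s s₁ s₂ : Memory}

theorem skip (hs : s.Bounded B) : Runs O B .skip s s 1 :=
  ⟨hs, 1, by simp only [stepTime]; nlinarith [Nat.zero_le (B ^ 50)], .skip s⟩

theorem store (hB : 100 ≤ B) (hs : s.Bounded B) {k : ℕ} {i e : Expr} (hi : i.Simple)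
    (he : e.Simple) {j v : ℤ} (hj : i.eval O s = j) (hv : e.eval O s = v) (hvB : |v| ≤ B) :
    Runs O B (.store k i e) s (s.write k j v) 1 := by
  subst hj hv
  refine ⟨hs.write _ _ hvB, _, ?_, .store s k i e⟩
  have h1 := hi.cost_le (O := O) hB hs
  have h2 := he.cost_le (O := O) hB hs
  simp only [stepTime]; nlinarith [Nat.zero_le (B ^ 50)]

/-- The size of an oracle answer does not follow from the size of the query, so it is a hypothesis;
it is supplied later by closeness to a probability. -/
theorem store_query (hB : 100 ≤ B) (hs : s.Bounded B) {k : ℕ} {i e₁ e₂ : Expr} (hi : i.Simple)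
    (he₁ : e₁.Simple) (he₂ : e₂.Simple) {j a m : ℤ} (hj : i.eval O s = j)
    (ha : e₁.eval O s = a) (hm : e₂.eval O s = m) (hvB : |O a m| ≤ B) :
    Runs O B (.store k i (.query e₁ e₂)) s (s.write k j (O a m)) 1 := by
  subst hj ha hm
  refine ⟨hs.write _ _ hvB, _, ?_, .store s k i _⟩
  have h1 := hi.cost_le (O := O) hB hs
  have h2 := he₁.cost_le (O := O) hB hs
  have h3 := he₂.cost_le (O := O) hB hs
  have h4 := bitLength_le _ hvB
  have h5 : B ≤ B ^ 50 := Nat.le_self_pow (by norm_num) B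
  simp only [stepTime, Expr.cost, Expr.eval]; nlinarith

theorem seq {p q : Program} {m n : ℕ} (hp : Runs O B p s s₁ m) (hq : Runs O B q s₁ s₂ n) :
    Runs O B (.seq p q) s s₂ (m + n) := by
  obtain ⟨_, t, ht, h⟩ := hp
  obtain ⟨hb, t', ht', h'⟩ := hq
  exact ⟨hb, t + t', by rw [add_mul]; omega, .seq h h'⟩

theorem mono {p : Program} {m n : ℕ} (h : Runs O B p s s₁ m) (hmn : m ≤ n) :
    Runs O B p s s₁ n := by
  obtain ⟨hb, t, ht, h⟩ := h
  exact ⟨hb, t, ht.trans (Nat.mul_le_mul_right _ hmn), h⟩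

theorem ite_pos (hB : 100 ≤ B) (hs : s.Bounded B) {e : Expr} (he : e.Simple) {p q : Program}
    {n : ℕ} (h : 0 < e.eval O s) (hp : Runs O B p s s₁ n) :
    Runs O B (.ite e p q) s s₁ (n + 1) := by
  obtain ⟨hb, t, ht, hp⟩ := hp
  refine ⟨hb, _, ?_, .ite_pos h hp⟩
  have h1 := he.cost_le (O := O) hB hs
  have h2 : 1 + e.cost O s ≤ stepTime B := by
    simp only [stepTime]; nlinarith [Nat.zero_le (B ^ 50)]
  rw [add_mul]; omega

theorem ite_nonpos (hB : 100 ≤ B) (hs : s.Bounded B) {e : Expr} (he : e.Simple) {p q : Program}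
    {n : ℕ} (h : e.eval O s ≤ 0) (hp : Runs O B q s s₁ n) :
    Runs O B (.ite e p q) s s₁ (n + 1) := by
  obtain ⟨hb, t, ht, hp⟩ := hp
  refine ⟨hb, _, ?_, .ite_nonpos h hp⟩
  have h1 := he.cost_le (O := O) hB hs
  have h2 : 1 + e.cost O s ≤ stepTime B := by
    simp only [stepTime]; nlinarith [Nat.zero_le (B ^ 50)]
  rw [add_mul]; omega

theorem while_pos (hB : 100 ≤ B) (hs : s.Bounded B) {e : Expr} (he : e.Simple) {p : Program}
    {m n : ℕ} (h : 0 < e.eval O s) (hp : Runs O B p s s₁ m) (hw : Runs O B (.while e p) s₁ s₂ n) :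
    Runs O B (.while e p) s s₂ (m + n + 1) := by
  obtain ⟨_, t, ht, hp⟩ := hp
  obtain ⟨hb, t', ht', hw⟩ := hw
  refine ⟨hb, _, ?_, .while_pos h hp hw⟩
  have h1 := he.cost_le (O := O) hB hs
  have h2 : 1 + e.cost O s ≤ stepTime B := by
    simp only [stepTime]; nlinarith [Nat.zero_le (B ^ 50)]
  rw [add_mul, add_mul]; omega

theorem while_nonpos (hB : 100 ≤ B) (hs : s.Bounded B) {e : Expr} (he : e.Simple) {p : Program}
    (h : e.eval O s ≤ 0) : Runs O B (.while e p) s s 1 := by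
  refine ⟨hs, _, ?_, .while_nonpos h⟩
  have h1 := he.cost_le (O := O) hB hs
  simp only [stepTime]; nlinarith [Nat.zero_le (B ^ 50)]

end Runs

/-- The loop `for k := 0, …, e - 1 do p`, with the counter in cell `0` of array `k`. -/
def Program.forLoop (k : ℕ) (e : Expr) (p : Program) : Program :=
  .seq (.store k 0 0) (.while (e - .var k) (.seq p (.store k 0 (.var k + 1))))

/-- The invariant is asserted at the loop head, after the counter has been written; it must
determine the loop bound, and the body must leave the counter as it found it. -/
theorem Runs.forLoop {O : Oracle} {B : ℕ} (hB : 100 ≤ B) {s : Memory} (hs : s.Bounded B) {k : ℕ}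
    {e : Expr} (he : (e - .var k).Simple) {p : Program} {L m : ℕ} (hL : L ≤ B)
    (I : ℕ → Memory → Prop)
    (hI0 : I 0 (s.write k 0 0))
    (hIe : ∀ n s, I n s → e.eval O s = L)
    (hstep : ∀ n < L, ∀ s, s.Bounded B → I n s → s k 0 = n →
      ∃ s', Runs O B p s s' m ∧ s' k 0 = n ∧ I (n + 1) (s'.write k 0 ((n : ℤ) + 1))) :
    ∃ s', Runs O B (.forLoop k e p) s s' (L * (m + 2) + 2) ∧ I L s' := by
  -- Induction on the number d of iterations still to be made.
  have loop : ∀ d n, n + d = L → ∀ s, s.Bounded B → I n s → s k 0 = n →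
      ∃ s', Runs O B (.while (e - .var k) (.seq p (.store k 0 (.var k + 1)))) s s'
        (d * (m + 2) + 1) ∧ I L s' := by
    intro d
    induction d with
    | zero =>
      intro n hn s hs hI hk
      refine ⟨s, ?_, by rwa [← hn]⟩
      rw [zero_mul, zero_add]
      apply Runs.while_nonpos hB hs he
      rw [Expr.eval_sub, hIe n s hI, Expr.eval_var, hk]; omega
    | succ d ih =>
      intro n hn s hs hI hk
      obtain ⟨s', hr, hk', hI'⟩ := hstep n (by omega) s hs hI hk
      have hst : Runs O B (.store k 0 (.var k + 1)) s' (s'.write k 0 ((n : ℤ) + 1)) 1 := by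
        refine Runs.store hB hr.1 ⟨rfl, by decide⟩ ⟨rfl, by simp [Expr.size, Expr.var]⟩ rfl ?_ ?_
        · rw [Expr.eval_add, Expr.eval_var, hk', Expr.eval_one]
        · rw [abs_of_nonneg (by positivity)]; omega
      obtain ⟨s'', hr', hI''⟩ := ih (n + 1) (by omega) _ hst.1 hI'
        (by rw [Memory.write_same]; push_cast; rfl)
      refine ⟨s'', ?_, hI''⟩
      refine (Runs.while_pos hB hs he ?_ (hr.seq hst) hr').mono (by ring_nf; omega)
      rw [Expr.eval_sub, hIe n s hI, Expr.eval_var, hk]; omega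
  have hst : Runs O B (.store k 0 0) s (s.write k 0 0) 1 :=
    Runs.store hB hs ⟨rfl, by decide⟩ ⟨rfl, by decide⟩ rfl rfl (by simp)
  obtain ⟨s', hr, hI⟩ := loop L 0 (by omega) _ hst.1 hI0 (by rw [Memory.write_same]; rfl)
  exact ⟨s', (hst.seq hr).mono (by omega), hI⟩

/-- The arrays a program may write to. -/
def Program.writes : Program → List ℕ
  | .skip => []
  | .store k _ _ => [k]
  | .seq p q => p.writes ++ q.writes
  | .ite _ p q => p.writes ++ q.writes
  | .while _ p => p.writes

/-- Arrays not written by a subprogram can be left out of its specification; membership in the list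
of written arrays is decidable, so each use is settled by `decide`. -/
theorem Exec.frame {O : Oracle} {p : Program} {s s' : Memory} {t : ℕ} (h : Exec O p s s' t)
    {k : ℕ} (hk : k ∉ p.writes) : s' k = s k := by
  induction h with
  | skip s => rfl
  | store s k' i v =>
    simp only [Program.writes, List.mem_singleton] at hk
    exact Memory.write_array_ne _ hk _ _
  | seq _ _ h₁ h₂ =>
    simp only [Program.writes, List.mem_append, not_or] at hk
    rw [h₂ hk.2, h₁ hk.1]
  | ite_pos _ _ h =>
    simp only [Program.writes, List.mem_append, not_or] at hk
    exact h hk.1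
  | ite_nonpos _ _ h =>
    simp only [Program.writes, List.mem_append, not_or] at hk
    exact h hk.2
  | while_pos _ _ _ h₁ h₂ => rw [h₂ hk, h₁ hk]
  | while_nonpos _ => rfl

theorem Runs.frame {O : Oracle} {B : ℕ} {p : Program} {s s' : Memory} {n : ℕ}
    (h : Runs O B p s s' n) {k : ℕ} (hk : k ∉ p.writes) : s' k = s k :=
  h.2.choose_spec.2.frame hk

/-! ### The tables computed by the algorithm -/

/-- Euler's method for `y' = -x y` with step `1 / E`: an approximation of
`E² exp (-(k / E)² / 2)`. -/
def gaussSeq (E : ℤ) : ℕ → ℤ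
  | 0 => E * E
  | k + 1 => gaussSeq E k - ((k : ℤ) * gaussSeq E k).fdiv (E * E)

/-- Partial sums of `gaussSeq`. -/
def gaussPartialSum (E : ℤ) (k : ℕ) : ℤ := ∑ i ∈ Finset.range k, gaussSeq E i

/-- An approximation of `2 E Φ(k / E)`, where `Φ` is the standard Gaussian distribution function,
for `|k| ≤ L`. -/
def cdfTable (E : ℤ) (L : ℕ) (k : ℤ) : ℤ :=
  if 0 ≤ k then E + (E * gaussPartialSum E k.toNat).fdiv (gaussPartialSum E L)
  else E - (E * gaussPartialSum E (-k).toNat).fdiv (gaussPartialSum E L)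

/-- For k ≤ E² the Euler multiplier 1 - k/E² lies in [0, 1], and the floor is exact enough to
preserve both signs. This range of k explains the side condition carried through all table lemmas.
-/
theorem gaussSeq_succ_bounds {E : ℤ} (hE : 0 < E) {k : ℕ} (hk : (k : ℤ) ≤ E * E)
    (h : 0 ≤ gaussSeq E k) : 0 ≤ gaussSeq E (k + 1) ∧ gaussSeq E (k + 1) ≤ gaussSeq E k := by
  have hEE : 0 < E * E := by positivity
  simp only [gaussSeq]
  rw [Int.fdiv_eq_ediv_of_nonneg _ hEE.le]
  have h1 : 0 ≤ (k : ℤ) * gaussSeq E k / (E * E) := Int.ediv_nonneg (by positivity) hEE.le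
  have h2 : (k : ℤ) * gaussSeq E k / (E * E) ≤ gaussSeq E k := by
    apply Int.ediv_le_of_le_mul hEE
    nlinarith
  omega

theorem gaussSeq_bounds {E : ℤ} (hE : 0 < E) {k : ℕ} (hk : (k : ℤ) ≤ E * E) :
    0 ≤ gaussSeq E k ∧ gaussSeq E k ≤ E * E := by
  induction k with
  | zero => simp only [gaussSeq]; exact ⟨by positivity, le_rfl⟩
  | succ k ih =>
    have hk' : (k : ℤ) ≤ E * E := by push_cast at hk; omega
    have := gaussSeq_succ_bounds hE hk' (ih hk').1
    exact ⟨this.1, this.2.trans (ih hk').2⟩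

theorem gaussPartialSum_succ (E : ℤ) (k : ℕ) : gaussPartialSum E (k + 1) = gaussPartialSum E k + gaussSeq E k :=
  Finset.sum_range_succ _ _

theorem gaussPartialSum_mono {E : ℤ} (hE : 0 < E) {k l : ℕ} (hkl : k ≤ l) (hl : (l : ℤ) ≤ E * E) :
    gaussPartialSum E k ≤ gaussPartialSum E l := by
  apply Finset.sum_le_sum_of_subset_of_nonneg (Finset.range_mono hkl)
  intro i hi _
  rw [Finset.mem_range] at hi
  exact (gaussSeq_bounds hE (by omega)).1

theorem gaussPartialSum_nonneg {E : ℤ} (hE : 0 < E) {l : ℕ} (hl : (l : ℤ) ≤ E * E) :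
    0 ≤ gaussPartialSum E l := by
  simpa [gaussPartialSum] using gaussPartialSum_mono hE (Nat.zero_le l) hl

theorem gaussPartialSum_pos {E : ℤ} (hE : 0 < E) {l : ℕ} (h : 1 ≤ l) (hl : (l : ℤ) ≤ E * E) :
    0 < gaussPartialSum E l := by
  have := gaussPartialSum_mono hE h hl
  have h1 : gaussPartialSum E 1 = E * E := by simp [gaussPartialSum, gaussSeq]
  have h2 : 0 < E * E := by positivity
  omega

theorem gaussPartialSum_le {E : ℤ} (hE : 0 < E) {l : ℕ} (hl : (l : ℤ) ≤ E * E) :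
    gaussPartialSum E l ≤ l * (E * E) := by
  calc gaussPartialSum E l ≤ ∑ i ∈ Finset.range l, E * E := by
        apply Finset.sum_le_sum
        intro i hi
        rw [Finset.mem_range] at hi
        exact (gaussSeq_bounds hE (by omega)).2
    _ = _ := by simp

theorem fdiv_gaussPartialSum_bounds {E : ℤ} (hE : 0 < E) {k l : ℕ} (hl1 : 1 ≤ l) (hkl : k ≤ l)
    (hl : (l : ℤ) ≤ E * E) :
    0 ≤ (E * gaussPartialSum E k).fdiv (gaussPartialSum E l) ∧ (E * gaussPartialSum E k).fdiv (gaussPartialSum E l) ≤ E := by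
  have h0 := gaussPartialSum_nonneg hE (l := k) (by omega)
  have h1 := gaussPartialSum_pos hE hl1 hl
  have h2 := gaussPartialSum_mono hE hkl hl
  rw [Int.fdiv_eq_ediv_of_nonneg _ h1.le]
  refine ⟨Int.ediv_nonneg (by positivity) h1.le, Int.ediv_le_of_le_mul h1 ?_⟩
  gcongr

theorem cdfTable_bounds {E : ℤ} (hE : 0 < E) {l : ℕ} (hl1 : 1 ≤ l) (hl : (l : ℤ) ≤ E * E) {k : ℤ}
    (hk : |k| ≤ l) : 0 ≤ cdfTable E l k ∧ cdfTable E l k ≤ 2 * E := by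
  rw [abs_le] at hk
  unfold cdfTable
  split_ifs with h
  · have := fdiv_gaussPartialSum_bounds hE hl1 (k := k.toNat) (by omega) hl
    omega
  · have := fdiv_gaussPartialSum_bounds hE hl1 (k := (-k).toNat) (by omega) hl
    omega

/-- The inverse step size of the tables. -/
def scale (r N : ℕ) : ℕ := 16 * r * N

/-- The number of steps of the tables. -/
def tableSize (r N : ℕ) : ℕ := 16 * r * scale r N

/-- The grid at which distribution functions are compared has `gridSize r N + 1` points. -/
def gridSize (r N : ℕ) : ℕ := 20 * r * scale r N

/-- The number of rounds of the greedy algorithm. -/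
def rounds (r N : ℕ) : ℕ := 4 * r * N * N

/-- The (approximate, scaled) distribution function of the `j`-th component at the `i`-th grid
point. -/
def feature (r N : ℕ) (j i : ℕ) : ℤ :=
  cdfTable (scale r N) (tableSize r N)
    (i - 10 * r * scale r N - 32 * (j - 3 * r * r) * N)

/-- The (approximate, scaled) distribution function of the unknown distribution at the `i`-th grid
point. -/
def answer (O : Oracle) (r N : ℕ) (i : ℕ) : ℤ := O (i - 10 * r * scale r N) (2 * scale r N)

/-- The accumulated discrepancy after `t` rounds if component `idx u` is chosen in round `u`. -/
def discrepancy (O : Oracle) (r N : ℕ) (idx : ℕ → ℕ) (t i : ℕ) : ℤ :=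
  ∑ u ∈ Finset.range t, (feature r N (idx u) i - answer O r N i)

/-- The inner product of the discrepancy with a component. -/
def score (O : Oracle) (r N : ℕ) (idx : ℕ → ℕ) (t j : ℕ) : ℤ :=
  ∑ i ∈ Finset.range (gridSize r N + 1), discrepancy O r N idx t i * feature r N j i

/-- The state of round t depends only on earlier choices, so the choice function may be redefined at
t without disturbing what is known about the past. -/
theorem discrepancy_congr {O : Oracle} {r N : ℕ} {idx idx' : ℕ → ℕ} {t : ℕ}
    (h : ∀ u < t, idx u = idx' u) (i : ℕ) :
    discrepancy O r N idx t i = discrepancy O r N idx' t i := by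
  apply Finset.sum_congr rfl
  intro u hu
  rw [h u (Finset.mem_range.1 hu)]

theorem score_congr {O : Oracle} {r N : ℕ} {idx idx' : ℕ → ℕ} {t : ℕ}
    (h : ∀ u < t, idx u = idx' u) (j : ℕ) : score O r N idx t j = score O r N idx' t j := by
  apply Finset.sum_congr rfl
  intro i _
  rw [discrepancy_congr h]

theorem scale_pos {r N : ℕ} (hr : 1 ≤ r) (hN : 1 ≤ N) : 0 < scale r N := by
  unfold scale; positivity

/-- Since 16r ≤ E = 16rN, the table stays inside the range k ≤ E² where the Euler recursion is
monotone and nonnegative. -/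
theorem tableSize_le {r N : ℕ} (hN : 1 ≤ N) :
    (tableSize r N : ℤ) ≤ (scale r N : ℤ) * scale r N := by
  unfold tableSize
  push_cast
  apply mul_le_mul_of_nonneg_right _ (by positivity)
  unfold scale; push_cast
  have : (1 : ℤ) ≤ N := by exact_mod_cast hN
  nlinarith [Nat.zero_le r]

theorem one_le_tableSize {r N : ℕ} (hr : 1 ≤ r) (hN : 1 ≤ N) : 1 ≤ tableSize r N := by
  unfold tableSize scale; apply Nat.succ_le_of_lt; positivity

/-- The grid contributes at most 10rE and the lattice at most 32·3r²·N = 6rE. The sum 16rE is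
exactly the length of the table. -/
theorem abs_feature_index_le {r N i j : ℕ} (hi : i ≤ gridSize r N) (hj : j ≤ 6 * r * r) :
    |((i : ℤ) - 10 * r * scale r N - 32 * (j - 3 * r * r) * N)| ≤ tableSize r N := by
  unfold gridSize at hi
  unfold tableSize
  have h1 : |(i : ℤ) - 10 * r * scale r N| ≤ 10 * r * scale r N := by
    have : (i : ℤ) ≤ 20 * r * scale r N := by exact_mod_cast hi
    rw [abs_le]; constructor <;> linarith
  have h2 : |32 * ((j : ℤ) - 3 * r * r) * N| ≤ 32 * (3 * r * r) * N := by
    have : (j : ℤ) ≤ 6 * r * r := by exact_mod_cast hj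
    rw [abs_mul, abs_mul, Nat.abs_cast]
    have : |(j : ℤ) - 3 * r * r| ≤ 3 * r * r := by rw [abs_le]; constructor <;> linarith
    norm_num only [abs_of_pos]
    gcongr
  refine (abs_sub _ _).trans ((add_le_add h1 h2).trans (le_of_eq ?_))
  unfold scale; push_cast; ring

theorem feature_bounds {r N i j : ℕ} (hr : 1 ≤ r) (hN : 1 ≤ N) (hi : i ≤ gridSize r N)
    (hj : j ≤ 6 * r * r) : 0 ≤ feature r N j i ∧ feature r N j i ≤ 2 * scale r N :=
  cdfTable_bounds (by exact_mod_cast scale_pos hr hN) (one_le_tableSize hr hN) (tableSize_le hN)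
    (abs_feature_index_le hi hj)

theorem abs_answer_le {O : Oracle} (hO : ∀ a m : ℤ, 1 ≤ m → |O a m| ≤ m + 1) {r N : ℕ}
    (hr : 1 ≤ r) (hN : 1 ≤ N) (i : ℕ) : |answer O r N i| ≤ 2 * scale r N + 1 :=
  hO _ _ (by have := scale_pos hr hN; omega)

theorem abs_feature_sub_answer_le {O : Oracle} (hO : ∀ a m : ℤ, 1 ≤ m → |O a m| ≤ m + 1)
    {r N i j : ℕ} (hr : 1 ≤ r) (hN : 1 ≤ N) (hi : i ≤ gridSize r N) (hj : j ≤ 6 * r * r) :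
    |feature r N j i - answer O r N i| ≤ 4 * scale r N + 1 := by
  have h1 := feature_bounds hr hN hi hj
  have h2 := abs_answer_le hO hr hN i
  rw [abs_le] at *; omega

theorem abs_discrepancy_le {O : Oracle} (hO : ∀ a m : ℤ, 1 ≤ m → |O a m| ≤ m + 1)
    {r N i : ℕ} {idx : ℕ → ℕ} (hr : 1 ≤ r) (hN : 1 ≤ N) (hi : i ≤ gridSize r N)
    (hj : ∀ u, idx u ≤ 6 * r * r) (t : ℕ) :
    |discrepancy O r N idx t i| ≤ t * (4 * scale r N + 1) := by
  refine (Finset.abs_sum_le_sum_abs _ _).trans ?_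
  refine (Finset.sum_le_sum fun u _ => abs_feature_sub_answer_le hO hr hN hi (hj u)).trans ?_
  simp

/-! ### The program -/

section

open Expr Program

/-- Find the least `r ≥ 1` with `N < 2 ^ (r ^ 2)`. -/
def resolutionProgram : Program :=
  -- With r in array 4, arrays 5 and 6 hold 2^(r²) and 2^(2r+1); since (r+1)² = r² + (2r+1), both
  -- are updated by a multiplication.
  .seq (.store 4 0 1) <| .seq (.store 5 0 2) <| .seq (.store 6 0 8) <|
    .while (var 0 + 1 - var 5) <|
      .seq (.store 5 0 (var 5 * var 6)) <| .seq (.store 6 0 (4 * var 6)) (.store 4 0 (var 4 + 1))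

/-- Compute `gaussPartialSum`. -/
def gaussPartialSumProgram : Program :=
  .seq (.store 16 0 (var 7 * var 7)) <| .seq (.store 17 0 0) <|
    forLoop 8 (16 * var 4 * var 7) <|
      .seq (.store 16 (var 8 + 1)
        (get 16 (var 8) - (var 8 * get 16 (var 8)) / (var 7 * var 7)))
        (.store 17 (var 8 + 1) (get 17 (var 8) + get 16 (var 8)))

/-- Compute `cdfTable`. -/
def cdfTableProgram : Program :=
  forLoop 8 (16 * var 4 * var 7 + 1) <|
    .seq (.store 18 (var 8)
      (var 7 + (var 7 * get 17 (var 8)) / get 17 (16 * var 4 * var 7)))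
      (.store 18 (0 - var 8)
        (var 7 - (var 7 * get 17 (var 8)) / get 17 (16 * var 4 * var 7)))

/-- Compute the score of a component. -/
def scoreProgram : Program :=
  .seq (.store 12 0 0) <|
    forLoop 9 (20 * var 4 * var 7 + 1) <|
      .store 12 0 (var 12 + get 19 (var 9) *
        get 18 (var 9 - 10 * var 4 * var 7 - 32 * (var 10 - 3 * var 4 * var 4) * var 0))

/-- Find the component with the least score. -/
def argminProgram : Program :=
  forLoop 10 (6 * var 4 * var 4 + 1) <|
    .seq scoreProgram <|
      -- For component 0 the test equals 1, so the stale best value is always replaced. For a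
      -- component j ≥ 1 it is j·(best - score) + 1 - j, positive exactly when the integer score is
      -- strictly smaller than the best one.
      .ite ((var 13 - var 12) * var 10 + (1 - var 10))
        (.seq (.store 13 0 (var 12)) (.store 14 0 (var 10))) .skip

/-- Update the discrepancy. -/
def updateProgram : Program :=
  forLoop 9 (20 * var 4 * var 7 + 1) <|
    .seq (.store 15 0 (query (var 9 - 10 * var 4 * var 7) (2 * var 7))) <|
      .store 19 (var 9) (get 19 (var 9) +
        get 18 (var 9 - 10 * var 4 * var 7 - 32 * (var 14 - 3 * var 4 * var 4) * var 0) - var 15)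

/-- The greedy algorithm. -/
def greedyProgram : Program :=
  forLoop 11 (4 * var 4 * var 0 * var 0) <|
    .seq argminProgram <| .seq updateProgram (.store 1 (var 14) (get 1 (var 14) + 1))

/-- Write the output. -/
def outputProgram : Program :=
  .seq (forLoop 10 (6 * var 4 * var 4 + 1)
    -- Over the common denominator 4rN² the mean (j - 3r²)/r has numerator 4(j - 3r²)N², and the
    -- variance 1/4 has numerator rN².
    (.seq (.store 2 (var 10) ((var 10 - 3 * var 4 * var 4) * 4 * var 0 * var 0))
      (.store 3 (var 10) (var 4 * var 0 * var 0)))) <|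
  -- The denominator is written first: cell 0 of array 0 still holds N, which it needs.
  .seq (.store 0 1 (4 * var 4 * var 0 * var 0)) (.store 0 0 (6 * var 4 * var 4 + 1))

/-- The learning algorithm. -/
def learner : Program :=
  .seq resolutionProgram <| .seq (.store 7 0 (16 * var 4 * var 0)) <|
  .seq gaussPartialSumProgram <| .seq cdfTableProgram <| .seq greedyProgram outputProgram

/-- A bound for the contents of all cells. -/
def cellBound (N : ℕ) : ℕ := (100 * N) ^ 10

theorem le_cellBound {N : ℕ} (hN : 1 ≤ N) (c a : ℕ) (hc : c ≤ 100 ^ 10) (ha : a ≤ 10) :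
    c * N ^ a ≤ cellBound N := by
  unfold cellBound
  rw [mul_pow]
  exact Nat.mul_le_mul hc (Nat.pow_le_pow_right hN ha)

theorem abs_le_cellBound {N : ℕ} (hN : 1 ≤ N) (c a : ℕ) (hc : c ≤ 100 ^ 10) (ha : a ≤ 10) {z : ℤ}
    (h : |z| ≤ c * (N : ℤ) ^ a) : |z| ≤ cellBound N :=
  h.trans (by exact_mod_cast le_cellBound hN c a hc ha)

theorem hundred_le_cellBound {N : ℕ} (hN : 1 ≤ N) : 100 ≤ cellBound N := by
  simpa using le_cellBound hN 100 0 (by norm_num) (by norm_num)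

/-- Bounds the search for r: it stops at the latest when r reaches N. -/
theorem self_lt_two_pow_sq (n : ℕ) : n < 2 ^ n ^ 2 :=
  Nat.lt_two_pow_self.trans_le (Nat.pow_le_pow_right (by norm_num) (Nat.le_self_pow (by norm_num) n))

theorem resolution_le {r N : ℕ} (hr : 1 ≤ r) (h : 2 ^ (r - 1) ^ 2 ≤ N) : r ≤ N := by
  have := self_lt_two_pow_sq (r - 1)
  omega

theorem resolutionProgram_runs {N : ℕ} (hN : 1 ≤ N) (O : Oracle) {s : Memory}
    (hs : s.Bounded (cellBound N)) (h0 : s 0 0 = N) :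
    ∃ (r : ℕ) (s' : Memory), Runs O (cellBound N) resolutionProgram s s' (4 * N + 10) ∧ 1 ≤ r ∧
      N < 2 ^ r ^ 2 ∧ 2 ^ (r - 1) ^ 2 ≤ N ∧ s' 4 0 = r := by
  have hB := hundred_le_cellBound hN
  -- The fuel d satisfies N ≤ r + d, so at d = 0 the loop test already fails.
  have loop : ∀ (d r : ℕ) (s : Memory), N ≤ r + d → 1 ≤ r → 2 ^ (r - 1) ^ 2 ≤ N → s.Bounded (cellBound N) →
      s 0 0 = N → s 4 0 = r → s 5 0 = 2 ^ r ^ 2 → s 6 0 = 2 ^ (2 * r + 1) →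
      ∃ (r : ℕ) (s' : Memory), Runs O (cellBound N) (.while (var 0 + 1 - var 5) <|
      .seq (.store 5 0 (var 5 * var 6)) <| .seq (.store 6 0 (4 * var 6)) (.store 4 0 (var 4 + 1)))
        s s' (4 * d + 1) ∧ 1 ≤ r ∧ N < 2 ^ r ^ 2 ∧ 2 ^ (r - 1) ^ 2 ≤ N ∧ s' 4 0 = r := by
    intro d
    induction d with
    | zero =>
      intro r s hd hr hr' hs h0 h4 h5 h6
      have : N < 2 ^ r ^ 2 := lt_of_le_of_lt hd (self_lt_two_pow_sq r)
      refine ⟨r, s, Runs.while_nonpos hB hs ⟨rfl, by decide⟩ ?_, hr, this, hr', h4⟩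
      simp only [eval_sub, eval_add, eval_var, eval_one, h0, h5]
      have : (N : ℤ) < 2 ^ r ^ 2 := by exact_mod_cast this
      linarith
    | succ d ih =>
      intro r s hd hr hr' hs h0 h4 h5 h6
      by_cases hc : N < 2 ^ r ^ 2
      · refine ⟨r, s, (Runs.while_nonpos hB hs ⟨rfl, by decide⟩ ?_).mono (by omega), hr, hc, hr',
          h4⟩
        simp only [eval_sub, eval_add, eval_var, eval_one, h0, h5]
        have : (N : ℤ) < 2 ^ r ^ 2 := by exact_mod_cast hc
        linarith
      · rw [not_lt] at hc
        have hrN := resolution_le hr hr'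
        -- From (r - 1)² ≥ 0 one gets 2r + 1 ≤ r² + 2, so this cell is linear in N while the loop
        -- runs.
        have e1 : 2 ^ (2 * r + 1) ≤ 4 * N := by
          calc 2 ^ (2 * r + 1) ≤ 2 ^ (2 + r ^ 2) := Nat.pow_le_pow_right (by norm_num) (by
                nlinarith [sq_nonneg ((r : ℤ) - 1)])
            _ = 4 * 2 ^ r ^ 2 := by rw [pow_add]; norm_num
            _ ≤ _ := by omega
        have w1 : Runs O (cellBound N) (.store 5 0 (var 5 * var 6)) s
            (s.write 5 0 (2 ^ (r + 1) ^ 2)) 1 := by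
          refine Runs.store hB hs ⟨rfl, by decide⟩ ⟨rfl, by decide⟩ rfl ?_ ?_
          · simp only [eval_mul, eval_var, h5, h6, ← pow_add]; congr 1; ring
          · apply abs_le_cellBound hN 4 2 (by norm_num) (by norm_num)
            rw [abs_of_nonneg (by positivity)]
            have : 2 ^ (r + 1) ^ 2 = 2 ^ r ^ 2 * 2 ^ (2 * r + 1) := by
              rw [← pow_add]; congr 1; ring
            have : 2 ^ (r + 1) ^ 2 ≤ 4 * N ^ 2 := by
              rw [this]; exact (Nat.mul_le_mul hc e1).trans (le_of_eq (by ring))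
            exact_mod_cast this
        have w2 : Runs O (cellBound N) (.store 6 0 (4 * var 6)) (s.write 5 0 (2 ^ (r + 1) ^ 2))
            ((s.write 5 0 (2 ^ (r + 1) ^ 2)).write 6 0 (2 ^ (2 * (r + 1) + 1))) 1 := by
          refine Runs.store hB w1.1 ⟨rfl, by decide⟩ ⟨rfl, by decide⟩ rfl ?_ ?_
          · simp [eval_mul, eval_var, eval_ofNat, h6, Memory.write_array_ne]; ring
          · apply abs_le_cellBound hN 16 1 (by norm_num) (by norm_num)
            rw [abs_of_nonneg (by positivity)]
            have : 2 ^ (2 * (r + 1) + 1) ≤ 16 * N ^ 1 := by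
              rw [show 2 * (r + 1) + 1 = 2 + (2 * r + 1) by ring, pow_add, pow_one]; omega
            exact_mod_cast this
        have w3 : Runs O (cellBound N) (.store 4 0 (var 4 + 1))
            ((s.write 5 0 (2 ^ (r + 1) ^ 2)).write 6 0 (2 ^ (2 * (r + 1) + 1)))
            (((s.write 5 0 (2 ^ (r + 1) ^ 2)).write 6 0 (2 ^ (2 * (r + 1) + 1))).write 4 0
              ((r : ℤ) + 1)) 1 := by
          refine Runs.store hB w2.1 ⟨rfl, by decide⟩ ⟨rfl, by decide⟩ rfl ?_ ?_
          · simp [eval_add, eval_var, eval_one, h4, Memory.write_array_ne]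
          · apply abs_le_cellBound hN 2 1 (by norm_num) (by norm_num)
            rw [abs_of_nonneg (by positivity)]
            have : (r : ℤ) ≤ N := by exact_mod_cast hrN
            have : (1 : ℤ) ≤ N := by exact_mod_cast hN
            push_cast; linarith
        obtain ⟨r', s', hrun, h⟩ := ih (r + 1) _ (by omega) (by omega) (by simpa using hc) w3.1
          (by simpa [Memory.write_array_ne] using h0) (by simp [Memory.write_same])
          (by simp [Memory.write_array_ne, Memory.write_same])
          (by simp [Memory.write_array_ne, Memory.write_same])
        refine ⟨r', s', (Runs.while_pos hB hs ⟨rfl, by decide⟩ ?_ (w1.seq (w2.seq w3)) hrun).mono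
          (by omega), h⟩
        simp only [eval_sub, eval_add, eval_var, eval_one, h0, h5]
        have : (2 : ℤ) ^ r ^ 2 ≤ N := by exact_mod_cast hc
        linarith
  have w1 : Runs O (cellBound N) (.store 4 0 1) s (s.write 4 0 1) 1 :=
    Runs.store hB hs ⟨rfl, by decide⟩ ⟨rfl, by decide⟩ rfl rfl (by rw [abs_one]; omega)
  have w2 : Runs O (cellBound N) (.store 5 0 2) (s.write 4 0 1) ((s.write 4 0 1).write 5 0 2) 1 :=
    Runs.store hB w1.1 ⟨rfl, by decide⟩ ⟨rfl, by decide⟩ rfl rfl (by rw [abs_two]; omega)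
  have w3 : Runs O (cellBound N) (.store 6 0 8) ((s.write 4 0 1).write 5 0 2)
      (((s.write 4 0 1).write 5 0 2).write 6 0 8) 1 :=
    Runs.store hB w2.1 ⟨rfl, by decide⟩ ⟨rfl, by decide⟩ rfl rfl
      (by rw [abs_of_nonneg (by norm_num)]; omega)
  obtain ⟨r, s', hrun, h⟩ := loop N 1 _ (by omega) le_rfl (by simpa using hN) w3.1
    (by simpa [Memory.write_array_ne] using h0)
    (by simp [Memory.write_array_ne, Memory.write_same])
    (by simp [Memory.write_array_ne, Memory.write_same])
    (by simp [Memory.write_same])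
  exact ⟨r, s', (w1.seq (w2.seq (w3.seq hrun))).mono (by omega), h⟩

/-! ### Polynomial size bounds for the tables -/

theorem scale_le {r N : ℕ} (hr : r ≤ N) : (scale r N : ℤ) ≤ 16 * (N : ℤ) ^ 2 := by
  have : scale r N ≤ 16 * N ^ 2 := by
    unfold scale; nlinarith [Nat.mul_le_mul_right N hr]
  exact_mod_cast this

theorem tableSize_le_pow {r N : ℕ} (hr : r ≤ N) : (tableSize r N : ℤ) ≤ 256 * (N : ℤ) ^ 3 := by
  have h := scale_le hr
  have : (r : ℤ) ≤ N := by exact_mod_cast hr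
  unfold tableSize; push_cast
  calc 16 * (r : ℤ) * scale r N ≤ 16 * N * (16 * (N : ℤ) ^ 2) := by gcongr
    _ = _ := by ring

theorem gridSize_le_pow {r N : ℕ} (hr : r ≤ N) : (gridSize r N : ℤ) ≤ 320 * (N : ℤ) ^ 3 := by
  have h := scale_le hr
  have : (r : ℤ) ≤ N := by exact_mod_cast hr
  unfold gridSize; push_cast
  calc 20 * (r : ℤ) * scale r N ≤ 20 * N * (16 * (N : ℤ) ^ 2) := by gcongr
    _ = _ := by ring

theorem rounds_le_pow {r N : ℕ} (hr : r ≤ N) : (rounds r N : ℤ) ≤ 4 * (N : ℤ) ^ 3 := by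
  have : (r : ℤ) ≤ N := by exact_mod_cast hr
  unfold rounds; push_cast
  calc 4 * (r : ℤ) * N * N ≤ 4 * N * N * N := by gcongr
    _ = _ := by ring

theorem one_le_cast_pow {N : ℕ} (hN : 1 ≤ N) (a : ℕ) : (1 : ℤ) ≤ (N : ℤ) ^ a :=
  one_le_pow₀ (by exact_mod_cast hN)

theorem gaussSeq_abs_le {r N : ℕ} (hr1 : 1 ≤ r) (hr : r ≤ N) {k : ℕ} (hk : k ≤ tableSize r N) :
    |gaussSeq (scale r N) k| ≤ cellBound N := by
  have hN : 1 ≤ N := hr1.trans hr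
  have hE : (0 : ℤ) < scale r N := by exact_mod_cast scale_pos hr1 hN
  have h := gaussSeq_bounds hE (k := k)
    ((by exact_mod_cast hk : (k : ℤ) ≤ tableSize r N).trans (tableSize_le hN))
  apply abs_le_cellBound hN 256 4 (by norm_num) (by norm_num)
  rw [abs_of_nonneg h.1]
  calc _ ≤ _ := h.2
    _ ≤ (16 * (N : ℤ) ^ 2) * (16 * (N : ℤ) ^ 2) := by gcongr <;> exact scale_le hr
    _ = _ := by push_cast; ring

theorem gaussPartialSum_abs_le {r N : ℕ} (hr1 : 1 ≤ r) (hr : r ≤ N) {k : ℕ}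
    (hk : k ≤ tableSize r N) : |gaussPartialSum (scale r N) k| ≤ cellBound N := by
  have hN : 1 ≤ N := hr1.trans hr
  have hE : (0 : ℤ) < scale r N := by exact_mod_cast scale_pos hr1 hN
  have hk0 : (k : ℤ) ≤ tableSize r N := by exact_mod_cast hk
  have hk' := hk0.trans (tableSize_le hN)
  apply abs_le_cellBound hN 65536 7 (by norm_num) (by norm_num)
  rw [abs_of_nonneg (gaussPartialSum_nonneg hE hk')]
  calc _ ≤ _ := gaussPartialSum_le hE hk'
    _ ≤ (256 * (N : ℤ) ^ 3) * ((16 * (N : ℤ) ^ 2) * (16 * (N : ℤ) ^ 2)) := by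
      gcongr
      exacts [hk0.trans (tableSize_le_pow hr), scale_le hr, scale_le hr]
    _ = _ := by push_cast; ring

theorem le_cellBound_of_le {N : ℕ} (hN : 1 ≤ N) (c a : ℕ) (hc : c ≤ 100 ^ 10) (ha : a ≤ 10) {z : ℕ}
    (h : (z : ℤ) ≤ c * (N : ℤ) ^ a) : z ≤ cellBound N :=
  (by exact_mod_cast h : z ≤ c * N ^ a).trans (le_cellBound hN c a hc ha)

theorem tableSize_lt_cellBound {r N : ℕ} (hN : 1 ≤ N) (hr : r ≤ N) :
    tableSize r N + 1 ≤ cellBound N := by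
  apply le_cellBound_of_le hN 257 3 (by norm_num) (by norm_num)
  have := tableSize_le_pow hr
  have := one_le_cast_pow hN 3
  push_cast; linarith

theorem gridSize_lt_cellBound {r N : ℕ} (hN : 1 ≤ N) (hr : r ≤ N) :
    gridSize r N + 1 ≤ cellBound N := by
  apply le_cellBound_of_le hN 321 3 (by norm_num) (by norm_num)
  have := gridSize_le_pow hr
  have := one_le_cast_pow hN 3
  push_cast; linarith

/-! ### Correctness and step counts of the subprograms -/

theorem gaussPartialSumProgram_runs {r N : ℕ} (hr1 : 1 ≤ r) (hr : r ≤ N) (O : Oracle) {s : Memory}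
    (hs : s.Bounded (cellBound N)) (h4 : s 4 0 = r) (h7 : s 7 0 = scale r N) :
    ∃ s', Runs O (cellBound N) gaussPartialSumProgram s s' (4 * tableSize r N + 4) ∧
      ∀ k ≤ tableSize r N, s' 17 k = gaussPartialSum (scale r N) k := by
  have hN : 1 ≤ N := hr1.trans hr
  have hB := hundred_le_cellBound hN
  set E : ℤ := ((scale r N : ℕ) : ℤ)
  set B := cellBound N
  have w1 : Runs O B (.store 16 0 (var 7 * var 7)) s (s.write 16 0 (gaussSeq E 0)) 1 := by
    refine Runs.store hB hs ⟨rfl, by decide⟩ ⟨rfl, by decide⟩ rfl ?_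
      (gaussSeq_abs_le hr1 hr (Nat.zero_le _))
    simp [eval_mul, eval_var, h7, gaussSeq]
  have w2 : Runs O B (.store 17 0 0) (s.write 16 0 (gaussSeq E 0))
      ((s.write 16 0 (gaussSeq E 0)).write 17 0 0) 1 :=
    Runs.store hB w1.1 ⟨rfl, by decide⟩ ⟨rfl, by decide⟩ rfl rfl (by simp)
  obtain ⟨s', hr', hI⟩ := Runs.forLoop (L := tableSize r N) (m := 2) (k := 8) (O := O) hB w2.1
    (e := 16 * var 4 * var 7)
    (p := .seq (.store 16 (var 8 + 1)
        (get 16 (var 8) - (var 8 * get 16 (var 8)) / (var 7 * var 7)))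
        (.store 17 (var 8 + 1) (get 17 (var 8) + get 16 (var 8))))
    ⟨rfl, by decide⟩ (by have := tableSize_lt_cellBound hN hr; omega)
    (fun n s₁ => s₁ 4 0 = r ∧ s₁ 7 0 = E ∧ s₁ 16 n = gaussSeq E n ∧
      ∀ k : ℕ, k ≤ n → s₁ 17 k = gaussPartialSum E k)
    (by
      refine ⟨?_, ?_, ?_, ?_⟩
      · simpa [Memory.write_array_ne] using h4
      · simpa [Memory.write_array_ne] using h7
      · simp [Memory.write_array_ne, Memory.write_same]
      · intro k hk
        obtain rfl : k = 0 := by omega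
        simp [Memory.write_array_ne, Memory.write_same, gaussPartialSum])
    (by
      rintro n s₁ ⟨h4, h7, -⟩
      simp only [eval_mul, eval_var, eval_ofNat, h4, h7]
      simp [E, tableSize])
    (by
      rintro n hn s₁ hs₁ ⟨h4, h7, h16, h17⟩ h8
      have v1 : Runs O B (.store 16 (var 8 + 1)
          (get 16 (var 8) - (var 8 * get 16 (var 8)) / (var 7 * var 7))) s₁
          (s₁.write 16 ((n : ℤ) + 1) (gaussSeq E (n + 1))) 1 := by
        refine Runs.store hB hs₁ ⟨rfl, by decide⟩ ⟨rfl, by decide⟩ ?_ ?_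
          (gaussSeq_abs_le hr1 hr (by omega))
        · simp [eval_add, eval_var, eval_one, h8]
        · simp [eval_sub, eval_get, eval_div, eval_mul, eval_var, h8, h7, h16, gaussSeq]
      have v2 : Runs O B (.store 17 (var 8 + 1) (get 17 (var 8) + get 16 (var 8)))
          (s₁.write 16 ((n : ℤ) + 1) (gaussSeq E (n + 1)))
          ((s₁.write 16 ((n : ℤ) + 1) (gaussSeq E (n + 1))).write 17 ((n : ℤ) + 1)
            (gaussPartialSum E (n + 1))) 1 := by
        refine Runs.store hB v1.1 ⟨rfl, by decide⟩ ⟨rfl, by decide⟩ ?_ ?_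
          (gaussPartialSum_abs_le hr1 hr (by omega))
        · simp [eval_add, eval_var, eval_one, h8, Memory.write_array_ne]
        · simp [eval_add, eval_get, eval_var, h8, h16, h17 n le_rfl, gaussPartialSum_succ,
            Memory.write_array_ne, Memory.write_index_ne]
      refine ⟨_, v1.seq v2, by simp [Memory.write_array_ne, h8], ?_, ?_, ?_, ?_⟩
      · simp [Memory.write_array_ne, h4]
      · simp [Memory.write_array_ne, h7]
      · simp [Memory.write_array_ne, Memory.write_same]
      · intro k hk
        rcases Nat.lt_or_ge n k with h | h
        · obtain rfl : k = n + 1 := by omega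
          simp [Memory.write_array_ne, Memory.write_same]
        · have : (k : ℤ) ≠ n + 1 := by omega
          simp [Memory.write_array_ne, Memory.write_index_ne _ _ this, h17 k h])
  have hrun : Runs O B gaussPartialSumProgram s s' (1 + (1 + (tableSize r N * (2 + 2) + 2))) :=
    w1.seq (w2.seq hr')
  exact ⟨s', hrun.mono (by omega), fun k hk => hI.2.2.2 k hk⟩

theorem cdfTableProgram_runs {r N : ℕ} (hr1 : 1 ≤ r) (hr : r ≤ N) (O : Oracle) {s : Memory}
    (hs : s.Bounded (cellBound N)) (h4 : s 4 0 = r) (h7 : s 7 0 = scale r N)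
    (h17 : ∀ k ≤ tableSize r N, s 17 k = gaussPartialSum (scale r N) k) :
    ∃ s', Runs O (cellBound N) cdfTableProgram s s' (4 * tableSize r N + 6) ∧
      ∀ k : ℤ, |k| ≤ tableSize r N → s' 18 k = cdfTable (scale r N) (tableSize r N) k := by
  have hN : 1 ≤ N := hr1.trans hr
  have hB := hundred_le_cellBound hN
  have hE : (0 : ℤ) < scale r N := by exact_mod_cast scale_pos hr1 hN
  have hT := tableSize_le (r := r) hN
  have hT1 := one_le_tableSize hr1 hN
  have hEB : 2 * (scale r N : ℤ) ≤ cellBound N := by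
    have := le_cellBound hN 32 2 (by norm_num) (by norm_num)
    have h2 := scale_le hr
    have : (32 : ℤ) * N ^ 2 ≤ cellBound N := by exact_mod_cast this
    linarith
  set E : ℤ := ((scale r N : ℕ) : ℤ) with hEdef
  set B := cellBound N
  set L := tableSize r N with hL
  have hcT : ∀ n : ℕ, n ≤ L → cdfTable E L n =
      E + (E * gaussPartialSum E n).fdiv (gaussPartialSum E L) := by
    intro n _; simp [cdfTable]
  have hcT' : ∀ n : ℕ, n ≤ L → cdfTable E L (-(n : ℤ)) =
      E - (E * gaussPartialSum E n).fdiv (gaussPartialSum E L) := by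
    -- At n = 0 the second store overwrites cell 0; this is harmless because the empty partial sum
    -- vanishes and both formulas give E.
    intro n _
    rcases Nat.eq_zero_or_pos n with rfl | h
    · simp [cdfTable, gaussPartialSum]
    · rw [cdfTable, if_neg (by omega)]; simp
  have hcB : ∀ k : ℤ, |k| ≤ L → |cdfTable E L k| ≤ B := by
    intro k hk
    have := cdfTable_bounds hE hT1 hT hk
    rw [abs_of_nonneg this.1]; omega
  obtain ⟨s', hr', hI⟩ := Runs.forLoop (L := L + 1) (m := 2) (k := 8) (O := O) hB hs
    (e := 16 * var 4 * var 7 + 1)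
    (p := .seq (.store 18 (var 8)
      (var 7 + (var 7 * get 17 (var 8)) / get 17 (16 * var 4 * var 7)))
      (.store 18 (0 - var 8)
        (var 7 - (var 7 * get 17 (var 8)) / get 17 (16 * var 4 * var 7))))
    ⟨rfl, by decide⟩ (tableSize_lt_cellBound hN hr)
    (fun n s₁ => s₁ 4 0 = r ∧ s₁ 7 0 = E ∧ s₁ 17 = s 17 ∧
      ∀ k : ℤ, |k| < n → s₁ 18 k = cdfTable E L k)
    (by
      refine ⟨?_, ?_, ?_, ?_⟩
      · simpa [Memory.write_array_ne] using h4
      · simpa [Memory.write_array_ne] using h7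
      · simp [Memory.write_array_ne]
      · intro k hk
        have := abs_nonneg k
        simp at hk; omega)
    (by
      rintro n s₁ ⟨h4, h7, -⟩
      simp only [eval_mul, eval_var, eval_ofNat, h4, h7, eval_add]
      simp [E, L, tableSize])
    (by
      rintro n hn s₁ hs₁ ⟨h4, h7, h17', h18⟩ h8
      have hLe : (16 * (r : ℤ) * E) = (L : ℕ) := by simp [E, L, tableSize]
      have e17 : s₁ 17 n = gaussPartialSum E n := by rw [h17', h17 n (by omega)]
      have e17' : s₁ 17 (16 * (r : ℤ) * E) = gaussPartialSum E L := by
        rw [h17', hLe]; exact h17 L le_rfl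
      have v1 : Runs O B (.store 18 (var 8)
          (var 7 + (var 7 * get 17 (var 8)) / get 17 (16 * var 4 * var 7))) s₁
          (s₁.write 18 n (cdfTable E L n)) 1 := by
        refine Runs.store hB hs₁ ⟨rfl, by decide⟩ ⟨rfl, by decide⟩ ?_ ?_
          (hcB _ (by rw [Nat.abs_cast]; omega))
        · simp [eval_var, h8]
        · rw [hcT n (by omega)]
          simp [eval_add, eval_get, eval_div, eval_mul, eval_var, eval_ofNat, h8, h7, h4, e17, e17']
      have v2 : Runs O B (.store 18 (0 - var 8)
          (var 7 - (var 7 * get 17 (var 8)) / get 17 (16 * var 4 * var 7)))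
          (s₁.write 18 n (cdfTable E L n))
          ((s₁.write 18 n (cdfTable E L n)).write 18 (-(n : ℤ)) (cdfTable E L (-(n : ℤ)))) 1 := by
        refine Runs.store hB v1.1 ⟨rfl, by decide⟩ ⟨rfl, by decide⟩ ?_ ?_
          (hcB _ (by rw [abs_neg, Nat.abs_cast]; omega))
        · simp [eval_sub, eval_var, eval_zero, h8, Memory.write_array_ne]
        · rw [hcT' n (by omega)]
          simp [eval_sub, eval_get, eval_div, eval_mul, eval_var, eval_ofNat, h8, h7, h4, e17, e17',
            Memory.write_array_ne]
      refine ⟨_, v1.seq v2, by simp [Memory.write_array_ne, h8], ?_, ?_, ?_, ?_⟩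
      · simp [Memory.write_array_ne, h4]
      · simp [Memory.write_array_ne, h7]
      · simp [Memory.write_array_ne, h17']
      · intro k hk
        by_cases hk1 : k = -(n : ℤ)
        · subst hk1; simp [Memory.write_array_ne, Memory.write_same]
        · by_cases hk2 : k = n
          · subst hk2
            simp [Memory.write_array_ne, Memory.write_same, Memory.write_index_ne _ _ hk1]
          · have : |k| < n := by
              rw [abs_lt] at *; push_cast at hk; omega
            simp [Memory.write_array_ne, Memory.write_index_ne _ _ hk1,
              Memory.write_index_ne _ _ hk2, h18 k this])
  refine ⟨s', hr'.mono (by ring_nf; omega), fun k hk => hI.2.2.2 k (by push_cast; omega)⟩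

/-- These are the largest numbers that occur: O(N³) grid points, discrepancies O(N⁵) and features
O(N²). They dictate the exponent 10 in `cellBound`. Partial sums over n terms are included because
the accumulator passes through them. -/
theorem sum_mul_abs_le {r N : ℕ} (hr1 : 1 ≤ r) (hr : r ≤ N) {O : Oracle}
    (hO : ∀ a m : ℤ, 1 ≤ m → |O a m| ≤ m + 1) {idx : ℕ → ℕ} (hidx : ∀ u, idx u ≤ 6 * r * r)
    {t : ℕ} (ht : t ≤ rounds r N) {j : ℕ} (hj : j ≤ 6 * r * r) {n : ℕ}
    (hn : n ≤ gridSize r N + 1) :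
    |∑ i ∈ Finset.range n, discrepancy O r N idx t i * feature r N j i| ≤ cellBound N := by
  have hN : 1 ≤ N := hr1.trans hr
  have hN0 : (0 : ℤ) ≤ N := by positivity
  have hE := scale_le hr
  have h2 := one_le_cast_pow hN 2
  have h3 := one_le_cast_pow hN 3
  apply abs_le_cellBound hN (321 * 260 * 32) 10 (by norm_num) (by norm_num)
  have ht' : (t : ℤ) ≤ 4 * (N : ℤ) ^ 3 := (by exact_mod_cast ht : (t : ℤ) ≤ rounds r N).trans
    (rounds_le_pow hr)
  have hn' : (n : ℤ) ≤ 321 * (N : ℤ) ^ 3 := by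
    have := gridSize_le_pow hr
    have : (n : ℤ) ≤ gridSize r N + 1 := by exact_mod_cast hn
    linarith
  calc |∑ i ∈ Finset.range n, discrepancy O r N idx t i * feature r N j i|
      ≤ ∑ i ∈ Finset.range n, |discrepancy O r N idx t i * feature r N j i| :=
        Finset.abs_sum_le_sum_abs _ _
    _ ≤ ∑ i ∈ Finset.range n, (260 * (N : ℤ) ^ 5) * (32 * (N : ℤ) ^ 2) := by
        apply Finset.sum_le_sum
        intro i hi
        have hi' : i ≤ gridSize r N := by rw [Finset.mem_range] at hi; omega
        rw [abs_mul]
        have hf := feature_bounds hr1 hN hi' hj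
        have hf' : |feature r N j i| ≤ 32 * (N : ℤ) ^ 2 := by
          rw [abs_of_nonneg hf.1]; linarith
        have hd : |discrepancy O r N idx t i| ≤ 260 * (N : ℤ) ^ 5 := by
          refine (abs_discrepancy_le hO hr1 hN hi' hidx t).trans ?_
          calc (t : ℤ) * (4 * scale r N + 1) ≤ (4 * (N : ℤ) ^ 3) * (65 * (N : ℤ) ^ 2) := by
                gcongr; linarith
            _ = _ := by ring
        gcongr
    _ = n * ((260 * (N : ℤ) ^ 5) * (32 * (N : ℤ) ^ 2)) := by simp
    _ ≤ 321 * (N : ℤ) ^ 3 * ((260 * (N : ℤ) ^ 5) * (32 * (N : ℤ) ^ 2)) := by gcongr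
    _ = _ := by push_cast; ring

theorem discrepancy_abs_le_cellBound {r N : ℕ} (hr1 : 1 ≤ r) (hr : r ≤ N) {O : Oracle}
    (hO : ∀ a m : ℤ, 1 ≤ m → |O a m| ≤ m + 1) {idx : ℕ → ℕ} (hidx : ∀ u, idx u ≤ 6 * r * r)
    {t : ℕ} (ht : t ≤ rounds r N) {i : ℕ} (hi : i ≤ gridSize r N) :
    |discrepancy O r N idx t i| ≤ cellBound N := by
  have hN : 1 ≤ N := hr1.trans hr
  have hE := scale_le hr
  have h2 := one_le_cast_pow hN 2
  have ht' : (t : ℤ) ≤ 4 * (N : ℤ) ^ 3 := (by exact_mod_cast ht : (t : ℤ) ≤ rounds r N).trans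
    (rounds_le_pow hr)
  apply abs_le_cellBound hN 260 5 (by norm_num) (by norm_num)
  refine (abs_discrepancy_le hO hr1 hN hi hidx t).trans ?_
  calc (t : ℤ) * (4 * scale r N + 1) ≤ (4 * (N : ℤ) ^ 3) * (65 * (N : ℤ) ^ 2) := by
        gcongr; linarith
    _ = _ := by push_cast; ring

theorem sq_le_cellBound {r N : ℕ} (hr1 : 1 ≤ r) (hr : r ≤ N) : 6 * r * r + 1 ≤ cellBound N := by
  have hN : 1 ≤ N := hr1.trans hr
  refine le_trans ?_ (le_cellBound hN 7 2 (by norm_num) (by norm_num))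
  nlinarith [Nat.mul_le_mul hr hr, Nat.mul_le_mul hN hN]

/-- The cells that are not changed during the greedy algorithm. -/
structure Tables (r N : ℕ) (s : Memory) : Prop where
  input : s 0 0 = N
  resolution : s 4 0 = r
  scale : s 7 0 = scale r N
  table : ∀ k : ℤ, |k| ≤ tableSize r N → s 18 k = cdfTable (_root_.scale r N) (tableSize r N) k

theorem Tables.congr {r N : ℕ} {s s' : Memory} (h : Tables r N s) (h0 : s' 0 = s 0)
    (h4 : s' 4 = s 4) (h7 : s' 7 = s 7) (h18 : s' 18 = s 18) : Tables r N s' :=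
  ⟨by rw [h0, h.input], by rw [h4, h.resolution], by rw [h7, h.scale],
    fun k hk => by rw [h18, h.table k hk]⟩

theorem Tables.feature {r N : ℕ} {s : Memory} (h : Tables r N s) {i j : ℕ} (hi : i ≤ gridSize r N)
    (hj : j ≤ 6 * r * r) :
    s 18 (i - 10 * r * _root_.scale r N - 32 * (j - 3 * r * r) * N) = feature r N j i :=
  h.table _ (abs_feature_index_le hi hj)

theorem scoreProgram_runs {r N : ℕ} (hr1 : 1 ≤ r) (hr : r ≤ N) {O : Oracle}
    (hO : ∀ a m : ℤ, 1 ≤ m → |O a m| ≤ m + 1) {s : Memory}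
    (hs : s.Bounded (cellBound N)) (hT : Tables r N s) {idx : ℕ → ℕ}
    (hidx : ∀ u, idx u ≤ 6 * r * r) {t : ℕ} (ht : t ≤ rounds r N)
    (h19 : ∀ i ≤ gridSize r N, s 19 i = discrepancy O r N idx t i) {j : ℕ}
    (hj : j ≤ 6 * r * r) (h10 : s 10 0 = j) :
    ∃ s', Runs O (cellBound N) scoreProgram s s' (3 * gridSize r N + 6) ∧
      s' 12 0 = score O r N idx t j := by
  have hN : 1 ≤ N := hr1.trans hr
  have hB := hundred_le_cellBound hN
  have hG := gridSize_lt_cellBound hN hr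
  set B := cellBound N
  have w1 : Runs O B (.store 12 0 0) s (s.write 12 0 0) 1 :=
    Runs.store hB hs ⟨rfl, by decide⟩ ⟨rfl, by decide⟩ rfl rfl (by simp)
  obtain ⟨s', hr', hI⟩ := Runs.forLoop (L := gridSize r N + 1) (m := 1) (k := 9) (O := O) hB w1.1
    (e := 20 * var 4 * var 7 + 1)
    (p := .store 12 0 (var 12 + get 19 (var 9) *
        get 18 (var 9 - 10 * var 4 * var 7 - 32 * (var 10 - 3 * var 4 * var 4) * var 0)))
    ⟨rfl, by decide⟩ hG
    (fun n s₁ => (∀ k, k ≠ 9 → k ≠ 12 → s₁ k = s k) ∧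
      s₁ 12 0 = ∑ i ∈ Finset.range n, discrepancy O r N idx t i * feature r N j i)
    (by
      refine ⟨?_, ?_⟩
      · intro k h9 h12
        simp [Memory.write_array_ne _ h9, Memory.write_array_ne _ h12]
      · simp [Memory.write_array_ne, Memory.write_same])
    (by
      rintro n s₁ ⟨hs', -⟩
      simp only [eval_mul, eval_var, eval_ofNat, eval_add, hs' 4 (by decide) (by decide),
        hs' 7 (by decide) (by decide), hT.resolution, hT.scale]
      simp [gridSize])
    (by
      rintro n hn s₁ hs₁ ⟨hs', h12⟩ h9
      have hn' : n ≤ gridSize r N := by omega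
      have v1 : Runs O B (.store 12 0 (var 12 + get 19 (var 9) *
          get 18 (var 9 - 10 * var 4 * var 7 - 32 * (var 10 - 3 * var 4 * var 4) * var 0))) s₁
          (s₁.write 12 0 (∑ i ∈ Finset.range (n + 1),
            discrepancy O r N idx t i * feature r N j i)) 1 := by
        refine Runs.store hB hs₁ ⟨rfl, by decide⟩ ⟨rfl, by decide⟩ rfl ?_
          (sum_mul_abs_le hr1 hr hO hidx ht hj hn)
        have := hT.feature hn' hj
        simp only [eval_add, eval_mul, eval_sub, eval_get, eval_var, eval_ofNat, h9, h12,
          hs' 4 (by decide) (by decide), hs' 7 (by decide) (by decide),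
          hs' 19 (by decide) (by decide), hs' 18 (by decide) (by decide),
          hs' 10 (by decide) (by decide), hs' 0 (by decide) (by decide), hT.resolution, hT.scale,
          hT.input, h10, h19 n hn', Finset.sum_range_succ]
        congr 2
      refine ⟨_, v1, by simp [Memory.write_array_ne, h9], ?_, ?_⟩
      · intro k h9 h12
        simp [Memory.write_array_ne _ h9, Memory.write_array_ne _ h12, hs' k h9 h12]
      · simp [Memory.write_array_ne, Memory.write_same])
  exact ⟨s', (w1.seq hr').mono (by omega), hI.2⟩

theorem argminProgram_runs {r N : ℕ} (hr1 : 1 ≤ r) (hr : r ≤ N) {O : Oracle}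
    (hO : ∀ a m : ℤ, 1 ≤ m → |O a m| ≤ m + 1) {s : Memory}
    (hs : s.Bounded (cellBound N)) (hT : Tables r N s) {idx : ℕ → ℕ}
    (hidx : ∀ u, idx u ≤ 6 * r * r) {t : ℕ} (ht : t ≤ rounds r N)
    (h19 : ∀ i ≤ gridSize r N, s 19 i = discrepancy O r N idx t i) :
    ∃ s' m, Runs O (cellBound N) argminProgram s s'
        ((6 * r * r + 1) * (3 * gridSize r N + 11) + 2) ∧
      m ≤ 6 * r * r ∧ s' 14 0 = m ∧ ∀ j ≤ 6 * r * r, score O r N idx t m ≤ score O r N idx t j := by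
  have hN : 1 ≤ N := hr1.trans hr
  have hB := hundred_le_cellBound hN
  have hK := sq_le_cellBound hr1 hr
  have hscore : ∀ j ≤ 6 * r * r, |score O r N idx t j| ≤ cellBound N := fun j hj =>
    sum_mul_abs_le hr1 hr hO hidx ht hj le_rfl
  set B := cellBound N
  obtain ⟨s', hr', hI⟩ := Runs.forLoop (L := 6 * r * r + 1) (m := 3 * gridSize r N + 9) (k := 10)
    (O := O) hB hs
    (e := 6 * var 4 * var 4 + 1)
    (p := .seq scoreProgram <|
      .ite ((var 13 - var 12) * var 10 + (1 - var 10))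
        (.seq (.store 13 0 (var 12)) (.store 14 0 (var 10))) .skip)
    ⟨rfl, by decide⟩ hK
    -- Nothing is claimed about the running minimum at n = 0, when arrays 13 and 14 may hold
    -- leftovers of the previous round.
    (fun n s₁ => (∀ k, k ∉ [9, 10, 12, 13, 14] → s₁ k = s k) ∧
      (0 < n → ∃ m, m < n ∧ s₁ 14 0 = m ∧ s₁ 13 0 = score O r N idx t m ∧
        ∀ j < n, score O r N idx t m ≤ score O r N idx t j))
    (by
      refine ⟨?_, fun h => absurd h (lt_irrefl _)⟩
      intro k hk
      have : k ≠ 10 := by rintro rfl; simp at hk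
      simp [Memory.write_array_ne _ this])
    (by
      rintro n s₁ ⟨hs', -⟩
      simp only [eval_mul, eval_var, eval_ofNat, eval_add, hs' 4 (by decide),
        hT.resolution]
      simp)
    (by
      rintro n hn s₁ hs₁ ⟨hs', hm⟩ h10
      have hn' : n ≤ 6 * r * r := by omega
      have hT₁ : Tables r N s₁ := hT.congr (hs' 0 (by decide)) (hs' 4 (by decide))
        (hs' 7 (by decide)) (hs' 18 (by decide))
      obtain ⟨s₂, hr₂, h12⟩ := scoreProgram_runs hr1 hr hO hs₁ hT₁ hidx ht
        (fun i hi => by rw [hs' 19 (by decide), h19 i hi]) hn' h10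
      have fr : ∀ k, k ∉ [9, 12] → s₂ k = s₁ k := fun k hk => hr₂.frame (by
        simp [scoreProgram, forLoop, writes] at hk ⊢; tauto)
      have h10' : s₂ 10 0 = n := by rw [fr 10 (by decide), h10]
      have hfin : ∀ k, k ∉ [9, 10, 12, 13, 14] → s₂ k = s k := by
        intro k hk
        rw [fr k (by simp at hk ⊢; tauto), hs' k hk]
      by_cases hc : n = 0 ∨ score O r N idx t n < s₂ 13 0
      · have v1 : Runs O B (.store 13 0 (var 12)) s₂ (s₂.write 13 0 (score O r N idx t n)) 1 :=
          Runs.store hB hr₂.1 ⟨rfl, by decide⟩ ⟨rfl, by decide⟩ rfl h12 (hscore n hn')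
        have v2 : Runs O B (.store 14 0 (var 10)) (s₂.write 13 0 (score O r N idx t n))
            ((s₂.write 13 0 (score O r N idx t n)).write 14 0 n) 1 := by
          refine Runs.store hB v1.1 ⟨rfl, by decide⟩ ⟨rfl, by decide⟩ rfl ?_ ?_
          · simp [eval_var, Memory.write_array_ne, h10']
          · rw [Nat.abs_cast]; omega
        refine ⟨_, (hr₂.seq (Runs.ite_pos hB hr₂.1 ⟨rfl, by decide⟩ ?_ (v1.seq v2))).mono
          (by omega), by simp [Memory.write_array_ne, h10'], ?_, ?_⟩
        · simp only [eval_add, eval_mul, eval_sub, eval_var, eval_one, h12, h10']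
          rcases hc with rfl | hc
          · simp
          · have : (0 : ℤ) ≤ n := by positivity
            nlinarith
        · intro k hk
          have h10 : k ≠ 10 := by rintro rfl; simp at hk
          have h13 : k ≠ 13 := by rintro rfl; simp at hk
          have h14 : k ≠ 14 := by rintro rfl; simp at hk
          simp [Memory.write_array_ne _ h10, Memory.write_array_ne _ h13,
            Memory.write_array_ne _ h14, hfin k hk]
        · intro _
          refine ⟨n, by omega, by simp [Memory.write_array_ne, Memory.write_same],
            by simp [Memory.write_array_ne, Memory.write_same], ?_⟩
          intro j hj
          rcases Nat.lt_or_ge j n with h | h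
          · obtain ⟨m, -, -, h13, hmin⟩ := hm (by omega)
            rcases hc with h0 | hc
            · omega
            · rw [fr 13 (by decide), h13] at hc
              exact hc.le.trans (hmin j h)
          · obtain rfl : j = n := by omega
            rfl
      · push Not at hc
        refine ⟨s₂, (hr₂.seq (Runs.ite_nonpos hB hr₂.1 ⟨rfl, by decide⟩ ?_
          (Runs.skip hr₂.1))).mono (by omega), h10', ?_, ?_⟩
        · simp only [eval_add, eval_mul, eval_sub, eval_var, eval_one, h12, h10']
          have : (1 : ℤ) ≤ n := by exact_mod_cast Nat.one_le_iff_ne_zero.2 hc.1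
          nlinarith [hc.2]
        · intro k hk
          have h10 : k ≠ 10 := by rintro rfl; simp at hk
          simp [Memory.write_array_ne _ h10, hfin k hk]
        · intro _
          obtain ⟨m, hmn, h14, h13, hmin⟩ := hm (Nat.pos_of_ne_zero hc.1)
          have hc2 := hc.2
          rw [fr 13 (by decide), h13] at hc2
          refine ⟨m, by omega, by simp [Memory.write_array_ne, fr 14, h14],
            by simp [Memory.write_array_ne, fr 13, h13], ?_⟩
          intro j hj
          rcases Nat.lt_or_ge j n with h | h
          · exact hmin j h
          · obtain rfl : j = n := by omega
            exact hc2)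
  obtain ⟨m, hm, h14, -, hmin⟩ := hI.2 (by omega)
  exact ⟨s', m, hr', by omega, h14, fun j hj => hmin j (by omega)⟩

theorem discrepancy_succ (O : Oracle) (r N : ℕ) (idx : ℕ → ℕ) (t i : ℕ) :
    discrepancy O r N idx (t + 1) i =
      discrepancy O r N idx t i + (feature r N (idx t) i - answer O r N i) :=
  Finset.sum_range_succ _ _

theorem updateProgram_runs {r N : ℕ} (hr1 : 1 ≤ r) (hr : r ≤ N) {O : Oracle}
    (hO : ∀ a m : ℤ, 1 ≤ m → |O a m| ≤ m + 1) {s : Memory}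
    (hs : s.Bounded (cellBound N)) (hT : Tables r N s) {idx : ℕ → ℕ}
    (hidx : ∀ u, idx u ≤ 6 * r * r) {t : ℕ} (ht : t < rounds r N)
    (h19 : ∀ i ≤ gridSize r N, s 19 i = discrepancy O r N idx t i) (h14 : s 14 0 = idx t) :
    ∃ s', Runs O (cellBound N) updateProgram s s' (4 * gridSize r N + 6) ∧
      ∀ i ≤ gridSize r N, s' 19 i = discrepancy O r N idx (t + 1) i := by
  have hN : 1 ≤ N := hr1.trans hr
  have hB := hundred_le_cellBound hN
  have hG := gridSize_lt_cellBound hN hr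
  have hans : ∀ i, |answer O r N i| ≤ cellBound N := by
    intro i
    apply abs_le_cellBound hN 33 2 (by norm_num) (by norm_num)
    have h1 := abs_answer_le hO hr1 hN i
    have h2 := scale_le hr
    have h3 := one_le_cast_pow hN 2
    push_cast; linarith
  set B := cellBound N
  obtain ⟨s', hr', hI⟩ := Runs.forLoop (L := gridSize r N + 1) (m := 2) (k := 9) (O := O) hB hs
    (e := 20 * var 4 * var 7 + 1)
    (p := .seq (.store 15 0 (query (var 9 - 10 * var 4 * var 7) (2 * var 7))) <|
      .store 19 (var 9) (get 19 (var 9) +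
        get 18 (var 9 - 10 * var 4 * var 7 - 32 * (var 14 - 3 * var 4 * var 4) * var 0) - var 15))
    ⟨rfl, by decide⟩ hG
    (fun n s₁ => (∀ k, k ∉ [9, 15, 19] → s₁ k = s k) ∧
      -- In the middle of the sweep the entries below n already belong to round t + 1, the others
      -- still to round t.
      ∀ i ≤ gridSize r N, s₁ 19 i = discrepancy O r N idx (if i < n then t + 1 else t) i)
    (by
      refine ⟨?_, ?_⟩
      · intro k hk
        have h9 : k ≠ 9 := by rintro rfl; simp at hk
        simp [Memory.write_array_ne _ h9]
      · intro i hi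
        simp [Memory.write_array_ne, h19 i hi])
    (by
      rintro n s₁ ⟨hs', -⟩
      simp only [eval_mul, eval_var, eval_ofNat, eval_add, hs' 4 (by decide),
        hs' 7 (by decide), hT.resolution, hT.scale]
      simp [gridSize])
    (by
      rintro n hn s₁ hs₁ ⟨hs', hd⟩ h9
      have hn' : n ≤ gridSize r N := by omega
      have v1 : Runs O B (.store 15 0 (query (var 9 - 10 * var 4 * var 7) (2 * var 7))) s₁
          (s₁.write 15 0 (answer O r N n)) 1 := by
        refine Runs.store_query hB hs₁ ⟨rfl, by decide⟩ ⟨rfl, by decide⟩ ⟨rfl, by decide⟩ rfl ?_ ?_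
          (hans n)
        · simp [eval_sub, eval_mul, eval_var, eval_ofNat, h9, hs' 4, hs' 7, hT.resolution,
            hT.scale]
        · simp [eval_mul, eval_var, eval_ofNat, hs' 7, hT.scale]
      have v2 : Runs O B (.store 19 (var 9) (get 19 (var 9) +
          get 18 (var 9 - 10 * var 4 * var 7 - 32 * (var 14 - 3 * var 4 * var 4) * var 0) - var 15))
          (s₁.write 15 0 (answer O r N n))
          ((s₁.write 15 0 (answer O r N n)).write 19 n (discrepancy O r N idx (t + 1) n)) 1 := by
        refine Runs.store hB v1.1 ⟨rfl, by decide⟩ ⟨rfl, by decide⟩ ?_ ?_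
          (discrepancy_abs_le_cellBound hr1 hr hO hidx (by omega) hn')
        · simp [eval_var, Memory.write_array_ne, h9]
        · have hf := hT.feature hn' (hidx t)
          have hdn := hd n hn'
          rw [if_neg (lt_irrefl _)] at hdn
          have e19 : (s₁.write 15 0 (answer O r N n)) 19 = s₁ 19 :=
            Memory.write_array_ne _ (by decide) _ _
          have e18 : (s₁.write 15 0 (answer O r N n)) 18 = s 18 := by
            rw [Memory.write_array_ne _ (by decide), hs' 18 (by decide)]
          have e15 : (s₁.write 15 0 (answer O r N n)) 15 0 = answer O r N n :=
            Memory.write_same _ _ _ _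
          have e14 : (s₁.write 15 0 (answer O r N n)) 14 0 = idx t := by
            rw [Memory.write_array_ne _ (by decide), hs' 14 (by decide), h14]
          have e9 : (s₁.write 15 0 (answer O r N n)) 9 0 = n := by
            rw [Memory.write_array_ne _ (by decide), h9]
          have e7 : (s₁.write 15 0 (answer O r N n)) 7 0 = scale r N := by
            rw [Memory.write_array_ne _ (by decide), hs' 7 (by decide), hT.scale]
          have e4 : (s₁.write 15 0 (answer O r N n)) 4 0 = r := by
            rw [Memory.write_array_ne _ (by decide), hs' 4 (by decide), hT.resolution]
          have e0 : (s₁.write 15 0 (answer O r N n)) 0 0 = N := by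
            rw [Memory.write_array_ne _ (by decide), hs' 0 (by decide), hT.input]
          simp only [eval_add, eval_mul, eval_sub, eval_get, eval_var, eval_ofNat, e19, e18, e15,
            e14, e9, e7, e4, e0, hdn, discrepancy_succ, ← hf]
          push_cast; ring
      refine ⟨_, v1.seq v2, by simp [Memory.write_array_ne, h9], ?_, ?_⟩
      · intro k hk
        have h9 : k ≠ 9 := by rintro rfl; simp at hk
        have h15 : k ≠ 15 := by rintro rfl; simp at hk
        have h19 : k ≠ 19 := by rintro rfl; simp at hk
        simp [Memory.write_array_ne _ h9, Memory.write_array_ne _ h15, Memory.write_array_ne _ h19,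
          hs' k hk]
      · intro i hi
        by_cases hin : i = n
        · subst hin
          simp [Memory.write_array_ne, Memory.write_same]
        · have h1 : (i : ℤ) ≠ n := by exact_mod_cast hin
          have h2 : i < n + 1 ↔ i < n := by omega
          simp [Memory.write_array_ne, Memory.write_index_ne _ _ h1, hd i hi, h2])
  refine ⟨s', hr'.mono (by omega), fun i hi => ?_⟩
  rw [hI.2 i hi, if_pos (by omega)]

/-- In each of the first `t` rounds, a component of least score is chosen. -/
structure Greedy (O : Oracle) (r N : ℕ) (idx : ℕ → ℕ) (t : ℕ) : Prop where
  index_le : ∀ u, idx u ≤ 6 * r * r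
  score_le : ∀ u < t, ∀ j ≤ 6 * r * r, score O r N idx u (idx u) ≤ score O r N idx u j

/-- The number of times component `j` is chosen in the first `t` rounds. -/
def visits (idx : ℕ → ℕ) (t j : ℕ) : ℕ := ((Finset.range t).filter (idx · = j)).card

theorem visits_succ (idx : ℕ → ℕ) (t j : ℕ) :
    visits idx (t + 1) j = visits idx t j + if idx t = j then 1 else 0 := by
  unfold visits
  rw [Finset.range_add_one, Finset.filter_insert]
  split_ifs with h
  · rw [Finset.card_insert_of_notMem (by simp)]
  · simp

theorem visits_congr {idx idx' : ℕ → ℕ} {t : ℕ} (h : ∀ u < t, idx u = idx' u) (j : ℕ) :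
    visits idx t j = visits idx' t j := by
  unfold visits
  congr 1
  apply Finset.filter_congr
  intro u hu
  rw [h u (Finset.mem_range.1 hu)]

theorem visits_le (idx : ℕ → ℕ) (t j : ℕ) : visits idx t j ≤ t :=
  (Finset.card_filter_le _ _).trans (by simp)

/-- A bound for the number of elementary steps in a round. -/
def roundSteps (r N : ℕ) : ℕ :=
  (6 * r * r + 1) * (3 * gridSize r N + 11) + 4 * gridSize r N + 11

theorem greedyProgram_runs {r N : ℕ} (hr1 : 1 ≤ r) (hr : r ≤ N) {O : Oracle}
    (hO : ∀ a m : ℤ, 1 ≤ m → |O a m| ≤ m + 1) {s : Memory}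
    (hs : s.Bounded (cellBound N)) (hT : Tables r N s)
    (h1 : ∀ j, s 1 j = 0) (h19 : ∀ j, s 19 j = 0) :
    ∃ s' idx, Runs O (cellBound N) greedyProgram s s' (rounds r N * (roundSteps r N + 2) + 2) ∧
      Greedy O r N idx (rounds r N) ∧ ∀ j : ℕ, s' 1 j = visits idx (rounds r N) j := by
  have hN : 1 ≤ N := hr1.trans hr
  have hB := hundred_le_cellBound hN
  have hTB : rounds r N ≤ cellBound N :=
    le_cellBound_of_le hN 4 3 (by norm_num) (by norm_num) (by exact_mod_cast rounds_le_pow hr)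
  set B := cellBound N
  obtain ⟨s', hr', idx, hg, hI⟩ := Runs.forLoop (L := rounds r N) (m := roundSteps r N) (k := 11)
    (O := O) hB hs
    (e := 4 * var 4 * var 0 * var 0)
    (p := .seq argminProgram <| .seq updateProgram (.store 1 (var 14) (get 1 (var 14) + 1)))
    ⟨rfl, by decide⟩ hTB
    -- The sequence of choices is a ghost variable, not stored in memory; each round produces a new
    -- function that agrees with the old one before t.
    (fun t s₁ => ∃ idx, Greedy O r N idx t ∧
      (∀ k ∈ [0, 4, 7, 18], s₁ k = s k) ∧
      (∀ i ≤ gridSize r N, s₁ 19 i = discrepancy O r N idx t i) ∧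
      ∀ j : ℕ, s₁ 1 j = visits idx t j)
    (by
      refine ⟨fun _ => 0, ⟨by simp, by simp⟩, ?_, ?_, ?_⟩
      · intro k hk
        have : k ≠ 11 := by rintro rfl; simp at hk
        simp [Memory.write_array_ne _ this]
      · intro i hi
        simp [Memory.write_array_ne, h19, discrepancy]
      · intro j
        simp [Memory.write_array_ne, h1, visits])
    (by
      rintro t s₁ ⟨-, -, hs', -⟩
      simp only [eval_mul, eval_var, eval_ofNat, hs' 4 (by decide), hs' 0 (by decide),
        hT.resolution, hT.input]
      simp [rounds])
    (by
      rintro t ht s₁ hs₁ ⟨idx, hg, hs', hd, hc⟩ h11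
      have hT₁ : Tables r N s₁ := hT.congr (hs' 0 (by decide)) (hs' 4 (by decide))
        (hs' 7 (by decide)) (hs' 18 (by decide))
      obtain ⟨s₂, m, hr₂, hm, h14, hmin⟩ := argminProgram_runs hr1 hr hO hs₁ hT₁ hg.index_le ht.le hd
      have fr₂ : ∀ k, k ∉ argminProgram.writes → s₂ k = s₁ k := fun k hk => hr₂.frame hk
      have hT₂ : Tables r N s₂ := hT₁.congr (fr₂ 0 (by decide)) (fr₂ 4 (by decide))
        (fr₂ 7 (by decide)) (fr₂ 18 (by decide))
      set idx' : ℕ → ℕ := fun u => if u = t then m else idx u with hidx'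
      have hcongr : ∀ u < t, idx u = idx' u := fun u hu => by simp [hidx', hu.ne]
      have hidxt : idx' t = m := by simp [hidx']
      have hg' : Greedy O r N idx' (t + 1) := by
        refine ⟨fun u => ?_, fun u hu j hj => ?_⟩
        · by_cases hut : u = t
          · simp [hidx', hut, hm]
          · simp [hidx', hut, hg.index_le u]
        · have hc' : ∀ v < u, idx v = idx' v := fun v hv => hcongr v (by omega)
          rw [← score_congr hc', ← score_congr hc']
          rcases Nat.lt_or_ge u t with h | h
          · rw [← hcongr u h]; exact hg.score_le u h j hj
          · obtain rfl : u = t := by omega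
            rw [hidxt]; exact hmin j hj
      obtain ⟨s₃, hr₃, hd₃⟩ := updateProgram_runs hr1 hr hO hr₂.1 hT₂ hg'.index_le ht
        (fun i hi => by rw [fr₂ 19 (by decide), hd i hi, discrepancy_congr hcongr])
        (by rw [h14, hidxt])
      have fr₃ : ∀ k, k ∉ updateProgram.writes → s₃ k = s₂ k := fun k hk => hr₃.frame hk
      have h14' : s₃ 14 0 = m := by rw [fr₃ 14 (by decide), h14]
      have h1' : ∀ j : ℕ, s₃ 1 j = visits idx' t j := by
        intro j
        rw [fr₃ 1 (by decide), fr₂ 1 (by decide), hc, visits_congr hcongr]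
      have v3 : Runs O B (.store 1 (var 14) (get 1 (var 14) + 1)) s₃
          (s₃.write 1 m (visits idx' (t + 1) m)) 1 := by
        refine Runs.store hB hr₃.1 ⟨rfl, by decide⟩ ⟨rfl, by decide⟩ h14' ?_ ?_
        · simp [eval_add, eval_get, eval_var, eval_one, h14', h1', visits_succ, hidxt]
        · rw [Nat.abs_cast]
          have := visits_le idx' (t + 1) m
          omega
      refine ⟨_, (hr₂.seq (hr₃.seq v3)).mono (by unfold roundSteps; omega), ?_, idx', hg', ?_, ?_,
        ?_⟩
      · rw [Memory.write_array_ne _ (by decide), fr₃ 11 (by decide), fr₂ 11 (by decide), h11]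
      · intro k hk
        have h11 : k ≠ 11 := by rintro rfl; simp at hk
        have h1 : k ≠ 1 := by rintro rfl; simp at hk
        rw [Memory.write_array_ne _ h11, Memory.write_array_ne _ h1, ← hs' k hk]
        simp only [List.mem_cons, List.not_mem_nil, or_false] at hk
        rcases hk with rfl | rfl | rfl | rfl <;>
          rw [fr₃ _ (by decide), fr₂ _ (by decide)]
      · intro i hi
        rw [Memory.write_array_ne _ (by decide), Memory.write_array_ne _ (by decide), hd₃ i hi]
      · intro j
        rw [Memory.write_array_ne _ (by decide)]
        by_cases hjm : j = m
        · subst hjm; rw [Memory.write_same]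
        · rw [Memory.write_index_ne _ _ (by exact_mod_cast hjm), h1', visits_succ, hidxt,
            if_neg (Ne.symm hjm), add_zero])
  exact ⟨s', idx, hr', hg, hI.2.2⟩

theorem outputProgram_runs {r N : ℕ} (hr1 : 1 ≤ r) (hr : r ≤ N) (O : Oracle) {s : Memory}
    (hs : s.Bounded (cellBound N)) (h0 : s 0 0 = N) (h4 : s 4 0 = r) :
    ∃ s', Runs O (cellBound N) outputProgram s s' (4 * (6 * r * r) + 10) ∧
      s' 0 0 = 6 * r * r + 1 ∧ s' 0 1 = rounds r N ∧
      (∀ j : ℕ, j ≤ 6 * r * r → s' 2 j = (j - 3 * r * r) * 4 * N * N) ∧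
      (∀ j : ℕ, j ≤ 6 * r * r → s' 3 j = r * N * N) := by
  have hN : 1 ≤ N := hr1.trans hr
  have hB := hundred_le_cellBound hN
  have hK := sq_le_cellBound hr1 hr
  have hTB : rounds r N ≤ cellBound N :=
    le_cellBound_of_le hN 4 3 (by norm_num) (by norm_num) (by exact_mod_cast rounds_le_pow hr)
  have hrN : (r : ℤ) ≤ N := by exact_mod_cast hr
  have hmean : ∀ j : ℕ, j ≤ 6 * r * r → |((j : ℤ) - 3 * r * r) * 4 * N * N| ≤ cellBound N := by
    intro j hj
    have : (j : ℤ) ≤ 6 * r * r := by exact_mod_cast hj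
    apply abs_le_cellBound hN 12 4 (by norm_num) (by norm_num)
    have h1 : |(j : ℤ) - 3 * r * r| ≤ 3 * N * N := by
      calc |(j : ℤ) - 3 * r * r| ≤ 3 * r * r := by rw [abs_le]; constructor <;> linarith
        _ ≤ _ := by gcongr
    rw [abs_mul, abs_mul, abs_mul, Nat.abs_cast, abs_of_pos (by norm_num : (0 : ℤ) < 4)]
    calc _ ≤ 3 * (N : ℤ) * N * 4 * N * N := by gcongr
      _ = _ := by push_cast; ring
  have hvar : |(r : ℤ) * N * N| ≤ cellBound N := by
    apply abs_le_cellBound hN 1 3 (by norm_num) (by norm_num)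
    rw [abs_of_nonneg (by positivity)]
    calc (r : ℤ) * N * N ≤ N * N * N := by gcongr
      _ = _ := by push_cast; ring
  set B := cellBound N
  obtain ⟨s', hr', hs', h2, h3⟩ := Runs.forLoop (L := 6 * r * r + 1) (m := 2) (k := 10)
    (O := O) hB hs
    (e := 6 * var 4 * var 4 + 1)
    (p := .seq (.store 2 (var 10) ((var 10 - 3 * var 4 * var 4) * 4 * var 0 * var 0))
      (.store 3 (var 10) (var 4 * var 0 * var 0)))
    ⟨rfl, by decide⟩ hK
    (fun n s₁ => (∀ k ∈ [0, 4], s₁ k = s k) ∧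
      (∀ j : ℕ, j < n → s₁ 2 j = (j - 3 * r * r) * 4 * N * N) ∧
      (∀ j : ℕ, j < n → s₁ 3 j = r * N * N))
    (by
      refine ⟨?_, by simp, by simp⟩
      intro k hk
      have : k ≠ 10 := by rintro rfl; simp at hk
      simp [Memory.write_array_ne _ this])
    (by
      rintro n s₁ ⟨hs', -⟩
      simp only [eval_mul, eval_var, eval_ofNat, eval_add, hs' 4 (by decide), h4]
      simp)
    (by
      rintro n hn s₁ hs₁ ⟨hs', h2, h3⟩ h10
      have e4 : s₁ 4 0 = r := by rw [hs' 4 (by decide), h4]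
      have e0 : s₁ 0 0 = N := by rw [hs' 0 (by decide), h0]
      have v1 : Runs O B (.store 2 (var 10) ((var 10 - 3 * var 4 * var 4) * 4 * var 0 * var 0)) s₁
          (s₁.write 2 n ((n - 3 * r * r) * 4 * N * N)) 1 := by
        refine Runs.store hB hs₁ ⟨rfl, by decide⟩ ⟨rfl, by decide⟩ h10 ?_ (hmean n (by omega))
        simp only [eval_mul, eval_sub, eval_var, eval_ofNat, e4, e0, h10]
        push_cast; rfl
      have v2 : Runs O B (.store 3 (var 10) (var 4 * var 0 * var 0))
          (s₁.write 2 n ((n - 3 * r * r) * 4 * N * N))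
          ((s₁.write 2 n ((n - 3 * r * r) * 4 * N * N)).write 3 n (r * N * N)) 1 := by
        refine Runs.store hB v1.1 ⟨rfl, by decide⟩ ⟨rfl, by decide⟩ ?_ ?_ hvar
        · simp [eval_var, Memory.write_array_ne, h10]
        · simp [eval_mul, eval_var, Memory.write_array_ne, e4, e0]
      refine ⟨_, v1.seq v2, by simp [Memory.write_array_ne, h10], ?_, ?_, ?_⟩
      · intro k hk
        have h10 : k ≠ 10 := by rintro rfl; simp at hk
        have h2 : k ≠ 2 := by rintro rfl; simp at hk
        have h3 : k ≠ 3 := by rintro rfl; simp at hk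
        simp [Memory.write_array_ne _ h10, Memory.write_array_ne _ h2, Memory.write_array_ne _ h3,
          hs' k hk]
      · intro j hj
        by_cases hjn : j = n
        · subst hjn; simp [Memory.write_array_ne, Memory.write_same]
        · have : (j : ℤ) ≠ n := by exact_mod_cast hjn
          simp [Memory.write_array_ne, Memory.write_index_ne _ _ this, h2 j (by omega)]
      · intro j hj
        by_cases hjn : j = n
        · subst hjn; simp [Memory.write_array_ne, Memory.write_same]
        · have : (j : ℤ) ≠ n := by exact_mod_cast hjn
          simp [Memory.write_array_ne, Memory.write_index_ne _ _ this, h3 j (by omega)])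
  have e4 : s' 4 0 = r := by rw [hs' 4 (by decide), h4]
  have e0 : s' 0 0 = N := by rw [hs' 0 (by decide), h0]
  have w1 : Runs O B (.store 0 1 (4 * var 4 * var 0 * var 0)) s'
      (s'.write 0 1 (rounds r N)) 1 := by
    refine Runs.store hB hr'.1 ⟨rfl, by decide⟩ ⟨rfl, by decide⟩ rfl ?_ ?_
    · simp [eval_mul, eval_var, eval_ofNat, e4, e0, rounds]
    · rw [Nat.abs_cast]; exact_mod_cast hTB
  have w2 : Runs O B (.store 0 0 (6 * var 4 * var 4 + 1)) (s'.write 0 1 (rounds r N))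
      ((s'.write 0 1 (rounds r N)).write 0 0 (6 * r * r + 1)) 1 := by
    refine Runs.store hB w1.1 ⟨rfl, by decide⟩ ⟨rfl, by decide⟩ rfl ?_ ?_
    · simp [eval_add, eval_mul, eval_var, eval_ofNat, e4, Memory.write_array_ne]
    · rw [abs_of_nonneg (by positivity)]; exact_mod_cast hK
  have hrun : Runs O B outputProgram s _ ((6 * r * r + 1) * (2 + 2) + 2 + (1 + 1)) :=
    hr'.seq (w1.seq w2)
  refine ⟨_, hrun.mono (by omega), by rw [Memory.write_same], ?_, ?_, ?_⟩
  · rw [Memory.write_index_ne _ _ (by decide), Memory.write_same]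
  · intro j hj
    simp [Memory.write_array_ne, h2 j (by omega)]
  · intro j hj
    simp [Memory.write_array_ne, h3 j (by omega)]

/-- What the algorithm computes on input `N`. -/
structure LearnerOutput (O : Oracle) (N r : ℕ) (idx : ℕ → ℕ) (s : Memory) : Prop where
  one_le : 1 ≤ r
  lt_two_pow : N < 2 ^ r ^ 2
  two_pow_le : 2 ^ (r - 1) ^ 2 ≤ N
  greedy : Greedy O r N idx (rounds r N)
  size : s 0 0 = 6 * r * r + 1
  denominator : s 0 1 = rounds r N
  weight : ∀ j : ℕ, s 1 j = visits idx (rounds r N) j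
  mean : ∀ j : ℕ, j ≤ 6 * r * r → s 2 j = (j - 3 * r * r) * 4 * N * N
  variance : ∀ j : ℕ, j ≤ 6 * r * r → s 3 j = r * N * N

/-- Halting and the step count need nothing about the unknown distribution beyond the size of the
oracle answers. The count is dominated by O(N³) rounds, each scoring O(N²) components on O(N³) grid
points, so O(N⁸) steps. -/
theorem learner_runs {N : ℕ} (hN : 1 ≤ N) {O : Oracle}
    (hO : ∀ a m : ℤ, 1 ≤ m → |O a m| ≤ m + 1) :
    ∃ r idx s, Runs O (cellBound N) learner (inputMemory N) s (cellBound N) ∧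
      LearnerOutput O N r idx s := by
  have hB := hundred_le_cellBound hN
  have hNB : N ≤ cellBound N := by simpa using le_cellBound hN 1 1 (by norm_num) (by norm_num)
  have hs : (inputMemory N).Bounded (cellBound N) := by
    refine Memory.Bounded.write (fun k j => by simp) _ _ ?_
    rw [Nat.abs_cast]; exact_mod_cast hNB
  have hz : ∀ k, k ≠ 0 → ∀ j, inputMemory N k j = 0 := fun k hk j => by
    rw [inputMemory, Memory.write_array_ne _ hk]
  obtain ⟨r, s₁, hr₁, h1r, hlt, hle, h4⟩ := resolutionProgram_runs hN O hs
    (Memory.write_same _ _ _ _)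
  have hr := resolution_le h1r hle
  have hE := scale_le hr
  have e0 : s₁ 0 0 = N := by rw [hr₁.frame (by decide)]; exact Memory.write_same _ _ _ _
  have hsB : |(scale r N : ℤ)| ≤ cellBound N := by
    apply abs_le_cellBound hN 16 2 (by norm_num) (by norm_num)
    rw [Nat.abs_cast]; exact hE
  have w : Runs O (cellBound N) (.store 7 0 (16 * var 4 * var 0)) s₁ (s₁.write 7 0 (scale r N)) 1 := by
    refine Runs.store hB hr₁.1 ⟨rfl, by decide⟩ ⟨rfl, by decide⟩ rfl ?_ hsB
    simp [eval_mul, eval_var, eval_ofNat, e0, h4, scale]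
  set s₂ := s₁.write 7 0 (scale r N) with hs₂
  have h7 : s₂ 7 0 = scale r N := Memory.write_same _ _ _ _
  have f₂ : ∀ k, k ≠ 7 → s₂ k = s₁ k := fun k hk => Memory.write_array_ne _ hk _ _
  obtain ⟨s₃, hr₃, h17⟩ := gaussPartialSumProgram_runs h1r hr O w.1
    (by rw [f₂ 4 (by decide), h4]) h7
  obtain ⟨s₄, hr₄, h18⟩ := cdfTableProgram_runs h1r hr O hr₃.1
    (by rw [hr₃.frame (by decide), f₂ 4 (by decide), h4]) (by rw [hr₃.frame (by decide), h7]) h17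
  have hT : Tables r N s₄ := by
    refine ⟨?_, ?_, ?_, h18⟩
    · rw [hr₄.frame (by decide), hr₃.frame (by decide), f₂ 0 (by decide), e0]
    · rw [hr₄.frame (by decide), hr₃.frame (by decide), f₂ 4 (by decide), h4]
    · rw [hr₄.frame (by decide), hr₃.frame (by decide), h7]
  have hzero : ∀ k ∈ [1, 19], ∀ j, s₄ k j = 0 := by
    intro k hk j
    simp only [List.mem_cons, List.not_mem_nil, or_false] at hk
    rcases hk with rfl | rfl <;>
      rw [hr₄.frame (by decide), hr₃.frame (by decide), f₂ _ (by decide), hr₁.frame (by decide),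
        hz _ (by decide)]
  obtain ⟨s₅, idx, hr₅, hg, hmul⟩ := greedyProgram_runs h1r hr hO hr₄.1 hT
    (hzero 1 (by decide)) (hzero 19 (by decide))
  obtain ⟨s₆, hr₆, h00, h01, h2, h3⟩ := outputProgram_runs h1r hr O hr₅.1
    (by rw [hr₅.frame (by decide), hT.input]) (by rw [hr₅.frame (by decide), hT.resolution])
  refine ⟨r, idx, s₆, ?_, h1r, hlt, hle, hg, h00, h01, ?_, h2, h3⟩
  · have hrun : Runs O (cellBound N) learner (inputMemory N) s₆ _ :=
      hr₁.seq (w.seq (hr₃.seq (hr₄.seq (hr₅.seq hr₆))))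
    apply hrun.mono
    have hp : ∀ a b : ℕ, a ≤ b → N ^ a ≤ N ^ b := fun a b h => Nat.pow_le_pow_right hN h
    have hG : gridSize r N ≤ 320 * N ^ 3 := by exact_mod_cast gridSize_le_pow hr
    have hTs : tableSize r N ≤ 256 * N ^ 3 := by exact_mod_cast tableSize_le_pow hr
    have hR : rounds r N ≤ 4 * N ^ 3 := by exact_mod_cast rounds_le_pow hr
    have hrr : 6 * r * r ≤ 6 * N ^ 2 := by nlinarith [Nat.mul_le_mul hr hr]
    have h08 : 1 ≤ N ^ 8 := Nat.one_le_pow _ _ hN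
    have h18 : N ≤ N ^ 8 := Nat.le_self_pow (by norm_num) N
    have h28 := hp 2 8 (by norm_num)
    have h38 := hp 3 8 (by norm_num)
    have h58 := hp 5 8 (by norm_num)
    have h02 : 1 ≤ N ^ 2 := Nat.one_le_pow _ _ hN
    have h03 : 1 ≤ N ^ 3 := Nat.one_le_pow _ _ hN
    have h35 := hp 3 5 (by norm_num)
    have h05 : 1 ≤ N ^ 5 := Nat.one_le_pow _ _ hN
    have hstep : roundSteps r N + 2 ≤ 10000 * N ^ 5 := by
      unfold roundSteps
      calc _ ≤ (7 * N ^ 2) * (971 * N ^ 3) + 4 * (320 * N ^ 3) + 11 + 2 := by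
            gcongr
            · omega
            · omega
        _ = 6797 * N ^ 5 + 1280 * N ^ 3 + 13 := by ring
        _ ≤ _ := by omega
    have hprod : rounds r N * (roundSteps r N + 2) ≤ 40000 * N ^ 8 := by
      calc _ ≤ (4 * N ^ 3) * (10000 * N ^ 5) := Nat.mul_le_mul hR hstep
        _ = _ := by ring
    have := le_cellBound hN 100000 8 (by norm_num) (by norm_num)
    omega
  · intro j
    rw [hr₆.frame (by decide), hmul]

end

/-! ### Discretizing Gaussian mixtures -/

open Real in
theorem hasSum_int_ne_zero_pow {q : ℝ} (h0 : 0 ≤ q) (h1 : q < 1) :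
    HasSum (fun n : ℤ => if n = 0 then 0 else q ^ n.natAbs) (2 * (q / (1 - q))) := by
  have hg : HasSum (fun n : ℕ => q ^ (n + 1)) (q / (1 - q)) := by
    have := (hasSum_geometric_of_lt_one h0 h1).mul_left q
    simpa [pow_succ', div_eq_mul_inv] using this
  have e : ∀ n : ℕ, ((n : ℤ) + 1).natAbs = n + 1 := fun n => by omega
  rw [two_mul]
  apply HasSum.of_nat_of_neg_add_one
  · have h := (hasSum_nat_add_iff
      (f := fun n : ℕ => if (n : ℤ) = 0 then (0 : ℝ) else q ^ (n : ℤ).natAbs) 1).1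
      (by simpa [Nat.cast_add_one_ne_zero, e] using hg)
    simpa using h
  · convert hg using 2 with n
    rw [if_neg (by omega)]
    congr 1

open Complex in
-- The term n = 0 equals 1. As n² ≥ |n|, the others are dominated by two geometric series with ratio
-- exp(-A) ≤ 1/2.
theorem norm_theta_sub_one_le {A : ℝ} (hA : 2 ≤ A) (β : ℝ) :
    ‖(∑' n : ℤ, cexp (-A * n ^ 2 + β * n * I)) - 1‖ ≤ 4 * Real.exp (-A) := by
  set q := Real.exp (-A) with hq
  have hq0 : 0 < q := Real.exp_pos _
  have hq1 : q ≤ 1 / 2 := by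
    have h2 : Real.exp (-A) ≤ Real.exp (-1) := Real.exp_le_exp.2 (by linarith)
    have := Real.exp_neg_one_lt_d9
    linarith
  have hG := hasSum_int_ne_zero_pow hq0.le (by linarith : q < 1)
  have hnorm : ∀ n : ℤ, ‖cexp (-A * n ^ 2 + β * n * I)‖ ≤ q ^ n.natAbs := by
    intro n
    rw [Complex.norm_exp]
    have : (-A * (n : ℂ) ^ 2 + β * n * I).re = -A * (n : ℝ) ^ 2 := by
      have : (-A * (n : ℂ) ^ 2 + β * n * I) = ((-A * (n : ℝ) ^ 2 : ℝ) : ℂ) + ((β * n : ℝ) : ℂ) * I := by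
        push_cast; ring
      rw [this, Complex.add_re, Complex.re_ofReal_mul, Complex.I_re, Complex.ofReal_re]; ring
    rw [this, hq, ← Real.exp_nat_mul]
    apply Real.exp_le_exp.2
    have h1 : (n.natAbs : ℝ) ≤ (n : ℝ) ^ 2 := by
      have h := Nat.le_self_pow two_ne_zero n.natAbs
      rw [← Int.cast_natCast, ← Int.cast_pow, Int.cast_le, ← Int.natAbs_sq]
      exact_mod_cast h
    nlinarith
  set F : ℤ → ℂ := fun n => if n = 0 then 0 else cexp (-A * n ^ 2 + β * n * I) with hF
  have hFb : ∀ n, ‖F n‖ ≤ if n = 0 then 0 else q ^ n.natAbs := by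
    intro n
    simp only [hF]
    split_ifs with h
    · simp
    · exact hnorm n
  have hFs : Summable F := Summable.of_norm_bounded hG.summable hFb
  have h0 : HasSum (fun n : ℤ => if n = 0 then (1 : ℂ) else 0) 1 := hasSum_ite_eq 0 1
  have hsum : HasSum (fun n : ℤ => cexp (-A * n ^ 2 + β * n * I)) (1 + ∑' n, F n) := by
    convert h0.add hFs.hasSum using 2 with n
    simp only [hF]
    split_ifs with h
    · simp [h]
    · simp
  rw [hsum.tsum_eq, add_sub_cancel_left]
  refine (tsum_of_norm_bounded hG hFb).trans ?_
  have h3 : q / (1 - q) ≤ 2 * q := by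
    rw [div_le_iff₀ (by linarith)]; nlinarith
  linarith

open Complex in
-- Poisson summation: the Riemann sum with step 1/r of a Gaussian density of variance c is a theta
-- series with A = 2π²cr². The condition c ≥ 1/8 gives A ≥ 2r² because π² ≥ 8, so the sum differs
-- from the integral 1 by an exponentially small amount, uniformly in the shift m.
theorem hasSum_gaussian_lattice {r c : ℝ} (hr : 1 ≤ r) (hc : 1 / 8 ≤ c) (m : ℝ) :
    ∃ S : ℝ, HasSum (fun j : ℤ => r⁻¹ * ((√(2 * Real.pi * c))⁻¹ *
      Real.exp (-(j / r - m) ^ 2 / (2 * c)))) S ∧ |S - 1| ≤ 4 * Real.exp (-2 * r ^ 2) := by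
  have hr0 : 0 < r := by linarith
  have hc0 : 0 < c := by linarith
  have hpi := Real.pi_gt_three
  have hpi0 := Real.pi_pos
  have hpiC : (Real.pi : ℂ) ≠ 0 := by exact_mod_cast hpi0.ne'
  have hrC : (r : ℂ) ≠ 0 := by exact_mod_cast hr0.ne'
  have hcC : (c : ℂ) ≠ 0 := by exact_mod_cast hc0.ne'
  set a : ℝ := (2 * Real.pi * c * r ^ 2)⁻¹ with ha
  have ha0 : 0 < a := by positivity
  set b : ℝ := m / (2 * Real.pi * c * r) with hb
  set A : ℝ := 2 * Real.pi ^ 2 * c * r ^ 2 with hA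
  have hA2 : 2 * r ^ 2 ≤ A := by
    rw [hA]; gcongr; nlinarith
  have key := Complex.tsum_exp_neg_quadratic (a := a) (by simpa using ha0) (b : ℂ)
  set f : ℤ → ℝ := fun j => r⁻¹ * ((√(2 * Real.pi * c))⁻¹ *
      Real.exp (-(j / r - m) ^ 2 / (2 * c))) with hf
  set K : ℝ := r⁻¹ * (√(2 * Real.pi * c))⁻¹ * Real.exp (-m ^ 2 / (2 * c)) with hK
  have e1 : ∀ j : ℤ, ((f j : ℝ) : ℂ) =
      K * cexp (-Real.pi * a * j ^ 2 + 2 * Real.pi * b * j) := by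
    intro j
    have : cexp (-Real.pi * a * j ^ 2 + 2 * Real.pi * b * j) =
        ((Real.exp (-Real.pi * a * j ^ 2 + 2 * Real.pi * b * j) : ℝ) : ℂ) := by
      push_cast; rfl
    rw [this, ← Complex.ofReal_mul]
    congr 1
    rw [hf, hK]
    simp only
    rw [← mul_assoc, mul_assoc _ (Real.exp _), ← Real.exp_add]
    congr 2
    rw [ha, hb]
    field_simp
    ring
  have e2 : ∀ n : ℤ, cexp (-Real.pi / a * (n + I * b) ^ 2) = Real.exp (m ^ 2 / (2 * c)) *
      cexp (-A * n ^ 2 + (-2 * Real.pi * m * r : ℝ) * n * I) := by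
    intro n
    rw [Complex.ofReal_exp, ← Complex.exp_add]
    congr 1
    rw [hA, ha, hb]
    push_cast
    field_simp
    ring_nf
    rw [Complex.I_sq]
    ring
  simp_rw [e2] at key
  rw [tsum_mul_left] at key
  have hsqrt : (a : ℂ) ^ (1 / 2 : ℂ) = ((√a : ℝ) : ℂ) := by
    rw [Real.sqrt_eq_rpow, Complex.ofReal_cpow ha0.le]; norm_num
  have hsa : √a = r⁻¹ * (√(2 * Real.pi * c))⁻¹ := by
    rw [ha, Real.sqrt_inv, Real.sqrt_mul (by positivity), Real.sqrt_sq hr0.le, mul_inv, mul_comm]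
  set T := ∑' n : ℤ, cexp (-A * n ^ 2 + (-2 * Real.pi * m * r : ℝ) * n * I) with hT
  have hfT : ((∑' j, f j : ℝ) : ℂ) = T := by
    rw [Complex.ofReal_tsum]
    simp_rw [e1]
    rw [tsum_mul_left, key, hsqrt, hK, ← hsa]
    have h1 : (Real.exp (-m ^ 2 / (2 * c)) : ℂ) * Real.exp (m ^ 2 / (2 * c)) = 1 := by
      rw [← Complex.ofReal_mul, ← Real.exp_add]
      rw [show -m ^ 2 / (2 * c) + m ^ 2 / (2 * c) = 0 by ring]; simp
    have h2 : ((√a : ℝ) : ℂ) ≠ 0 := by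
      exact_mod_cast (Real.sqrt_pos.2 ha0).ne'
    push_cast at h1 h2 ⊢
    calc _ = (((√a : ℝ) : ℂ) * (1 / ((√a : ℝ) : ℂ))) *
          (cexp (-m ^ 2 / (2 * c)) * cexp (m ^ 2 / (2 * c))) * T := by ring
      _ = T := by rw [h1, mul_one_div_cancel h2]; ring
  have hth := norm_theta_sub_one_le (A := A) (by nlinarith) (-2 * Real.pi * m * r)
  rw [← hT, ← hfT, ← Complex.ofReal_one, ← Complex.ofReal_sub, Complex.norm_real,
    Real.norm_eq_abs] at hth
  have hle : |(∑' j, f j) - 1| ≤ 4 * Real.exp (-2 * r ^ 2) := by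
    refine hth.trans ?_
    gcongr
    linarith
  -- A divergent series would have `tsum` equal to 0, but the bound already proved puts it within
  -- 4·exp(-2) < 1 of 1.
  have hsm : Summable f := by
    by_contra hns
    rw [tsum_eq_zero_of_not_summable hns] at hle
    have h2 : Real.exp (-2 * r ^ 2) ≤ Real.exp (-2) := Real.exp_le_exp.2 (by nlinarith)
    have h3 : Real.exp (-2) = Real.exp (-1) * Real.exp (-1) := by rw [← Real.exp_add]; norm_num
    have := Real.exp_neg_one_lt_d9
    have h5 := Real.exp_pos (-1)
    rw [zero_sub, abs_neg, abs_one] at hle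
    nlinarith
  exact ⟨_, hsm.hasSum, hle⟩

/-- The density of the centered Gaussian distribution with variance `v`. -/
noncomputable def gaussDensity (v x : ℝ) : ℝ := (√(2 * Real.pi * v))⁻¹ * Real.exp (-x ^ 2 / (2 * v))

theorem gaussianPDFReal_eq_gaussDensity (μ : ℝ) (v : ℝ≥0) (x : ℝ) :
    gaussianPDFReal μ v x = gaussDensity v (x - μ) := rfl

theorem gaussDensity_nonneg (v x : ℝ) : 0 ≤ gaussDensity v x := by
  unfold gaussDensity; positivity

/-- Completing the square: a joint Gaussian density factors into the marginal of the sum and the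
conditional density of the summand, whose variance is ab/(a + b). -/
theorem gaussDensity_mul {a b : ℝ} (ha : 0 < a) (hb : 0 < b) (x y μ : ℝ) :
    gaussDensity a (y - μ) * gaussDensity b (x - y) =
      gaussDensity (a + b) (x - μ) *
        gaussDensity (a * b / (a + b)) (y - (b * μ + a * x) / (a + b)) := by
  have hpi := Real.pi_pos
  have hab : 0 < a + b := by positivity
  unfold gaussDensity
  rw [mul_mul_mul_comm, mul_mul_mul_comm (√(2 * Real.pi * (a + b)))⁻¹, ← Real.exp_add,
    ← Real.exp_add, ← mul_inv, ← mul_inv, ← Real.sqrt_mul (by positivity),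
    ← Real.sqrt_mul (by positivity)]
  congr 1
  · congr 2
    field_simp
  · congr 1
    field_simp
    ring

/-- After factoring, only the conditional density depends on the lattice point. Its variance is
a(1/4)/(a + 1/4), which is at least 1/8 precisely when a ≥ 1/4. The error is therefore relative to
the target density at every x, and can later be integrated. -/
theorem hasSum_lattice_conv {r a : ℝ} (hr : 1 ≤ r) (ha : 1 / 4 ≤ a) (μ x : ℝ) :
    ∃ S : ℝ, HasSum (fun j : ℤ => r⁻¹ * gaussDensity a (j / r - μ) *
        gaussDensity (1 / 4) (x - j / r)) S ∧
      |S - gaussDensity (a + 1 / 4) (x - μ)| ≤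
        4 * Real.exp (-2 * r ^ 2) * gaussDensity (a + 1 / 4) (x - μ) := by
  have ha0 : 0 < a := by linarith
  obtain ⟨S, hS, hS1⟩ := hasSum_gaussian_lattice hr (c := a * (1 / 4) / (a + 1 / 4))
    (by rw [div_le_div_iff₀ (by norm_num) (by linarith)]; linarith)
    ((1 / 4 * μ + a * x) / (a + 1 / 4))
  refine ⟨gaussDensity (a + 1 / 4) (x - μ) * S, ?_, ?_⟩
  · have h := hS.mul_left (gaussDensity (a + 1 / 4) (x - μ))
    refine h.congr_fun fun j => ?_
    rw [mul_assoc, gaussDensity_mul ha0 (by norm_num)]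
    unfold gaussDensity
    ring
  · have h0 := gaussDensity_nonneg (a + 1 / 4) (x - μ)
    rw [show gaussDensity (a + 1 / 4) (x - μ) * S - gaussDensity (a + 1 / 4) (x - μ) =
      (S - 1) * gaussDensity (a + 1 / 4) (x - μ) by ring, abs_mul, abs_of_nonneg h0]
    gcongr

/-- Here |μ| ≤ |y|/6, so the exponent is at least (5/18)y², which exceeds y²/16 + r² as y² ≥ 9r².
The loss in the prefactor is √(8/a) ≤ √32 < 6. The leftover Gaussian of variance 8 keeps the
discarded tail summable. -/
theorem gaussDensity_tail_le {r a μ y : ℝ} (hr : 1 ≤ r) (ha : 1 / 4 ≤ a) (ha' : a ≤ 5 / 4)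
    (hμ : |μ| ≤ 1 / 2) (hy : 3 * r ≤ |y|) :
    gaussDensity a (y - μ) ≤ 6 * Real.exp (-r ^ 2) * gaussDensity 8 y := by
  have hpi := Real.pi_pos
  have ha0 : 0 < a := by linarith
  unfold gaussDensity
  have h1 : (√(2 * Real.pi * a))⁻¹ ≤ 6 * (√(2 * Real.pi * 8))⁻¹ := by
    rw [← div_eq_mul_inv, inv_eq_one_div,
      div_le_div_iff₀ (Real.sqrt_pos.2 (by positivity)) (Real.sqrt_pos.2 (by positivity)), one_mul]
    rw [show (6 : ℝ) = √36 by rw [show (36 : ℝ) = 6 ^ 2 by norm_num, Real.sqrt_sq (by norm_num)],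
      ← Real.sqrt_mul (by norm_num)]
    apply Real.sqrt_le_sqrt
    nlinarith
  have h2 : -(y - μ) ^ 2 / (2 * a) ≤ -r ^ 2 + -y ^ 2 / (2 * 8) := by
    have h3 : |y| * (5 / 6) ≤ |y - μ| := by
      have := abs_sub_abs_le_abs_sub y μ
      linarith
    have h4 : (y - μ) ^ 2 ≥ y ^ 2 * (25 / 36) := by
      rw [← sq_abs (y - μ), ← sq_abs y]
      nlinarith [abs_nonneg y]
    have h5 : y ^ 2 ≥ 9 * r ^ 2 := by
      rw [← sq_abs y]; nlinarith
    have h6 : (y - μ) ^ 2 / (2 * a) ≥ (y - μ) ^ 2 / (2 * (5 / 4)) := by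
      gcongr
    rw [neg_div, neg_div]
    have h7 : (y - μ) ^ 2 / (2 * (5 / 4)) = (y - μ) ^ 2 * (2 / 5) := by ring
    have h8 : y ^ 2 / (2 * 8) = y ^ 2 * (1 / 16) := by ring
    nlinarith [sq_nonneg r]
  calc _ ≤ (6 * (√(2 * Real.pi * 8))⁻¹) * Real.exp (-r ^ 2 + -y ^ 2 / (2 * 8)) := by
        gcongr
    _ = _ := by rw [Real.exp_add]; ring

/-- The whole lattice sum is handled by Poisson summation. The terms beyond 3r are at most
6·exp(-r²) times those of the lattice sum for variance 8, which is at most 5 times a Gaussian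
density of variance 8 + 1/4 = 33/4; hence the constant 30. -/
theorem abs_lattice_sum_sub_le {r : ℕ} (hr : 1 ≤ r) {a μ : ℝ} (ha : 1 / 4 ≤ a) (ha' : a ≤ 5 / 4)
    (hμ : |μ| ≤ 1 / 2) (x : ℝ) :
    |∑ j ∈ Finset.Icc (-(3 * r * r) : ℤ) (3 * r * r),
        (r : ℝ)⁻¹ * gaussDensity a (j / r - μ) * gaussDensity (1 / 4) (x - j / r) -
      gaussDensity (a + 1 / 4) (x - μ)| ≤
      Real.exp (-r ^ 2) * (4 * gaussDensity (a + 1 / 4) (x - μ) + 30 * gaussDensity (33 / 4) x) := by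
  have hr' : (1 : ℝ) ≤ r := by exact_mod_cast hr
  obtain ⟨S, hS, hS1⟩ := hasSum_lattice_conv hr' ha μ x
  obtain ⟨S₈, hS₈, hS₈1⟩ := hasSum_lattice_conv hr' (by norm_num : (1 / 4 : ℝ) ≤ 8) 0 x
  set s := Finset.Icc (-(3 * r * r) : ℤ) (3 * r * r) with hs
  set f : ℤ → ℝ := fun j => (r : ℝ)⁻¹ * gaussDensity a (j / r - μ) * gaussDensity (1 / 4) (x - j / r)
    with hf
  set η := Real.exp (-(r : ℝ) ^ 2) with hη
  have hη0 : 0 < η := Real.exp_pos _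
  have hη1 : η ≤ 1 := by rw [hη, Real.exp_le_one_iff]; nlinarith
  have hη2 : Real.exp (-2 * (r : ℝ) ^ 2) ≤ η := Real.exp_le_exp.2 (by nlinarith)
  have hfin : HasSum (fun j => if j ∈ s then f j else 0) (∑ j ∈ s, f j) := by
    have h : HasSum (fun j => if j ∈ s then f j else 0) (∑ j ∈ s, if j ∈ s then f j else 0) :=
      hasSum_sum_of_ne_finset_zero fun j hj => if_neg hj
    rwa [Finset.sum_congr rfl (fun j hj => if_pos hj)] at h
  have hdiff := hS.sub hfin
  have hf0 : ∀ j, 0 ≤ f j := fun j => by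
    have := gaussDensity_nonneg a (j / r - μ)
    have := gaussDensity_nonneg (1 / 4) (x - j / r)
    simp only [hf]; positivity
  have hlow : 0 ≤ S - ∑ j ∈ s, f j := by
    refine hdiff.nonneg fun j => ?_
    split_ifs
    · simp [hf]
    · rw [sub_zero]; exact hf0 j
  have hupp : S - ∑ j ∈ s, f j ≤ 6 * η * S₈ := by
    refine hasSum_le (fun j => ?_) hdiff (hS₈.mul_left (6 * η))
    have h8 := gaussDensity_nonneg 8 ((j : ℝ) / r - 0)
    have h4 := gaussDensity_nonneg (1 / 4) (x - j / r)
    split_ifs with hj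
    · simp only [sub_self]; positivity
    · rw [sub_zero]
      have hjr : 3 * (r : ℝ) ≤ |(j : ℝ) / r| := by
        rw [abs_div, Nat.abs_cast, le_div_iff₀ (by positivity)]
        have : 3 * (r : ℤ) * r ≤ |j| := by
          rw [hs, Finset.mem_Icc, ← abs_le] at hj; omega
        exact_mod_cast this
      have := gaussDensity_tail_le hr' ha ha' hμ hjr
      calc f j = (r : ℝ)⁻¹ * gaussDensity a (j / r - μ) * gaussDensity (1 / 4) (x - j / r) := rfl
        _ ≤ (r : ℝ)⁻¹ * (6 * η * gaussDensity 8 (j / r)) * gaussDensity (1 / 4) (x - j / r) := by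
            gcongr
        _ = _ := by rw [sub_zero]; ring
  have hg := gaussDensity_nonneg (a + 1 / 4) (x - μ)
  have hg8 := gaussDensity_nonneg (33 / 4) x
  have hS₈2 : S₈ ≤ 5 * gaussDensity (33 / 4) x := by
    rw [show (8 : ℝ) + 1 / 4 = 33 / 4 by norm_num, sub_zero] at hS₈1
    have := (abs_le.1 hS₈1).2
    have : Real.exp (-2 * (r : ℝ) ^ 2) ≤ 1 := hη2.trans hη1
    nlinarith
  have h1 : |S - gaussDensity (a + 1 / 4) (x - μ)| ≤
      4 * η * gaussDensity (a + 1 / 4) (x - μ) := 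
    hS1.trans (mul_le_mul_of_nonneg_right (by linarith) hg)
  have h2 : 6 * η * S₈ ≤ 6 * η * (5 * gaussDensity (33 / 4) x) := by gcongr
  rw [abs_le] at h1 ⊢
  constructor <;> linarith

namespace GaussianMixture

/-- The density of a Gaussian mixture. -/
noncomputable def density {k : ℕ} (M : GaussianMixture k) (x : ℝ) : ℝ :=
  ∑ i, M.weight i * gaussianPDFReal (M.mean i) (M.variance i) x

variable {k : ℕ} (M : GaussianMixture k)

theorem integrable_density : Integrable M.density :=
  integrable_finsetSum _ fun _ _ => (integrable_gaussianPDFReal _ _).const_mul _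

theorem integral_density : ∫ x, M.density x = 1 := by
  unfold density
  rw [integral_finsetSum _ fun i _ => (integrable_gaussianPDFReal _ _).const_mul _, ← M.weight_sum]
  refine Finset.sum_congr rfl fun i _ => ?_
  rw [integral_const_mul, integral_gaussianPDFReal_eq_one _ (M.variance_pos i).ne', mul_one]

theorem real_toMeasure_eq_sum (A : Set ℝ) : M.toMeasure.real A =
    ∑ i, M.weight i * (gaussianReal (M.mean i) (M.variance i)).real A := by
  rw [Measure.real, toMeasure, Measure.finsetSum_apply, ENNReal.toReal_sum (by
    intro i _
    simp only [Measure.smul_apply, smul_eq_mul]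
    exact ENNReal.mul_ne_top ENNReal.ofReal_ne_top (measure_ne_top _ _))]
  refine Finset.sum_congr rfl fun i _ => ?_
  rw [Measure.smul_apply, smul_eq_mul, ENNReal.toReal_mul, ENNReal.toReal_ofReal (M.weight_nonneg i),
    Measure.real]

theorem real_toMeasure_eq_integral (A : Set ℝ) : M.toMeasure.real A = ∫ x in A, M.density x := by
  rw [real_toMeasure_eq_sum]
  unfold density
  rw [integral_finsetSum _ fun i _ => ((integrable_gaussianPDFReal _ _).const_mul _).integrableOn]
  refine Finset.sum_congr rfl fun i _ => ?_
  rw [integral_const_mul, Measure.real, gaussianReal_apply_eq_integral _ (M.variance_pos i).ne',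
    ENNReal.toReal_ofReal (integral_nonneg fun x => gaussianPDFReal_nonneg _ _ _)]

theorem abs_real_sub_le {l : ℕ} (M' : GaussianMixture l) (A : Set ℝ) :
    |M.toMeasure.real A - M'.toMeasure.real A| ≤ ∫ x, |M.density x - M'.density x| := by
  rw [real_toMeasure_eq_integral, real_toMeasure_eq_integral,
    ← integral_sub M.integrable_density.integrableOn M'.integrable_density.integrableOn]
  refine abs_integral_le_integral_abs.trans ?_
  exact setIntegral_le_integral (M.integrable_density.sub M'.integrable_density).abs
    (Filter.Eventually.of_forall fun x => abs_nonneg _)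

theorem tvDistance_le {l : ℕ} (M' : GaussianMixture l) :
    tvDistance M.toMeasure M'.toMeasure ≤ ∫ x, |M.density x - M'.density x| :=
  haveI : Nonempty {A : Set ℝ // MeasurableSet A} := ⟨⟨∅, .empty⟩⟩
  ciSup_le fun A => M.abs_real_sub_le M' A.1

end GaussianMixture

/-- The centers of the lattice of Gaussians used for the output. -/
noncomputable def latticePoint (r j : ℕ) : ℝ := ((j : ℝ) - 3 * r * r) / r

/-- A mixture of Gaussians of variance `1 / 4` with means in a lattice of spacing `1 / r`. -/
noncomputable def latticeMixture (r : ℕ) (w : ℕ → ℝ) (h0 : ∀ j, 0 ≤ w j)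
    (h1 : ∑ j ∈ Finset.range (6 * r * r + 1), w j = 1) : GaussianMixture (6 * r * r + 1) where
  weight j := w j
  mean j := latticePoint r j
  variance _ := 1 / 4
  weight_nonneg j := h0 j
  weight_sum := by rw [← h1, Finset.sum_range]
  variance_pos _ := by norm_num

theorem latticeMixture_density {r : ℕ} {w : ℕ → ℝ} (h0 : ∀ j, 0 ≤ w j)
    (h1 : ∑ j ∈ Finset.range (6 * r * r + 1), w j = 1) (x : ℝ) :
    (latticeMixture r w h0 h1).density x =
      ∑ j ∈ Finset.range (6 * r * r + 1), w j * gaussianPDFReal (latticePoint r j) (1 / 4) x := by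
  rw [Finset.sum_range]; rfl

theorem latticeMixture_real {r : ℕ} {w : ℕ → ℝ} (h0 : ∀ j, 0 ≤ w j)
    (h1 : ∑ j ∈ Finset.range (6 * r * r + 1), w j = 1) (A : Set ℝ) :
    (latticeMixture r w h0 h1).toMeasure.real A =
      ∑ j ∈ Finset.range (6 * r * r + 1), w j * (gaussianReal (latticePoint r j) (1 / 4)).real A := by
  rw [GaussianMixture.real_toMeasure_eq_sum, Finset.sum_range]; rfl

theorem sum_Icc_eq_sum_range (n : ℕ) (f : ℤ → ℝ) :
    ∑ j ∈ Finset.Icc (-n : ℤ) n, f j = ∑ j ∈ Finset.range (2 * n + 1), f ((j : ℤ) - n) := by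
  symm
  refine Finset.sum_nbij' (fun j : ℕ => (j : ℤ) - n) (fun j : ℤ => (j + n).toNat) ?_ ?_ ?_ ?_ ?_
  · intro j hj; simp only [Finset.mem_range, Finset.mem_Icc] at *; omega
  · intro j hj; simp only [Finset.mem_range, Finset.mem_Icc] at *; omega
  · intro j hj; simp only [Finset.mem_range] at *; omega
  · intro j hj; simp only [Finset.mem_Icc] at *; omega
  · intro j hj; rfl

/-- The unnormalized weights of the discretization of a mixture. -/
noncomputable def latticeWeight {k : ℕ} (M : GaussianMixture k) (r j : ℕ) : ℝ :=
  ∑ i, M.weight i * ((r : ℝ)⁻¹ *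
    gaussDensity ((M.variance i : ℝ) - 1 / 4) (latticePoint r j - M.mean i))

theorem latticeWeight_nonneg {k : ℕ} (M : GaussianMixture k) (r j : ℕ) :
    0 ≤ latticeWeight M r j :=
  Finset.sum_nonneg fun i _ => mul_nonneg (M.weight_nonneg i)
    (mul_nonneg (by positivity) (gaussDensity_nonneg _ _))

theorem latticeWeight_pos {k : ℕ} {M : GaussianMixture k} (hM : M.WellConditioned 0.5) {r : ℕ}
    (hr : 1 ≤ r) (j : ℕ) : 0 < latticeWeight M r j := by
  obtain ⟨i, -, hi⟩ : ∃ i ∈ Finset.univ, 0 < M.weight i := by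
    apply Finset.exists_lt_of_sum_lt (f := fun _ => (0 : ℝ))
    rw [M.weight_sum]; simp
  have hv := (abs_le.1 (hM i).2).1
  refine Finset.sum_pos' (fun i _ => mul_nonneg (M.weight_nonneg i)
    (mul_nonneg (by positivity) (gaussDensity_nonneg _ _))) ⟨i, Finset.mem_univ _, ?_⟩
  have h1 : 0 < (M.variance i : ℝ) - 1 / 4 := by norm_num at hv ⊢; linarith
  have hpi := Real.pi_pos
  unfold gaussDensity
  positivity

theorem abs_latticeWeight_sum_sub_le {k : ℕ} {M : GaussianMixture k} (hM : M.WellConditioned 0.5)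
    {r : ℕ} (hr : 1 ≤ r) (x : ℝ) :
    |∑ j ∈ Finset.range (6 * r * r + 1),
        latticeWeight M r j * gaussianPDFReal (latticePoint r j) (1 / 4) x - M.density x| ≤
      Real.exp (-r ^ 2) * (4 * M.density x + 30 * gaussianPDFReal 0 (33 / 4) x) := by
  have hr0 : (0 : ℝ) < r := by exact_mod_cast hr
  have e : ∑ j ∈ Finset.range (6 * r * r + 1),
        latticeWeight M r j * gaussianPDFReal (latticePoint r j) (1 / 4) x - M.density x =
      ∑ i, M.weight i * (∑ j ∈ Finset.Icc (-(3 * r * r) : ℤ) (3 * r * r),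
        (r : ℝ)⁻¹ * gaussDensity ((M.variance i : ℝ) - 1 / 4) (j / r - M.mean i) *
          gaussDensity (1 / 4) (x - j / r) - gaussDensity (((M.variance i : ℝ) - 1 / 4) + 1 / 4)
            (x - M.mean i)) := by
    simp_rw [mul_sub, Finset.sum_sub_distrib]
    congr 1
    · simp_rw [latticeWeight, Finset.sum_mul]
      rw [Finset.sum_comm]
      refine Finset.sum_congr rfl fun i _ => ?_
      have := sum_Icc_eq_sum_range (3 * r * r) (fun j => (r : ℝ)⁻¹ *
        gaussDensity ((M.variance i : ℝ) - 1 / 4) (j / r - M.mean i) *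
          gaussDensity (1 / 4) (x - j / r))
      push_cast at this
      rw [this, Finset.mul_sum, show 2 * (3 * r * r) + 1 = 6 * r * r + 1 by ring]
      refine Finset.sum_congr rfl fun j _ => ?_
      rw [gaussianPDFReal_eq_gaussDensity, latticePoint]
      push_cast
      ring
    · refine Finset.sum_congr rfl fun i _ => ?_
      rw [sub_add_cancel, gaussianPDFReal_eq_gaussDensity]
  rw [e]
  calc _ ≤ ∑ i, M.weight i * (Real.exp (-r ^ 2) *
        (4 * gaussDensity (((M.variance i : ℝ) - 1 / 4) + 1 / 4) (x - M.mean i) +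
          30 * gaussDensity (33 / 4) x)) := by
        refine (Finset.abs_sum_le_sum_abs _ _).trans (Finset.sum_le_sum fun i _ => ?_)
        rw [abs_mul, abs_of_nonneg (M.weight_nonneg i)]
        refine mul_le_mul_of_nonneg_left ?_ (M.weight_nonneg i)
        have h1 := (hM i).1
        have h2 := abs_le.1 (hM i).2
        norm_num at h1 h2
        exact abs_lattice_sum_sub_le hr (by linarith) (by linarith) (by linarith) x
    _ = Real.exp (-r ^ 2) * (4 * M.density x + 30 * gaussianPDFReal 0 (33 / 4) x) := by
        have h1 : M.density x = ∑ i, M.weight i * gaussDensity (M.variance i) (x - M.mean i) := rfl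
        have h2 : gaussianPDFReal 0 (33 / 4) x = ∑ i, M.weight i * gaussDensity (33 / 4) x := by
          rw [← Finset.sum_mul, M.weight_sum, one_mul, gaussianPDFReal_eq_gaussDensity, sub_zero]
          norm_num
        rw [h1, h2, Finset.mul_sum, Finset.mul_sum, ← Finset.sum_add_distrib, Finset.mul_sum]
        refine Finset.sum_congr rfl fun i _ => ?_
        rw [sub_add_cancel]; ring

/-- Every well-conditioned mixture is close to a mixture over the lattice. -/
theorem exists_latticeMixture {k : ℕ} {M : GaussianMixture k} (hM : M.WellConditioned 0.5)
    {r : ℕ} (hr : 1 ≤ r) :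
    ∃ (w : ℕ → ℝ) (h0 : ∀ j, 0 ≤ w j) (h1 : ∑ j ∈ Finset.range (6 * r * r + 1), w j = 1),
      ∫ x, |M.density x - (latticeMixture r w h0 h1).density x| ≤ 68 * Real.exp (-r ^ 2) := by
  set η := Real.exp (-(r : ℝ) ^ 2) with hη
  set u := latticeWeight M r with hu
  set s := Finset.range (6 * r * r + 1) with hs
  set Z := ∑ j ∈ s, u j with hZ
  have hu0 : ∀ j, 0 ≤ u j := latticeWeight_nonneg M r
  have hZ0 : 0 < Z := Finset.sum_pos (fun j _ => latticeWeight_pos hM hr j) (by simp [hs])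
  set p : ℝ → ℝ := fun x => ∑ j ∈ s, u j * gaussianPDFReal (latticePoint r j) (1 / 4) x with hp
  have hpi : Integrable p :=
    integrable_finsetSum _ fun _ _ => (integrable_gaussianPDFReal _ _).const_mul _
  have hpint : ∫ x, p x = Z := by
    rw [hp, integral_finsetSum _ fun i _ => (integrable_gaussianPDFReal _ _).const_mul _]
    refine Finset.sum_congr rfl fun j _ => ?_
    rw [integral_const_mul, integral_gaussianPDFReal_eq_one _ (by norm_num), mul_one]
  have hp0 : ∀ x, 0 ≤ p x := fun x => Finset.sum_nonneg fun j _ =>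
    mul_nonneg (hu0 j) (gaussianPDFReal_nonneg _ _ _)
  have hdiff : ∫ x, |p x - M.density x| ≤ 34 * η := by
    have hi1 : Integrable fun x => 4 * M.density x := M.integrable_density.const_mul _
    have hi2 : Integrable fun x => 30 * gaussianPDFReal 0 (33 / 4) x :=
      (integrable_gaussianPDFReal _ _).const_mul _
    calc _ ≤ ∫ x, η * (4 * M.density x + 30 * gaussianPDFReal 0 (33 / 4) x) := by
          refine integral_mono (hpi.sub M.integrable_density).abs ((hi1.add hi2).const_mul _) ?_
          intro x
          exact abs_latticeWeight_sum_sub_le hM hr x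
      _ = 34 * η := by
          rw [integral_const_mul, integral_add hi1 hi2, integral_const_mul, integral_const_mul,
            M.integral_density, integral_gaussianPDFReal_eq_one _ (by norm_num)]
          ring
  -- The total mass inherits the L¹ error 34 = 4 + 30, so normalizing the weights costs as much
  -- again; together 68.
  have hZ1 : |1 - Z| ≤ 34 * η := by
    rw [← hpint, ← M.integral_density, abs_sub_comm, ← integral_sub hpi M.integrable_density]
    exact abs_integral_le_integral_abs.trans hdiff
  have hw0 : ∀ j, 0 ≤ u j / Z := fun j => div_nonneg (hu0 j) hZ0.le
  have hw1 : ∑ j ∈ s, u j / Z = 1 := by rw [← Finset.sum_div, div_self hZ0.ne']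
  refine ⟨fun j => u j / Z, hw0, hw1, ?_⟩
  have hd : ∀ x, (latticeMixture r (fun j => u j / Z) hw0 hw1).density x = p x / Z := by
    intro x
    rw [latticeMixture_density, hp, Finset.sum_div]
    refine Finset.sum_congr rfl fun j _ => ?_
    ring
  have hnorm : ∫ x, |p x - p x / Z| = |1 - Z| := by
    have : ∀ x, |p x - p x / Z| = |1 - Z| / Z * p x := by
      intro x
      rw [show p x - p x / Z = -((1 - Z) / Z * p x) by field_simp; ring, abs_neg, abs_mul, abs_div,
        abs_of_pos hZ0, abs_of_nonneg (hp0 x)]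
    simp_rw [this]
    rw [integral_const_mul, hpint, div_mul_cancel₀ _ hZ0.ne']
  simp_rw [hd]
  calc _ ≤ ∫ x, (|p x - M.density x| + |p x - p x / Z|) := by
        refine integral_mono (M.integrable_density.sub (hpi.div_const Z)).abs
          ((hpi.sub M.integrable_density).abs.add (hpi.sub (hpi.div_const Z)).abs) fun x => ?_
        have := abs_sub_le (M.density x) (p x) (p x / Z)
        rwa [abs_sub_comm (M.density x) (p x)] at this
    _ = (∫ x, |p x - M.density x|) + ∫ x, |p x - p x / Z| :=
        integral_add (hpi.sub M.integrable_density).abs (hpi.sub (hpi.div_const Z)).abs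
    _ ≤ _ := by rw [hnorm]; linarith

/-! ### Accuracy of the tables -/

/-- (1 - u + u²/2)(1 + u + u²/2) = 1 + u⁴/4, and the second factor is at most exp(u). -/
theorem exp_neg_le_quadratic {u : ℝ} (hu : 0 ≤ u) : Real.exp (-u) ≤ 1 - u + u ^ 2 / 2 := by
  have h := Real.quadratic_le_exp_of_nonneg hu
  rw [Real.exp_neg, inv_le_iff_one_le_mul₀ (Real.exp_pos u)]
  have h1 : 0 ≤ 1 - u + u ^ 2 / 2 := by nlinarith [sq_nonneg (u - 1)]
  calc 1 ≤ (1 - u + u ^ 2 / 2) * (1 + u + u ^ 2 / 2) := by nlinarith [sq_nonneg (u ^ 2)]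
    _ ≤ _ := by gcongr

theorem sq_mul_exp_neg_le_one (x : ℝ) : x ^ 2 * Real.exp (-x ^ 2 / 2) ≤ 1 := by
  have h := Real.quadratic_le_exp_of_nonneg (x := x ^ 2 / 2) (by positivity)
  rw [neg_div, Real.exp_neg, ← div_eq_mul_inv, div_le_one (Real.exp_pos _)]
  nlinarith [sq_nonneg (x ^ 2 - 2)]

/-- The local error of Euler's method for y' = -xy. The second derivative grows like x², but
x²·exp(-x²/2) ≤ 1 makes the bound uniform in x. -/
theorem abs_euler_step_le {x δ : ℝ} (hx : 0 ≤ x) (hδ : 0 ≤ δ) (hδ1 : δ ≤ 1) :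
    |Real.exp (-(x + δ) ^ 2 / 2) - (1 - x * δ) * Real.exp (-x ^ 2 / 2)| ≤ δ ^ 2 := by
  set e := Real.exp (-x ^ 2 / 2) with he
  set u := x * δ + δ ^ 2 / 2 with hu
  have hu0 : 0 ≤ u := by positivity
  have he0 : 0 < e := Real.exp_pos _
  have he1 : e ≤ 1 := by
    rw [he, Real.exp_le_one_iff]; nlinarith [sq_nonneg x]
  have hx2 : x ^ 2 * e ≤ 1 := sq_mul_exp_neg_le_one x
  have h1 : Real.exp (-(x + δ) ^ 2 / 2) = e * Real.exp (-u) := by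
    rw [he, ← Real.exp_add]; congr 1; rw [hu]; ring
  have h2 := exp_neg_le_quadratic hu0
  have h3 := Real.add_one_le_exp (-u)
  have hδ2 : δ ^ 2 ≤ 1 := pow_le_one₀ hδ hδ1
  rw [h1, abs_le]
  constructor
  · have : e * (-u + 1) ≤ e * Real.exp (-u) := by gcongr
    have h5 : e * δ ^ 2 ≤ δ ^ 2 := by nlinarith [sq_nonneg δ]
    have h6 : e * (-u + 1) = (1 - x * δ) * e - e * δ ^ 2 / 2 := by rw [hu]; ring
    linarith [sq_nonneg δ]
  · have : e * Real.exp (-u) ≤ e * (1 - u + u ^ 2 / 2) := by gcongr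
    have h6 : u ^ 2 ≤ 2 * (x * δ) ^ 2 + 2 * (δ ^ 2 / 2) ^ 2 := by
      rw [hu]; nlinarith [sq_nonneg (x * δ - δ ^ 2 / 2)]
    have h7 : e * (u ^ 2 / 2) ≤ e * ((x * δ) ^ 2 + (δ ^ 2 / 2) ^ 2) := by
      apply mul_le_mul_of_nonneg_left _ he0.le
      linarith
    have h8 : x ^ 2 * e * δ ^ 2 ≤ δ ^ 2 := by nlinarith [sq_nonneg δ]
    have h9 : e * (δ ^ 2 / 2) ^ 2 ≤ e * (δ ^ 2 / 2) := by
      apply mul_le_mul_of_nonneg_left _ he0.le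
      nlinarith [sq_nonneg δ]
    have h10 : e * (1 - u + u ^ 2 / 2) =
        (1 - x * δ) * e - e * (δ ^ 2 / 2) + e * (u ^ 2 / 2) := by rw [hu]; ring
    nlinarith

theorem abs_exp_neg_sq_sub_le {x δ : ℝ} (hx : 0 ≤ x) (hδ : 0 ≤ δ) (hδ1 : δ ≤ 1) :
    |Real.exp (-(x + δ) ^ 2 / 2) - Real.exp (-x ^ 2 / 2)| ≤ 2 * δ := by
  have h := abs_euler_step_le hx hδ hδ1
  set e := Real.exp (-x ^ 2 / 2) with he
  have he0 : 0 < e := Real.exp_pos _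
  have he1 : e ≤ 1 := by
    rw [he, Real.exp_le_one_iff]; nlinarith [sq_nonneg x]
  have hx2 : x ^ 2 * e ≤ 1 := sq_mul_exp_neg_le_one x
  have hxe : x * e ≤ 1 := by
    by_contra hc
    push Not at hc
    nlinarith [mul_pos he0 he0]
  have hxe0 : 0 ≤ x * e := by positivity
  have h2 : x * e * δ ≤ δ := by nlinarith
  have h3 : 0 ≤ x * e * δ := by positivity
  rw [abs_le] at h ⊢
  constructor <;> nlinarith

/-- Each step adds 1/E² for the Euler error and 1/E² for the floor. Earlier errors are multiplied by
1 - k/E² in [0, 1] and are never amplified. -/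
theorem abs_gaussSeq_sub_le {E : ℕ} (hE : 1 ≤ E) {k : ℕ} (hk : (k : ℤ) ≤ E * E) :
    |(gaussSeq E k : ℝ) / (E * E) - Real.exp (-((k : ℝ) / E) ^ 2 / 2)| ≤ 2 * k / (E * E) := by
  have hE0 : (0 : ℝ) < E := by exact_mod_cast hE
  have hEE : (0 : ℝ) < E * E := by positivity
  have hEZ : (0 : ℤ) < E := by exact_mod_cast hE
  induction k with
  | zero => simp [gaussSeq, div_self hEE.ne']
  | succ k ih =>
    have hk' : (k : ℤ) ≤ E * E := by push_cast at hk; omega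
    have ih := ih hk'
    set y : ℝ := (gaussSeq E k : ℝ) with hy
    have hkR : (k : ℝ) ≤ E * E := by exact_mod_cast hk'
    set α : ℝ := k / (E * E) with hα
    have hα0 : 0 ≤ α := by positivity
    have hα1 : α ≤ 1 := (div_le_one hEE).2 hkR
    set w : ℤ := ((k : ℤ) * gaussSeq E k).fdiv (E * E) with hw
    have hy1 : ((gaussSeq E (k + 1) : ℤ) : ℝ) = y - w := by
      simp only [gaussSeq]; push_cast; rfl
    have hEEZ : (0 : ℤ) < E * E := by positivity
    rw [Int.fdiv_eq_ediv_of_nonneg _ hEEZ.le] at hw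
    have hw1 : (w : ℝ) * (E * E) ≤ k * y := by
      have := Int.ediv_mul_le ((k : ℤ) * gaussSeq E k) hEEZ.ne'
      rw [← hw] at this
      rw [hy]; exact_mod_cast this
    have hw2 : (k : ℝ) * y ≤ (w + 1) * (E * E) := by
      have := (Int.lt_ediv_add_one_mul_self ((k : ℤ) * gaussSeq E k) hEEZ).le
      rw [← hw] at this
      rw [hy]; exact_mod_cast this
    have hstep := abs_euler_step_le (x := (k : ℝ) / E) (δ := 1 / E) (by positivity) (by positivity)
      ((div_le_one hE0).2 (by exact_mod_cast hE))
    have e1 : (k : ℝ) / E + 1 / E = ((k + 1 : ℕ) : ℝ) / E := by push_cast; ring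
    have e2 : (k : ℝ) / E * (1 / E) = α := by rw [hα]; field_simp
    have e3 : (1 / (E : ℝ)) ^ 2 = 1 / (E * E) := by field_simp
    rw [e1, e2, e3] at hstep
    set φ := Real.exp (-((k : ℝ) / E) ^ 2 / 2) with hφ
    have hw1' : (w : ℝ) / (E * E) ≤ α * (y / (E * E)) := by
      rw [div_le_iff₀ hEE, hα]
      calc (w : ℝ) ≤ k * y / (E * E) := (le_div_iff₀ hEE).2 hw1
        _ = _ := by field_simp
    have hw2' : α * (y / (E * E)) ≤ (w : ℝ) / (E * E) + 1 / (E * E) := by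
      rw [← add_div, le_div_iff₀ hEE, hα]
      calc _ = k * y / (E * E) := by field_simp
        _ ≤ _ := (div_le_iff₀ hEE).2 hw2
    rw [hy1, sub_div]
    have hmul : |(1 - α) * (y / (E * E) - φ)| ≤ 2 * k / (E * E) := by
      rw [abs_mul, abs_of_nonneg (by linarith : 0 ≤ 1 - α)]
      refine (mul_le_of_le_one_left (abs_nonneg _) (by linarith)).trans ih
    have e4 : 2 * ((k + 1 : ℕ) : ℝ) / (E * E) =
        2 * k / (E * E) + 1 / (E * E) + 1 / (E * E) := by push_cast; ring
    rw [e4]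
    rw [abs_le] at hmul hstep ⊢
    constructor <;> nlinarith

/-- The integral of `exp (-u² / 2)` from `0` to `x`. -/
noncomputable def gaussPrimitive (x : ℝ) : ℝ := ∫ u in (0 : ℝ)..x, Real.exp (-u ^ 2 / 2)

/-! ### From the Riemann sums to the Gaussian distribution function -/

theorem continuous_exp_neg_sq_div_two : Continuous fun u : ℝ => Real.exp (-u ^ 2 / 2) := by
  fun_prop

theorem gaussPrimitive_neg (x : ℝ) : gaussPrimitive (-x) = -gaussPrimitive x := by
  unfold gaussPrimitive
  have h := intervalIntegral.integral_comp_neg (a := 0) (b := x)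
    (fun u : ℝ => Real.exp (-u ^ 2 / 2))
  simp only [neg_sq, neg_zero] at h
  rw [h, intervalIntegral.integral_symm]

theorem abs_cell_sub_le {E : ℕ} (hE : 1 ≤ E) (k : ℕ) :
    |Real.exp (-((k : ℝ) / E) ^ 2 / 2) / E -
      ∫ u in ((k : ℝ) / E)..(((k + 1 : ℕ) : ℝ) / E), Real.exp (-u ^ 2 / 2)| ≤ 2 / (E * E) := by
  have hE0 : (0 : ℝ) < E := by exact_mod_cast hE
  have hlen : (((k + 1 : ℕ) : ℝ) / E) - (k : ℝ) / E = 1 / E := by push_cast; ring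
  have hc : Real.exp (-((k : ℝ) / E) ^ 2 / 2) / E =
      ∫ _u in ((k : ℝ) / E)..(((k + 1 : ℕ) : ℝ) / E), Real.exp (-((k : ℝ) / E) ^ 2 / 2) := by
    rw [intervalIntegral.integral_const, hlen, smul_eq_mul]; ring
  rw [hc, ← intervalIntegral.integral_sub (by simp)
    (continuous_exp_neg_sq_div_two.intervalIntegrable _ _)]
  have h1E : 1 / (E : ℝ) ≤ 1 := (div_le_one hE0).2 (by exact_mod_cast hE)
  have h := intervalIntegral.norm_integral_le_of_norm_le_const (C := 2 * (1 / E))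
    (a := (k : ℝ) / E) (b := ((k + 1 : ℕ) : ℝ) / E)
    (f := fun u => Real.exp (-((k : ℝ) / E) ^ 2 / 2) - Real.exp (-u ^ 2 / 2)) (by
      intro u hu
      rw [Set.uIoc_of_le (by gcongr; omega)] at hu
      have h := abs_exp_neg_sq_sub_le (x := (k : ℝ) / E) (δ := u - (k : ℝ) / E) (by positivity)
        (by linarith [hu.1]) (by linarith [hu.2])
      rw [add_sub_cancel, abs_sub_comm] at h
      rw [Real.norm_eq_abs]
      exact h.trans (by linarith [hu.2]))
  rw [Real.norm_eq_abs, hlen, abs_of_pos (by positivity : 0 < 1 / (E : ℝ))] at h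
  exact h.trans (le_of_eq (by field_simp))

/-- The first summand in the bracket is the error of the tabulated values, the second that of the
left endpoint rule. The factor E³ is E² from the values times E from the step. -/
theorem abs_gaussPartialSum_sub_le {E : ℕ} (hE : 1 ≤ E) {k : ℕ} (hk : (k : ℤ) ≤ E * E) :
    |(gaussPartialSum E k : ℝ) / (E * E * E) - gaussPrimitive ((k : ℝ) / E)| ≤
      k * (2 * k / (E * E * E) + 2 / (E * E)) := by
  have hE0 : (0 : ℝ) < E := by exact_mod_cast hE
  have hG : gaussPrimitive ((k : ℝ) / E) = ∑ i ∈ Finset.range k,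
      ∫ u in ((i : ℝ) / E)..(((i + 1 : ℕ) : ℝ) / E), Real.exp (-u ^ 2 / 2) := by
    rw [intervalIntegral.sum_integral_adjacent_intervals (a := fun i : ℕ => (i : ℝ) / E)
      (fun i _ => continuous_exp_neg_sq_div_two.intervalIntegrable _ _)]
    simp [gaussPrimitive]
  rw [hG, gaussPartialSum, Int.cast_sum, Finset.sum_div, ← Finset.sum_sub_distrib]
  calc _ ≤ ∑ i ∈ Finset.range k, (2 * (k : ℝ) / (E * E * E) + 2 / (E * E)) := by
        refine (Finset.abs_sum_le_sum_abs _ _).trans (Finset.sum_le_sum fun i hi => ?_)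
        rw [Finset.mem_range] at hi
        have h1 := abs_gaussSeq_sub_le hE (k := i) (by omega)
        have h2 := abs_cell_sub_le hE i
        have h3 : |(gaussSeq E i : ℝ) / (E * E * E) - Real.exp (-((i : ℝ) / E) ^ 2 / 2) / E| ≤
            2 * k / (E * E * E) := by
          rw [← div_div _ ((E : ℝ) * E), ← sub_div, abs_div, abs_of_pos hE0, ← div_div _ ((E : ℝ) * E)]
          gcongr
          refine h1.trans ?_
          gcongr
        exact (abs_sub_le _ _ _).trans (add_le_add h3 h2)
    _ = _ := by simp [mul_add]

/-- The standard Gaussian distribution function. -/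
noncomputable def gaussCDF (x : ℝ) : ℝ := (gaussianReal 0 1).real (Set.Iic x)

theorem gaussianReal_real_Iic (m x : ℝ) :
    (gaussianReal m (1 / 4)).real (Set.Iic x) = gaussCDF (2 * (x - m)) := by
  have h1 := gaussianReal_map_const_mul (μ := 0) (v := 1) (1 / 2)
  have h2 := gaussianReal_map_const_add (μ := 1 / 2 * 0)
    (v := NNReal.mk ((1 / 2) ^ 2) (sq_nonneg _) * 1) m
  rw [← h1, Measure.map_map (by fun_prop) (by fun_prop)] at h2
  have h3 : NNReal.mk ((1 / 2) ^ 2) (sq_nonneg _) * 1 = 1 / 4 := by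
    ext; push_cast; norm_num
  rw [h3, show 1 / 2 * 0 + m = m by ring] at h2
  rw [← h2, gaussCDF, Measure.real, Measure.real, Measure.map_apply (by fun_prop) measurableSet_Iic]
  congr 2
  ext y
  simp only [Set.mem_preimage, Set.mem_Iic, Function.comp_apply]
  constructor <;> intro h <;> linarith

theorem gaussianPDFReal_zero_one (x : ℝ) :
    gaussianPDFReal 0 1 x = (√(2 * Real.pi))⁻¹ * Real.exp (-x ^ 2 / 2) := by
  simp [gaussianPDFReal]

theorem integrable_exp_neg_sq_div_two : Integrable fun u : ℝ => Real.exp (-u ^ 2 / 2) := by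
  have := integrable_exp_neg_mul_sq (b := 1 / 2) (by norm_num)
  refine this.congr (Filter.Eventually.of_forall fun x => ?_)
  simp only; congr 1; ring

theorem integral_Ioi_exp_neg_sq_div_two :
    ∫ u in Set.Ioi (0 : ℝ), Real.exp (-u ^ 2 / 2) = √(2 * Real.pi) / 2 := by
  have := integral_gaussian_Ioi (1 / 2)
  rw [show Real.pi / (1 / 2) = 2 * Real.pi by ring] at this
  rw [← this]
  congr 1
  ext x; congr 1; ring

theorem gaussPrimitive_add_integral_Ioi (x : ℝ) :
    gaussPrimitive x + ∫ u in Set.Ioi x, Real.exp (-u ^ 2 / 2) = √(2 * Real.pi) / 2 := by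
  rw [gaussPrimitive, intervalIntegral.integral_interval_add_Ioi
    integrable_exp_neg_sq_div_two.integrableOn integrable_exp_neg_sq_div_two.integrableOn,
    integral_Ioi_exp_neg_sq_div_two]

theorem gaussCDF_eq (x : ℝ) : gaussCDF x = 1 / 2 + gaussPrimitive x / √(2 * Real.pi) := by
  have hs : 0 < √(2 * Real.pi) := Real.sqrt_pos.2 (by positivity)
  have h1 : gaussCDF x = 1 - (gaussianReal 0 1).real (Set.Ioi x) := by
    rw [gaussCDF, ← Set.compl_Ioi, probReal_compl_eq_one_sub measurableSet_Ioi]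
  have h2 : (gaussianReal 0 1).real (Set.Ioi x) =
      (√(2 * Real.pi))⁻¹ * ∫ u in Set.Ioi x, Real.exp (-u ^ 2 / 2) := by
    rw [Measure.real, gaussianReal_apply_eq_integral _ one_ne_zero,
      ENNReal.toReal_ofReal (integral_nonneg fun x => gaussianPDFReal_nonneg _ _ _)]
    simp_rw [gaussianPDFReal_zero_one]
    rw [integral_const_mul]
  have h3 := gaussPrimitive_add_integral_Ioi x
  have h4 : ∫ u in Set.Ioi x, Real.exp (-u ^ 2 / 2) = √(2 * Real.pi) / 2 - gaussPrimitive x := by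
    linarith
  rw [h1, h2, h4]
  field_simp
  ring

/-- For u > x half of the exponent is bounded by its value at x and the other half is integrated:
u²/2 ≥ x²/4 + u²/4. -/
theorem integral_Ioi_exp_neg_sq_le {x : ℝ} (hx : 0 ≤ x) :
    ∫ u in Set.Ioi x, Real.exp (-u ^ 2 / 2) ≤ 2 * Real.exp (-x ^ 2 / 4) := by
  have hint : Integrable fun u : ℝ => Real.exp (-(1 / 4) * u ^ 2) :=
    integrable_exp_neg_mul_sq (by norm_num)
  calc _ ≤ ∫ u in Set.Ioi x, Real.exp (-x ^ 2 / 4) * Real.exp (-(1 / 4) * u ^ 2) := by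
        refine setIntegral_mono_on integrable_exp_neg_sq_div_two.integrableOn
          (hint.const_mul _).integrableOn measurableSet_Ioi fun u hu => ?_
        rw [← Real.exp_add]
        apply Real.exp_le_exp.2
        have : x < u := hu
        nlinarith
    _ = Real.exp (-x ^ 2 / 4) * ∫ u in Set.Ioi x, Real.exp (-(1 / 4) * u ^ 2) :=
        integral_const_mul _ _
    _ ≤ Real.exp (-x ^ 2 / 4) * ∫ u in Set.Ioi 0, Real.exp (-(1 / 4) * u ^ 2) := by
        gcongr
        · exact Filter.Eventually.of_forall fun u => (Real.exp_pos _).le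
        · exact hint.integrableOn
    _ = Real.exp (-x ^ 2 / 4) * (√(Real.pi / (1 / 4)) / 2) := by rw [integral_gaussian_Ioi]
    _ ≤ Real.exp (-x ^ 2 / 4) * 2 := by
        gcongr
        rw [div_le_iff₀ (by norm_num), Real.sqrt_le_left (by norm_num)]
        linarith [Real.pi_le_four]
    _ = _ := mul_comm _ _

theorem exp_neg_sq_le {r N : ℕ} (hN : 1 ≤ N) (h : N < 2 ^ r ^ 2) :
    Real.exp (-(r : ℝ) ^ 2) ≤ 1 / N := by
  have hN0 : (0 : ℝ) < N := by exact_mod_cast hN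
  rw [Real.exp_neg, ← one_div]
  apply one_div_le_one_div_of_le hN0
  calc (N : ℝ) ≤ 2 ^ r ^ 2 := by exact_mod_cast h.le
    _ ≤ Real.exp 1 ^ r ^ 2 := by
        gcongr
        linarith [Real.add_one_le_exp 1]
    _ = Real.exp ((r : ℝ) ^ 2) := by
        rw [← Real.exp_nat_mul]; congr 1; push_cast; ring

theorem abs_gaussPartialSum_scale_le {r N : ℕ} (hr : 1 ≤ r) (hN : 1 ≤ N) {k : ℕ}
    (hk : k ≤ tableSize r N) :
    |(gaussPartialSum (scale r N) k : ℝ) / (scale r N * scale r N * scale r N) -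
      gaussPrimitive ((k : ℝ) / scale r N)| ≤ 34 * r / N := by
  have hE : 1 ≤ scale r N := scale_pos hr hN
  have hE0 : (0 : ℝ) < scale r N := by exact_mod_cast hE
  have hN0 : (0 : ℝ) < N := by exact_mod_cast hN
  have hr0 : (1 : ℝ) ≤ r := by exact_mod_cast hr
  have hkZ : (k : ℤ) ≤ tableSize r N := by exact_mod_cast hk
  refine (abs_gaussPartialSum_sub_le hE (hkZ.trans (tableSize_le hN))).trans ?_
  have hkR : (k : ℝ) ≤ 16 * r * scale r N := by
    have : (k : ℝ) ≤ tableSize r N := by exact_mod_cast hk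
    rw [tableSize] at this; exact_mod_cast this
  have hER : (scale r N : ℝ) = 16 * r * N := by rw [scale]; push_cast; ring
  calc _ ≤ 16 * r * scale r N * (2 * (16 * r * scale r N) /
        (scale r N * scale r N * scale r N : ℝ) + 2 / (scale r N * scale r N)) := by gcongr
    _ = (512 * r ^ 2 + 32 * r) / scale r N := by field_simp; ring
    _ = (32 * r + 2) / N := by rw [hER]; field_simp; ring
    _ ≤ _ := by gcongr; linarith

theorem one_le_sqrt_two_pi_div_two : 1 ≤ √(2 * Real.pi) / 2 := by
  rw [le_div_iff₀ (by norm_num), one_mul]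
  apply Real.le_sqrt_of_sq_le
  linarith [Real.pi_gt_three]

/-- Dividing by the last partial sum replaces the unknown constant √(2π)/2, so the program never
needs π. The table reaches 16r, beyond which the tail is below 2/N. The constant is 34 for the
numerator plus 34 + 2 for the denominator. -/
theorem abs_ratio_sub_le {r N : ℕ} (hr : 1 ≤ r) (hN : 1 ≤ N) (hrN : N < 2 ^ r ^ 2) {k : ℕ}
    (hk : k ≤ tableSize r N) :
    |(gaussPartialSum (scale r N) k : ℝ) / gaussPartialSum (scale r N) (tableSize r N) -
      2 * gaussPrimitive ((k : ℝ) / scale r N) / √(2 * Real.pi)| ≤ 70 * r / N := by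
  have hE : 1 ≤ scale r N := scale_pos hr hN
  have hEZ : (0 : ℤ) < scale r N := by exact_mod_cast hE
  have hE0 : (0 : ℝ) < scale r N := by exact_mod_cast hE
  have hN0 : (0 : ℝ) < N := by exact_mod_cast hN
  have hr0 : (1 : ℝ) ≤ r := by exact_mod_cast hr
  have hg := one_le_sqrt_two_pi_div_two
  have h1 := abs_gaussPartialSum_scale_le hr hN hk
  have h2 := abs_gaussPartialSum_scale_le hr hN (le_refl (tableSize r N))
  set g := √(2 * Real.pi) / 2 with hgdef
  set zk : ℝ := (gaussPartialSum (scale r N) k : ℝ) with hzk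
  set zL : ℝ := (gaussPartialSum (scale r N) (tableSize r N) : ℝ) with hzL
  set E : ℝ := (scale r N : ℝ) with hEdef
  have hzL0 : 0 < zL := by
    have := gaussPartialSum_pos hEZ (one_le_tableSize hr hN) (tableSize_le hN)
    rw [hzL]; exact_mod_cast this
  have hzk0 : 0 ≤ zk := by
    have := gaussPartialSum_nonneg hEZ (l := k)
      ((by exact_mod_cast hk : (k : ℤ) ≤ tableSize r N).trans (tableSize_le hN))
    rw [hzk]; exact_mod_cast this
  have hzkL : zk ≤ zL := by
    have := gaussPartialSum_mono hEZ hk (tableSize_le hN)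
    rw [hzk, hzL]; exact_mod_cast this
  have hLE : (tableSize r N : ℝ) / E = 16 * r := by
    rw [tableSize]; push_cast; rw [← hEdef]; field_simp
  have htail : |gaussPrimitive ((tableSize r N : ℝ) / E) - g| ≤ 2 * r / N := by
    have h3 := gaussPrimitive_add_integral_Ioi ((tableSize r N : ℝ) / E)
    have h4 := integral_Ioi_exp_neg_sq_le (x := (tableSize r N : ℝ) / E) (by positivity)
    have h5 : 0 ≤ ∫ u in Set.Ioi ((tableSize r N : ℝ) / E), Real.exp (-u ^ 2 / 2) :=
      integral_nonneg fun u => (Real.exp_pos _).le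
    have h6 : Real.exp (-((tableSize r N : ℝ) / E) ^ 2 / 4) ≤ 1 / N := by
      refine le_trans (Real.exp_le_exp.2 ?_) (exp_neg_sq_le hN hrN)
      rw [hLE]; nlinarith
    have h7 : 2 * (1 / (N : ℝ)) ≤ 2 * r / N := by
      rw [mul_one_div]; gcongr; linarith
    rw [abs_le]; constructor <;> linarith
  have hdiff : |zL / (E * E * E) - g| ≤ 36 * r / N := by
    refine (abs_sub_le _ _ _).trans ((add_le_add h2 htail).trans (le_of_eq ?_))
    ring
  have hE3 : 0 < E * E * E := by positivity
  have hquot : zk / zL ≤ 1 := (div_le_one hzL0).2 hzkL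
  have hquot0 : 0 ≤ zk / zL := by positivity
  -- The error of the denominator appears multiplied by the quotient, which is at most 1 by
  -- monotonicity; dividing by g ≥ 1 only helps.
  have key : zk / zL - 2 * gaussPrimitive ((k : ℝ) / E) / √(2 * Real.pi) =
      (zk / (E * E * E) - gaussPrimitive ((k : ℝ) / E)) / g -
        zk / zL * ((zL / (E * E * E) - g) / g) := by
    have : √(2 * Real.pi) = 2 * g := by rw [hgdef]; ring
    rw [this]
    have : g ≠ 0 := by positivity
    field_simp
    ring
  rw [key]
  have hb : ∀ z : ℝ, |z / g| ≤ |z| := by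
    intro z
    rw [abs_div, abs_of_pos (by linarith : 0 < g)]
    exact div_le_self (abs_nonneg _) hg
  have h8 : |zk / zL * ((zL / (E * E * E) - g) / g)| ≤ 36 * r / N := by
    rw [abs_mul, abs_of_nonneg hquot0]
    exact (mul_le_of_le_one_left (abs_nonneg _) hquot).trans ((hb _).trans hdiff)
  refine (abs_sub _ _).trans ((add_le_add ((hb _).trans h1) h8).trans (le_of_eq ?_))
  ring

theorem gaussCDF_neg (x : ℝ) : gaussCDF (-x) = 1 - gaussCDF x := by
  rw [gaussCDF_eq, gaussCDF_eq, gaussPrimitive_neg]; ring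

/-- Half of the previous error, 35, plus 1 for the final floor; negative arguments follow from the
symmetry Φ(-x) = 1 - Φ(x). -/
theorem abs_cdfTable_sub_le {r N : ℕ} (hr : 1 ≤ r) (hN : 1 ≤ N) (hrN : N < 2 ^ r ^ 2) {k : ℤ}
    (hk : |k| ≤ tableSize r N) :
    |(cdfTable (scale r N) (tableSize r N) k : ℝ) / (2 * scale r N) -
      gaussCDF ((k : ℝ) / scale r N)| ≤ 36 * r / N := by
  have hE : 1 ≤ scale r N := scale_pos hr hN
  have hEZ : (0 : ℤ) < scale r N := by exact_mod_cast hE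
  have hE0 : (0 : ℝ) < scale r N := by exact_mod_cast hE
  have hN0 : (0 : ℝ) < N := by exact_mod_cast hN
  have hr0 : (1 : ℝ) ≤ r := by exact_mod_cast hr
  have hzL := gaussPartialSum_pos hEZ (one_le_tableSize hr hN) (tableSize_le hN)
  have hzLR : (0 : ℝ) < gaussPartialSum (scale r N) (tableSize r N) := by exact_mod_cast hzL
  have main : ∀ n : ℕ, n ≤ tableSize r N →
      |(((scale r N : ℤ) * gaussPartialSum (scale r N) n).fdiv
        (gaussPartialSum (scale r N) (tableSize r N)) : ℝ) / (2 * scale r N) -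
        (gaussCDF ((n : ℝ) / scale r N) - 1 / 2)| ≤ 36 * r / N := by
    intro n hn
    have h1 := abs_ratio_sub_le hr hN hrN hn
    rw [Int.fdiv_eq_ediv_of_nonneg _ hzL.le, gaussCDF_eq]
    set zn := gaussPartialSum (scale r N) n with hzn
    set zL := gaussPartialSum (scale r N) (tableSize r N) with hzLdef
    set w : ℤ := (scale r N * zn) / zL with hw
    have hw1 : (w : ℝ) * zL ≤ scale r N * zn := by
      have := Int.ediv_mul_le ((scale r N : ℤ) * zn) hzL.ne'
      rw [← hw] at this; exact_mod_cast this
    have hw2 : (scale r N : ℝ) * zn ≤ (w + 1) * zL := by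
      have := (Int.lt_ediv_add_one_mul_self ((scale r N : ℤ) * zn) hzL).le
      rw [← hw] at this; exact_mod_cast this
    have h2 : |(w : ℝ) / (2 * scale r N) - (zn : ℝ) / zL / 2| ≤ 1 / (2 * scale r N) := by
      have e1 : (w : ℝ) / (2 * scale r N) - (zn : ℝ) / zL / 2 =
          (w * zL - scale r N * zn) / (2 * scale r N * zL) := by field_simp
      rw [e1, abs_div, abs_of_pos (by positivity : (0 : ℝ) < 2 * scale r N * zL),
        div_le_div_iff₀ (by positivity) (by positivity), one_mul]
      have : |(w : ℝ) * zL - scale r N * zn| ≤ zL := by rw [abs_le]; constructor <;> linarith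
      nlinarith
    have h3 : |(zn : ℝ) / zL / 2 -
        (1 / 2 + gaussPrimitive ((n : ℝ) / scale r N) / √(2 * Real.pi) - 1 / 2)| ≤ 35 * r / N := by
      rw [show (zn : ℝ) / zL / 2 -
        (1 / 2 + gaussPrimitive ((n : ℝ) / scale r N) / √(2 * Real.pi) - 1 / 2) =
        ((zn : ℝ) / zL - 2 * gaussPrimitive ((n : ℝ) / scale r N) / √(2 * Real.pi)) / 2 by ring,
        abs_div, abs_two]
      rw [div_le_iff₀ (by norm_num)]
      exact h1.trans (le_of_eq (by ring))
    have h4 : 1 / (2 * (scale r N : ℝ)) ≤ r / N := by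
      have hER : (scale r N : ℝ) = 16 * r * N := by rw [scale]; push_cast; ring
      rw [hER, div_le_div_iff₀ (by positivity) hN0]
      nlinarith [mul_nonneg (by linarith : (0 : ℝ) ≤ r - 1) hN0.le,
        mul_nonneg (by linarith : (0 : ℝ) ≤ r - 1) (by linarith : (0 : ℝ) ≤ r)]
    refine (abs_sub_le _ _ _).trans ((add_le_add (h2.trans h4) h3).trans (le_of_eq ?_))
    ring
  rw [abs_le] at hk
  unfold cdfTable
  split_ifs with h0
  · have h := main k.toNat (by omega)
    have e : ((k.toNat : ℕ) : ℝ) = (k : ℝ) := by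
      exact_mod_cast congrArg (Int.cast : ℤ → ℝ) (Int.toNat_of_nonneg h0)
    rw [e] at h
    convert h using 2
    push_cast
    field_simp
    ring
  · have h := main (-k).toNat (by omega)
    have e : (((-k).toNat : ℕ) : ℝ) = -(k : ℝ) := by
      exact_mod_cast congrArg (Int.cast : ℤ → ℝ) (Int.toNat_of_nonneg (by omega : 0 ≤ -k))
    rw [e, neg_div, gaussCDF_neg, ← abs_neg] at h
    convert h using 2
    push_cast
    field_simp
    ring

/-- The points at which distribution functions are compared. -/
noncomputable def gridPoint (r N i : ℕ) : ℝ := ((i : ℝ) - 10 * r * scale r N) / (2 * scale r N)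

/-- Standardizing N(y, 1/4) gives Φ(2(x - y)). Since E/r = 16N, twice the lattice spacing is 32N
table steps, and the grid spacing 1/(2E) is one table step: the tabulated arguments are exact, with
no interpolation. -/
theorem abs_feature_sub_le {r N : ℕ} (hr : 1 ≤ r) (hN : 1 ≤ N) (hrN : N < 2 ^ r ^ 2) {i j : ℕ}
    (hi : i ≤ gridSize r N) (hj : j ≤ 6 * r * r) :
    |(feature r N j i : ℝ) / (2 * scale r N) -
      (gaussianReal (latticePoint r j) (1 / 4)).real (Set.Iic (gridPoint r N i))| ≤
      36 * r / N := by
  have hE0 : (0 : ℝ) < scale r N := by exact_mod_cast scale_pos hr hN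
  have hr0 : (0 : ℝ) < r := by exact_mod_cast hr
  have hN0 : (0 : ℝ) < N := by exact_mod_cast hN
  have h := abs_cdfTable_sub_le hr hN hrN (abs_feature_index_le hi hj)
  rw [gaussianReal_real_Iic]
  convert h using 3
  congr 1
  have hER : (scale r N : ℝ) = 16 * r * N := by rw [scale]; push_cast; ring
  rw [gridPoint, latticePoint]
  push_cast
  rw [hER]
  field_simp
  ring_nf

/-! ### An inverse inequality for combinations of Gaussians -/

theorem gaussDensity_neg (v x : ℝ) : gaussDensity v (-x) = gaussDensity v x := by
  simp [gaussDensity]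

theorem gaussDensity_quarter_mul (a b x : ℝ) :
    gaussDensity (1 / 4) (x - a) * gaussDensity (1 / 4) (x - b) =
      gaussDensity (1 / 2) (a - b) * gaussianPDFReal ((a + b) / 2) (1 / 8) x := by
  rw [← gaussDensity_neg (1 / 4) (x - b), neg_sub, gaussDensity_mul (by norm_num) (by norm_num),
    gaussianPDFReal_eq_gaussDensity, ← gaussDensity_neg _ (a - b), neg_sub]
  congr 2
  · norm_num
  · norm_num
  · ring

theorem integrable_gaussDensity_mul (a b : ℝ) :
    Integrable fun x => gaussDensity (1 / 4) (x - a) * gaussDensity (1 / 4) (x - b) := by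
  simp_rw [gaussDensity_quarter_mul]
  exact (integrable_gaussianPDFReal _ _).const_mul _

theorem integral_gaussDensity_mul (a b : ℝ) :
    ∫ x, gaussDensity (1 / 4) (x - a) * gaussDensity (1 / 4) (x - b) =
      gaussDensity (1 / 2) (a - b) := by
  simp_rw [gaussDensity_quarter_mul]
  rw [integral_const_mul, integral_gaussianPDFReal_eq_one _ (by norm_num), mul_one]

/-- The derivative of the density of the centered Gaussian distribution with variance `1 / 4`. -/
noncomputable def gaussDeriv (x : ℝ) : ℝ := -4 * x * gaussDensity (1 / 4) x

theorem gaussDeriv_mul (a b x : ℝ) :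
    gaussDeriv (x - a) * gaussDeriv (x - b) = 16 * gaussDensity (1 / 2) (a - b) *
      (gaussianPDFReal ((a + b) / 2) (1 / 8) x * ((x - (a + b) / 2) ^ 2 - (a - b) ^ 2 / 4)) := by
  have h := gaussDensity_quarter_mul a b x
  unfold gaussDeriv
  rw [show -4 * (x - a) * gaussDensity (1 / 4) (x - a) * (-4 * (x - b) * gaussDensity (1 / 4) (x - b))
    = 16 * ((x - a) * (x - b)) * (gaussDensity (1 / 4) (x - a) * gaussDensity (1 / 4) (x - b)) by ring,
    h]
  ring

theorem integrable_sub_sq_gaussianReal (m c : ℝ) (v : ℝ≥0) :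
    Integrable (fun x => (x - m) ^ 2 - c) (gaussianReal m v) := by
  have h : MemLp (fun x : ℝ => x - m) 2 (gaussianReal m v) :=
    (memLp_id_gaussianReal 2).sub (memLp_const m)
  exact h.integrable_sq.sub (integrable_const c)

theorem integrable_pdf_mul_iff {m : ℝ} {v : ℝ≥0} (hv : v ≠ 0) {f : ℝ → ℝ} :
    Integrable (fun x => gaussianPDFReal m v x * f x) ↔ Integrable f (gaussianReal m v) := by
  rw [gaussianReal_of_var_ne_zero m hv, integrable_withDensity_iff_integrable_smul'
    (measurable_gaussianPDF m v) (Filter.Eventually.of_forall fun x => gaussianPDF_lt_top)]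
  simp_rw [toReal_gaussianPDF, smul_eq_mul]

theorem integrable_gaussDeriv_mul (a b : ℝ) :
    Integrable fun x => gaussDeriv (x - a) * gaussDeriv (x - b) := by
  simp_rw [gaussDeriv_mul]
  exact ((integrable_pdf_mul_iff (by norm_num)).2 (integrable_sub_sq_gaussianReal _ _ _)).const_mul _

/-- The product is a Gaussian of variance 1/8 about the midpoint times a quadratic, so only its
variance is needed. -/
theorem integral_gaussDeriv_mul (a b : ℝ) :
    ∫ x, gaussDeriv (x - a) * gaussDeriv (x - b) =
      (2 - 4 * (a - b) ^ 2) * gaussDensity (1 / 2) (a - b) := by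
  simp_rw [gaussDeriv_mul]
  rw [integral_const_mul]
  have h := integral_gaussianReal_eq_integral_smul (μ := (a + b) / 2) (v := 1 / 8)
    (f := fun x => (x - (a + b) / 2) ^ 2 - (a - b) ^ 2 / 4) (by norm_num)
  simp only [smul_eq_mul] at h
  rw [← h]
  have hi := integrable_sub_sq_gaussianReal ((a + b) / 2) 0 (1 / 8)
  simp only [sub_zero] at hi
  have hvar := variance_fun_id_gaussianReal (μ := (a + b) / 2) (v := 1 / 8)
  rw [variance_eq_integral (by fun_prop), integral_id_gaussianReal] at hvar
  rw [integral_sub hi (integrable_const _), hvar]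
  simp
  ring

/-- The law of the Fourier variable. -/
noncomputable abbrev fourierLaw : Measure ℝ := gaussianReal 0 2

open Complex in
theorem integral_cexp_fourierLaw (d : ℝ) :
    ∫ t, cexp (d * I * t) ∂fourierLaw = ((Real.exp (-d ^ 2) : ℝ) : ℂ) := by
  have h := complexMGF_id_gaussianReal (μ := 0) (v := 2) (d * I)
  rw [complexMGF] at h
  simp only [id] at h
  rw [h]
  push_cast
  congr 1
  rw [mul_pow, I_sq]; ring

open Complex in
-- Second derivative of the moment generating function exp(z²), evaluated on the imaginary axis.
theorem integral_sq_mul_cexp_fourierLaw (d : ℝ) :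
    ∫ t, (t : ℂ) ^ 2 * cexp (d * I * t) ∂fourierLaw =
      (((2 - 4 * d ^ 2) * Real.exp (-d ^ 2) : ℝ) : ℂ) := by
  have h := iteratedDeriv_complexMGF (X := id) (μ := fourierLaw) (z := d * I)
    (by rw [integrableExpSet_id_gaussianReal]; simp) 2
  simp only [id] at h
  rw [← h]
  have e : complexMGF id fourierLaw = fun z => cexp (z ^ 2) := by
    ext z
    rw [complexMGF_id_gaussianReal]
    congr 1; push_cast; ring
  have d1 : deriv (fun z => cexp (z ^ 2)) = fun z => cexp (z ^ 2) * (2 * z) := by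
    ext z
    have := ((hasDerivAt_pow 2 z).cexp).deriv
    rw [this]; simp
  have d2 : ∀ z : ℂ, deriv (fun z => cexp (z ^ 2) * (2 * z)) z = (2 + 4 * z ^ 2) * cexp (z ^ 2) := by
    intro z
    have h1 := ((hasDerivAt_pow 2 z).cexp).mul ((hasDerivAt_id z).const_mul 2)
    have := h1.deriv
    simp only [id] at this
    refine (Eq.trans ?_ this).trans ?_
    · rfl
    · push_cast; ring
  rw [e, iteratedDeriv_succ, iteratedDeriv_one, d1, d2]
  push_cast
  rw [mul_pow, I_sq]
  congr 2 <;> ring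

theorem integrable_sq_fourierLaw : Integrable (fun t : ℝ => t ^ 2) fourierLaw := by
  simpa using integrable_sub_sq_gaussianReal 0 0 2

theorem integral_cos_fourierLaw (d : ℝ) :
    ∫ t, Real.cos (d * t) ∂fourierLaw = Real.exp (-d ^ 2) := by
  have h := congrArg Complex.re (integral_cexp_fourierLaw d)
  rw [Complex.ofReal_re] at h
  rw [← h]
  have hi : Integrable (fun t : ℝ => Complex.exp (d * Complex.I * t)) fourierLaw := by
    refine Integrable.of_bound (by fun_prop) 1 (Filter.Eventually.of_forall fun t => ?_)
    rw [show (d : ℂ) * Complex.I * t = ((d * t : ℝ) : ℂ) * Complex.I by push_cast; ring,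
      Complex.norm_exp_ofReal_mul_I]
  have := integral_re hi
  simp only [RCLike.re_to_complex] at this
  rw [← this]
  congr 1
  ext t
  rw [show (d : ℂ) * Complex.I * t = ((d * t : ℝ) : ℂ) * Complex.I by push_cast; ring,
    Complex.exp_ofReal_mul_I_re]

theorem integral_sq_mul_cos_fourierLaw (d : ℝ) :
    ∫ t, t ^ 2 * Real.cos (d * t) ∂fourierLaw = (2 - 4 * d ^ 2) * Real.exp (-d ^ 2) := by
  have h := congrArg Complex.re (integral_sq_mul_cexp_fourierLaw d)
  rw [Complex.ofReal_re] at h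
  rw [← h]
  have hi : Integrable (fun t : ℝ => (t : ℂ) ^ 2 * Complex.exp (d * Complex.I * t)) fourierLaw := by
    refine integrable_sq_fourierLaw.mono' (by fun_prop) (Filter.Eventually.of_forall fun t => ?_)
    rw [norm_mul, show (d : ℂ) * Complex.I * t = ((d * t : ℝ) : ℂ) * Complex.I by push_cast; ring,
      Complex.norm_exp_ofReal_mul_I, mul_one, norm_pow, Complex.norm_real, Real.norm_eq_abs, sq_abs]
  have := integral_re hi
  simp only [RCLike.re_to_complex] at this
  rw [← this]
  congr 1
  ext t
  rw [show (d : ℂ) * Complex.I * t = ((d * t : ℝ) : ℂ) * Complex.I by push_cast; ring,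
    ← Complex.ofReal_pow, Complex.re_ofReal_mul, Complex.exp_ofReal_mul_I_re]

/-- The exact value is √2; the exponent 1/8 is below the critical 1/4 of variance 2. -/
theorem integral_exp_sq_fourierLaw :
    Integrable (fun t : ℝ => Real.exp (t ^ 2 / 8)) fourierLaw ∧
      ∫ t, Real.exp (t ^ 2 / 8) ∂fourierLaw ≤ 3 / 2 := by
  have e : ∀ t : ℝ, gaussianPDFReal 0 2 t * Real.exp (t ^ 2 / 8) =
      (√(4 * Real.pi))⁻¹ * Real.exp (-(1 / 8) * t ^ 2) := by
    intro t
    rw [gaussianPDFReal, mul_assoc, ← Real.exp_add]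
    push_cast
    congr 2
    · congr 1; ring
    · ring
  constructor
  · rw [← integrable_pdf_mul_iff (by norm_num)]
    simp_rw [e]
    exact (integrable_exp_neg_mul_sq (by norm_num)).const_mul _
  · rw [integral_gaussianReal_eq_integral_smul (by norm_num)]
    simp_rw [smul_eq_mul, e]
    rw [integral_const_mul, integral_gaussian, ← div_eq_inv_mul,
      div_le_iff₀ (Real.sqrt_pos.2 (by positivity)), Real.sqrt_le_left (by positivity), mul_pow,
      Real.sq_sqrt (by positivity)]
    linarith [Real.pi_pos]

/-! ### Pointwise bounds and derivatives -/

theorem gaussDensity_quarter_eq (x : ℝ) :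
    gaussDensity (1 / 4) x = 2 / √(2 * Real.pi) * Real.exp (-(2 * x) ^ 2 / 2) := by
  rw [gaussDensity, show 2 * Real.pi * (1 / 4) = 2 * Real.pi / 2 ^ 2 by ring,
    Real.sqrt_div (by positivity), Real.sqrt_sq (by norm_num), inv_div]
  congr 2; ring

theorem gaussDensity_half_eq (x : ℝ) :
    gaussDensity (1 / 2) x = (√Real.pi)⁻¹ * Real.exp (-x ^ 2) := by
  rw [gaussDensity, show 2 * Real.pi * (1 / 2) = Real.pi by ring]
  congr 2; ring

theorem gaussDensity_quarter_le (x : ℝ) : gaussDensity (1 / 4) x ≤ Real.exp (-2 * x ^ 2) := by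
  rw [gaussDensity_quarter_eq, show -(2 * x) ^ 2 / 2 = -2 * x ^ 2 by ring]
  refine mul_le_of_le_one_left (Real.exp_pos _).le ?_
  rw [div_le_one (Real.sqrt_pos.2 (by positivity))]
  linarith [one_le_sqrt_two_pi_div_two]

theorem abs_gaussDeriv_le (x : ℝ) : |gaussDeriv x| ≤ 4 * Real.exp (-(3 / 2) * x ^ 2) := by
  rw [gaussDeriv, abs_mul, abs_mul, abs_of_nonneg (gaussDensity_nonneg _ _)]
  have h1 : |x| ≤ Real.exp (x ^ 2 / 2) := by
    have := Real.add_one_le_exp (x ^ 2 / 2)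
    have h2 := sq_abs x
    nlinarith [sq_nonneg (|x| - 1)]
  calc |(-4 : ℝ)| * |x| * gaussDensity (1 / 4) x
      ≤ 4 * Real.exp (x ^ 2 / 2) * Real.exp (-2 * x ^ 2) := by
        rw [abs_of_neg (by norm_num), neg_neg]
        exact mul_le_mul (by gcongr) (gaussDensity_quarter_le x) (gaussDensity_nonneg _ _)
          (by positivity)
    _ = _ := by rw [mul_assoc, ← Real.exp_add]; congr 2; ring

theorem hasDerivAt_gaussCDF (y x : ℝ) :
    HasDerivAt (fun x => gaussCDF (2 * (x - y))) (gaussDensity (1 / 4) (x - y)) x := by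
  have h1 : HasDerivAt gaussPrimitive (Real.exp (-(2 * (x - y)) ^ 2 / 2)) (2 * (x - y)) :=
    (continuous_exp_neg_sq_div_two.integral_hasStrictDerivAt 0 _).hasDerivAt
  have h2 : HasDerivAt (fun x : ℝ => 2 * (x - y)) 2 x := by
    simpa using ((hasDerivAt_id x).sub_const y).const_mul 2
  have h3 := ((h1.comp x h2).div_const (√(2 * Real.pi))).const_add (1 / 2)
  simp_rw [gaussCDF_eq]
  rw [gaussDensity_quarter_eq]
  refine HasDerivAt.congr_deriv h3 ?_
  ring

theorem hasDerivAt_gaussDensity_sub (y x : ℝ) :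
    HasDerivAt (fun x => gaussDensity (1 / 4) (x - y)) (gaussDeriv (x - y)) x := by
  have h2 : HasDerivAt (fun x : ℝ => -(x - y) ^ 2 / (2 * (1 / 4))) (-4 * (x - y)) x := by
    have := ((((hasDerivAt_id x).sub_const y).pow 2).neg).div_const (2 * (1 / 4))
    refine HasDerivAt.congr_deriv this ?_
    simp only [id]
    push_cast; ring
  have h3 := h2.exp.const_mul (√(2 * Real.pi * (1 / 4)))⁻¹
  unfold gaussDeriv gaussDensity
  refine HasDerivAt.congr_deriv h3 ?_
  ring

theorem continuous_gaussDensity_sub (y : ℝ) :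
    Continuous fun x => gaussDensity (1 / 4) (x - y) :=
  continuous_iff_continuousAt.2 fun x => (hasDerivAt_gaussDensity_sub y x).continuousAt

theorem gaussCDF_mem (x : ℝ) : 0 ≤ gaussCDF x ∧ gaussCDF x ≤ 1 :=
  ⟨measureReal_nonneg, measureReal_le_one⟩

/-- A linear combination of Gaussian densities of variance `1 / 4`. -/
noncomputable def gaussComb (s : Finset ℕ) (c y : ℕ → ℝ) (x : ℝ) : ℝ :=
  ∑ j ∈ s, c j * gaussDensity (1 / 4) (x - y j)

/-- The derivative of `gaussComb`. -/
noncomputable def gaussCombDeriv (s : Finset ℕ) (c y : ℕ → ℝ) (x : ℝ) : ℝ :=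
  ∑ j ∈ s, c j * gaussDeriv (x - y j)

/-- The cumulative distribution function of `gaussComb`. -/
noncomputable def gaussCombCDF (s : Finset ℕ) (c y : ℕ → ℝ) (x : ℝ) : ℝ :=
  ∑ j ∈ s, c j * gaussCDF (2 * (x - y j))

/-- The squared modulus of the Fourier transform of `∑ c j δ_{y j}`. -/
noncomputable def fourierSq (s : Finset ℕ) (c y : ℕ → ℝ) (t : ℝ) : ℝ :=
  ∑ i ∈ s, ∑ j ∈ s, c i * c j * Real.cos ((y i - y j) * t)

section

variable {s : Finset ℕ} {c y : ℕ → ℝ}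

theorem fourierSq_eq (t : ℝ) : fourierSq s c y t =
    (∑ j ∈ s, c j * Real.cos (y j * t)) ^ 2 + (∑ j ∈ s, c j * Real.sin (y j * t)) ^ 2 := by
  rw [fourierSq, sq, sq, Finset.sum_mul_sum, Finset.sum_mul_sum, ← Finset.sum_add_distrib]
  refine Finset.sum_congr rfl fun i _ => ?_
  rw [← Finset.sum_add_distrib]
  refine Finset.sum_congr rfl fun j _ => ?_
  rw [sub_mul, Real.cos_sub]; ring

theorem fourierSq_nonneg (t : ℝ) : 0 ≤ fourierSq s c y t := by
  rw [fourierSq_eq]; positivity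

theorem fourierSq_le (hc : ∑ j ∈ s, |c j| ≤ 2) (t : ℝ) : fourierSq s c y t ≤ 4 := by
  have h0 : 0 ≤ ∑ j ∈ s, |c j| := Finset.sum_nonneg fun _ _ => abs_nonneg _
  calc fourierSq s c y t ≤ ∑ i ∈ s, ∑ j ∈ s, |c i| * |c j| := by
        refine Finset.sum_le_sum fun i _ => Finset.sum_le_sum fun j _ => ?_
        refine (le_abs_self _).trans ?_
        rw [abs_mul, abs_mul]
        exact mul_le_of_le_one_right (by positivity) (Real.abs_cos_le_one _)
    _ = (∑ j ∈ s, |c j|) * ∑ j ∈ s, |c j| := by rw [Finset.sum_mul_sum]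
    _ ≤ 4 := by nlinarith

theorem gaussComb_sq (x : ℝ) : gaussComb s c y x ^ 2 = ∑ i ∈ s, ∑ j ∈ s,
    c i * c j * (gaussDensity (1 / 4) (x - y i) * gaussDensity (1 / 4) (x - y j)) := by
  rw [gaussComb, sq, Finset.sum_mul_sum]
  refine Finset.sum_congr rfl fun i _ => Finset.sum_congr rfl fun j _ => by ring

theorem gaussCombDeriv_sq (x : ℝ) : gaussCombDeriv s c y x ^ 2 = ∑ i ∈ s, ∑ j ∈ s,
    c i * c j * (gaussDeriv (x - y i) * gaussDeriv (x - y j)) := by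
  rw [gaussCombDeriv, sq, Finset.sum_mul_sum]
  refine Finset.sum_congr rfl fun i _ => Finset.sum_congr rfl fun j _ => by ring

theorem integrable_gaussComb_sq : Integrable fun x => gaussComb s c y x ^ 2 := by
  simp_rw [gaussComb_sq]
  exact integrable_finsetSum _ fun i _ => integrable_finsetSum _ fun j _ =>
    (integrable_gaussDensity_mul _ _).const_mul _

theorem integrable_gaussCombDeriv_sq : Integrable fun x => gaussCombDeriv s c y x ^ 2 := by
  simp_rw [gaussCombDeriv_sq]
  exact integrable_finsetSum _ fun i _ => integrable_finsetSum _ fun j _ =>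
    (integrable_gaussDeriv_mul _ _).const_mul _

theorem integrable_cos_fourierLaw (d : ℝ) :
    Integrable (fun t : ℝ => Real.cos (d * t)) fourierLaw :=
  Integrable.of_bound (by fun_prop) 1
    (Filter.Eventually.of_forall fun t => Real.abs_cos_le_one _)

theorem integrable_sq_mul_cos_fourierLaw (d : ℝ) :
    Integrable (fun t : ℝ => t ^ 2 * Real.cos (d * t)) fourierLaw := by
  refine integrable_sq_fourierLaw.mono' (by fun_prop) (Filter.Eventually.of_forall fun t => ?_)
  rw [Real.norm_eq_abs, abs_mul, abs_of_nonneg (sq_nonneg t)]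
  exact mul_le_of_le_one_right (sq_nonneg t) (Real.abs_cos_le_one _)

theorem integrable_fourierSq : Integrable (fourierSq s c y) fourierLaw :=
  integrable_finsetSum _ fun _ _ => integrable_finsetSum _ fun _ _ =>
    (integrable_cos_fourierLaw _).const_mul _

theorem sq_mul_fourierSq (t : ℝ) : t ^ 2 * fourierSq s c y t =
    ∑ i ∈ s, ∑ j ∈ s, c i * c j * (t ^ 2 * Real.cos ((y i - y j) * t)) := by
  simp_rw [fourierSq, Finset.mul_sum]
  refine Finset.sum_congr rfl fun i _ => Finset.sum_congr rfl fun j _ => by ring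

theorem integrable_sq_mul_fourierSq :
    Integrable (fun t => t ^ 2 * fourierSq s c y t) fourierLaw := by
  simp_rw [sq_mul_fourierSq]
  exact integrable_finsetSum _ fun _ _ => integrable_finsetSum _ fun _ _ =>
    (integrable_sq_mul_cos_fourierLaw _).const_mul _

/-- Plancherel in explicit form. The inner product of two translates is proportional to exp(-(y_i -
y_j)²), which is the characteristic function of N(0, 2); the Gaussian decay of the Fourier transform
is hidden in the law. For the derivative the same computation produces a factor t². -/
theorem integral_gaussComb_sq : ∫ x, gaussComb s c y x ^ 2 =
    (√Real.pi)⁻¹ * ∫ t, fourierSq s c y t ∂fourierLaw := by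
  simp_rw [gaussComb_sq, fourierSq]
  rw [integral_finsetSum _ fun i _ => integrable_finsetSum _ fun j _ =>
    (integrable_gaussDensity_mul _ _).const_mul _, integral_finsetSum _ fun i _ =>
    integrable_finsetSum _ fun j _ => (integrable_cos_fourierLaw _).const_mul _, Finset.mul_sum]
  refine Finset.sum_congr rfl fun i _ => ?_
  rw [integral_finsetSum _ fun j _ => (integrable_gaussDensity_mul _ _).const_mul _,
    integral_finsetSum _ fun j _ => (integrable_cos_fourierLaw _).const_mul _, Finset.mul_sum]
  refine Finset.sum_congr rfl fun j _ => ?_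
  rw [integral_const_mul, integral_const_mul, integral_gaussDensity_mul, integral_cos_fourierLaw,
    gaussDensity_half_eq]
  ring

theorem integral_gaussCombDeriv_sq : ∫ x, gaussCombDeriv s c y x ^ 2 =
    (√Real.pi)⁻¹ * ∫ t, t ^ 2 * fourierSq s c y t ∂fourierLaw := by
  simp_rw [gaussCombDeriv_sq, sq_mul_fourierSq]
  rw [integral_finsetSum _ fun i _ => integrable_finsetSum _ fun j _ =>
    (integrable_gaussDeriv_mul _ _).const_mul _, integral_finsetSum _ fun i _ =>
    integrable_finsetSum _ fun j _ => (integrable_sq_mul_cos_fourierLaw _).const_mul _,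
    Finset.mul_sum]
  refine Finset.sum_congr rfl fun i _ => ?_
  rw [integral_finsetSum _ fun j _ => (integrable_gaussDeriv_mul _ _).const_mul _,
    integral_finsetSum _ fun j _ => (integrable_sq_mul_cos_fourierLaw _).const_mul _,
    Finset.mul_sum]
  refine Finset.sum_congr rfl fun j _ => ?_
  rw [integral_const_mul, integral_const_mul, integral_gaussDeriv_mul,
    integral_sq_mul_cos_fourierLaw, gaussDensity_half_eq]
  ring

/-! ### A Bernstein inequality and its consequences -/

/-- Frequencies up to 6r give the first term. Above, the Fourier sum is at most 4, t² ≤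
16·exp(t²/16), and t²/16 ≥ 2r² allows half of exp(t²/8) to be traded for exp(-2r²). -/
theorem sq_mul_fourierSq_le (hc : ∑ j ∈ s, |c j| ≤ 2) (r t : ℝ) :
    t ^ 2 * fourierSq s c y t ≤
      36 * r ^ 2 * fourierSq s c y t + 64 * Real.exp (-r ^ 2) ^ 2 * Real.exp (t ^ 2 / 8) := by
  have h0 := fourierSq_nonneg (s := s) (c := c) (y := y) t
  have h4 := fourierSq_le (y := y) hc t
  by_cases ht : t ^ 2 ≤ 36 * r ^ 2
  · have : t ^ 2 * fourierSq s c y t ≤ 36 * r ^ 2 * fourierSq s c y t := by gcongr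
    have : 0 < 64 * Real.exp (-r ^ 2) ^ 2 * Real.exp (t ^ 2 / 8) := by positivity
    linarith
  · push Not at ht
    have h1 : t ^ 2 / 16 ≤ Real.exp (t ^ 2 / 16) := by linarith [Real.add_one_le_exp (t ^ 2 / 16)]
    have h2 : Real.exp (t ^ 2 / 16) ≤ Real.exp (-r ^ 2) ^ 2 * Real.exp (t ^ 2 / 8) := by
      rw [← Real.exp_nat_mul, ← Real.exp_add]
      apply Real.exp_le_exp.2
      push_cast
      nlinarith [sq_nonneg r]
    have : t ^ 2 * fourierSq s c y t ≤ t ^ 2 * 4 := by gcongr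
    have : 0 ≤ 36 * r ^ 2 * fourierSq s c y t := by positivity
    linarith

/-- Integrating the preceding bound: differentiation costs a factor 6r in L², up to a negligible
high-frequency part; 96 = 64·3/2. -/
theorem integral_gaussCombDeriv_sq_le (hc : ∑ j ∈ s, |c j| ≤ 2) (r : ℝ) :
    ∫ x, gaussCombDeriv s c y x ^ 2 ≤
      36 * r ^ 2 * (∫ x, gaussComb s c y x ^ 2) + 96 * Real.exp (-r ^ 2) ^ 2 := by
  have hE := integral_exp_sq_fourierLaw
  have hpi : (√Real.pi)⁻¹ ≤ 1 := by
    apply inv_le_one_of_one_le₀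
    apply Real.le_sqrt_of_sq_le
    linarith [Real.pi_gt_three]
  have h : ∫ t, t ^ 2 * fourierSq s c y t ∂fourierLaw ≤
      36 * r ^ 2 * (∫ t, fourierSq s c y t ∂fourierLaw) + 96 * Real.exp (-r ^ 2) ^ 2 := by
    calc _ ≤ ∫ t, (36 * r ^ 2 * fourierSq s c y t +
            64 * Real.exp (-r ^ 2) ^ 2 * Real.exp (t ^ 2 / 8)) ∂fourierLaw :=
          integral_mono integrable_sq_mul_fourierSq
            ((integrable_fourierSq.const_mul _).add (hE.1.const_mul _)) (sq_mul_fourierSq_le hc r)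
      _ = 36 * r ^ 2 * (∫ t, fourierSq s c y t ∂fourierLaw) +
            64 * Real.exp (-r ^ 2) ^ 2 * ∫ t, Real.exp (t ^ 2 / 8) ∂fourierLaw := by
          rw [integral_add (integrable_fourierSq.const_mul _) (hE.1.const_mul _),
            integral_const_mul, integral_const_mul]
      _ ≤ _ := by nlinarith [hE.2, sq_nonneg (Real.exp (-r ^ 2))]
  rw [integral_gaussCombDeriv_sq, integral_gaussComb_sq]
  have h0 : 0 ≤ (√Real.pi)⁻¹ := by positivity
  calc _ ≤ (√Real.pi)⁻¹ * (36 * r ^ 2 * (∫ t, fourierSq s c y t ∂fourierLaw) +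
        96 * Real.exp (-r ^ 2) ^ 2) := by gcongr
    _ = 36 * r ^ 2 * ((√Real.pi)⁻¹ * ∫ t, fourierSq s c y t ∂fourierLaw) +
        (√Real.pi)⁻¹ * (96 * Real.exp (-r ^ 2) ^ 2) := by ring
    _ ≤ _ := by
      have h96 : 0 ≤ 96 * Real.exp (-r ^ 2) ^ 2 := by positivity
      linarith [mul_le_of_le_one_left h96 hpi]

theorem hasDerivAt_gaussCombCDF (x : ℝ) :
    HasDerivAt (gaussCombCDF s c y) (gaussComb s c y x) x :=
  HasDerivAt.fun_sum fun j _ => (hasDerivAt_gaussCDF (y j) x).const_mul (c j)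

theorem hasDerivAt_gaussComb (x : ℝ) :
    HasDerivAt (gaussComb s c y) (gaussCombDeriv s c y x) x :=
  HasDerivAt.fun_sum fun j _ => (hasDerivAt_gaussDensity_sub (y j) x).const_mul (c j)

theorem continuous_gaussCombCDF : Continuous (gaussCombCDF s c y) :=
  continuous_iff_continuousAt.2 fun x => (hasDerivAt_gaussCombCDF x).continuousAt

theorem abs_sum_mul_le (hc : ∑ j ∈ s, |c j| ≤ 2) {f : ℕ → ℝ} {b : ℝ} (hb : 0 ≤ b)
    (hf : ∀ j ∈ s, |f j| ≤ b) : |∑ j ∈ s, c j * f j| ≤ 2 * b := by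
  calc |∑ j ∈ s, c j * f j| ≤ ∑ j ∈ s, |c j * f j| := Finset.abs_sum_le_sum_abs _ _
    _ ≤ ∑ j ∈ s, |c j| * b := Finset.sum_le_sum fun j hj => by
        rw [abs_mul]; exact mul_le_mul_of_nonneg_left (hf j hj) (abs_nonneg _)
    _ = (∑ j ∈ s, |c j|) * b := by rw [Finset.sum_mul]
    _ ≤ 2 * b := by gcongr

theorem abs_gaussCombCDF_le (hc : ∑ j ∈ s, |c j| ≤ 2) (x : ℝ) : |gaussCombCDF s c y x| ≤ 2 := by
  have := abs_sum_mul_le hc zero_le_one (f := fun j => gaussCDF (2 * (x - y j)))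
    fun j _ => abs_le.2 ⟨by linarith [gaussCDF_mem (2 * (x - y j))], (gaussCDF_mem _).2⟩
  rwa [mul_one] at this

theorem abs_gaussComb_le (hc : ∑ j ∈ s, |c j| ≤ 2) (x : ℝ) : |gaussComb s c y x| ≤ 2 := by
  have := abs_sum_mul_le hc zero_le_one (f := fun j => gaussDensity (1 / 4) (x - y j))
    fun j _ => by
      rw [abs_of_nonneg (gaussDensity_nonneg _ _)]
      refine (gaussDensity_quarter_le _).trans (Real.exp_le_one_iff.2 ?_)
      nlinarith [sq_nonneg (x - y j)]
  rwa [mul_one] at this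

/-- Outside [-5r, 5r] the distance to any center is at least 2|x|/5, enough for both a factor
exp(-2r²) and an integrable Gaussian. -/
theorem sq_sub_ge_of_far {r x z : ℝ} (hr : 0 ≤ r) (hz : |z| ≤ 3 * r) (hx : 5 * r < |x|) :
    4 / 25 * x ^ 2 ≤ (x - z) ^ 2 ∧ 25 * r ^ 2 ≤ x ^ 2 := by
  have h1 : 2 / 5 * |x| ≤ |x - z| := by
    have := abs_sub_abs_le_abs_sub x z
    linarith
  have h2 := sq_abs x
  have h3 := sq_abs (x - z)
  have h4 := abs_nonneg x
  constructor
  · nlinarith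
  · nlinarith

theorem abs_gaussComb_le_of_far (hc : ∑ j ∈ s, |c j| ≤ 2) {r x : ℝ} (hr : 0 ≤ r)
    (hy : ∀ j ∈ s, |y j| ≤ 3 * r) (hx : 5 * r < |x|) :
    |gaussComb s c y x| ≤ 2 * (Real.exp (-r ^ 2) ^ 2 * Real.exp (-(2 / 25) * x ^ 2)) := by
  refine abs_sum_mul_le hc (by positivity) fun j hj => ?_
  obtain ⟨h1, h2⟩ := sq_sub_ge_of_far hr (hy j hj) hx
  rw [abs_of_nonneg (gaussDensity_nonneg _ _), ← Real.exp_nat_mul, ← Real.exp_add]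
  refine (gaussDensity_quarter_le _).trans (Real.exp_le_exp.2 ?_)
  push_cast
  nlinarith [sq_nonneg r]

theorem abs_gaussCombDeriv_le_of_far (hc : ∑ j ∈ s, |c j| ≤ 2) {r x : ℝ} (hr : 0 ≤ r)
    (hy : ∀ j ∈ s, |y j| ≤ 3 * r) (hx : 5 * r < |x|) :
    |gaussCombDeriv s c y x| ≤ 2 * (4 * (Real.exp (-r ^ 2) ^ 2 * Real.exp (-(2 / 25) * x ^ 2))) := by
  refine abs_sum_mul_le hc (by positivity) fun j hj => ?_
  obtain ⟨h1, h2⟩ := sq_sub_ge_of_far hr (hy j hj) hx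
  refine (abs_gaussDeriv_le _).trans ?_
  rw [← Real.exp_nat_mul, ← Real.exp_add]
  gcongr
  push_cast
  nlinarith [sq_nonneg r]

theorem integrable_gaussDensity_sub (z : ℝ) : Integrable fun x => gaussDensity (1 / 4) (x - z) :=
  integrable_gaussianPDFReal z (1 / 4)

theorem integrable_gaussDeriv_sub (z : ℝ) : Integrable fun x => gaussDeriv (x - z) := by
  have h : Integrable fun x : ℝ => 4 * Real.exp (-(3 / 2) * (x - z) ^ 2) :=
    ((integrable_exp_neg_mul_sq (b := 3 / 2) (by norm_num)).comp_sub_right z).const_mul 4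
  refine h.mono' ?_ (Filter.Eventually.of_forall fun x => abs_gaussDeriv_le _)
  exact (((continuous_id.sub continuous_const).const_mul (-4)).mul
    (continuous_gaussDensity_sub z)).aestronglyMeasurable

theorem integrable_gaussComb : Integrable (gaussComb s c y) :=
  integrable_finsetSum _ fun _ _ => (integrable_gaussDensity_sub _).const_mul _

theorem integrable_gaussCombDeriv : Integrable (gaussCombDeriv s c y) :=
  integrable_finsetSum _ fun _ _ => (integrable_gaussDeriv_sub _).const_mul _

/-- Integration by parts without boundary terms, since all three products involved are integrable.
-/
theorem integral_gaussComb_sq_eq (hc : ∑ j ∈ s, |c j| ≤ 2) :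
    ∫ x, gaussComb s c y x ^ 2 = -∫ x, gaussCombCDF s c y x * gaussCombDeriv s c y x := by
  have bdd : ∀ f : ℝ → ℝ, Integrable f → Integrable fun x => gaussCombCDF s c y x * f x := by
    intro f hf
    exact hf.bdd_mul continuous_gaussCombCDF.aestronglyMeasurable
      (Filter.Eventually.of_forall fun x => abs_gaussCombCDF_le hc x)
  have h := integral_mul_deriv_eq_deriv_mul_of_integrable (u := gaussCombCDF s c y)
    (v := gaussComb s c y) (fun x _ => hasDerivAt_gaussCombCDF x) (fun x _ => hasDerivAt_gaussComb x)
    (bdd _ integrable_gaussCombDeriv)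
    (integrable_gaussComb_sq.congr (Filter.Eventually.of_forall fun x => sq _))
    (bdd _ integrable_gaussComb)
  rw [h, neg_neg]
  simp_rw [sq]

theorem integral_exp_tail_le : ∫ x : ℝ, Real.exp (-(2 / 25) * x ^ 2) ≤ 7 := by
  rw [integral_gaussian, Real.sqrt_le_left (by norm_num)]
  linarith [Real.pi_lt_d2]

/-- The inverse inequality. After integration by parts, weighted AM-GM on [-5r, 5r] splits the
product of distribution function and derivative; outside, the product is at most 16·exp(-2r²) times
a Gaussian. -/
theorem integral_gaussComb_sq_le (hc : ∑ j ∈ s, |c j| ≤ 2) {r : ℝ} (hr : 1 ≤ r)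
    (hy : ∀ j ∈ s, |y j| ≤ 3 * r) :
    ∫ x, gaussComb s c y x ^ 2 ≤
      36 * r ^ 2 * (∫ x in Set.Icc (-(5 * r)) (5 * r), gaussCombCDF s c y x ^ 2) +
        230 * Real.exp (-r ^ 2) ^ 2 := by
  set η := Real.exp (-r ^ 2) with hη
  have hg : Integrable fun x : ℝ => Real.exp (-(2 / 25) * x ^ 2) :=
    integrable_exp_neg_mul_sq (by norm_num)
  have hP : IntegrableOn (fun x => gaussCombCDF s c y x ^ 2) (Set.Icc (-(5 * r)) (5 * r)) :=
    (continuous_gaussCombCDF.pow 2).continuousOn.integrableOn_compact isCompact_Icc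
  have hP' := hP.integrable_indicator measurableSet_Icc
  have hpt : ∀ x, -(gaussCombCDF s c y x * gaussCombDeriv s c y x) ≤
      18 * r ^ 2 * (Set.Icc (-(5 * r)) (5 * r)).indicator (fun x => gaussCombCDF s c y x ^ 2) x +
        1 / (72 * r ^ 2) * gaussCombDeriv s c y x ^ 2 +
        16 * η ^ 2 * Real.exp (-(2 / 25) * x ^ 2) := by
    intro x
    have hpos : 0 ≤ 16 * η ^ 2 * Real.exp (-(2 / 25) * x ^ 2) := by positivity
    by_cases hx : x ∈ Set.Icc (-(5 * r)) (5 * r)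
    · rw [Set.indicator_of_mem hx]
      have key : 18 * r ^ 2 * gaussCombCDF s c y x ^ 2 +
          1 / (72 * r ^ 2) * gaussCombDeriv s c y x ^ 2 +
          gaussCombCDF s c y x * gaussCombDeriv s c y x =
          1 / (72 * r ^ 2) * (36 * r ^ 2 * gaussCombCDF s c y x + gaussCombDeriv s c y x) ^ 2 := by
        field_simp; ring
      have : 0 ≤ 1 / (72 * r ^ 2) *
        (36 * r ^ 2 * gaussCombCDF s c y x + gaussCombDeriv s c y x) ^ 2 := by positivity
      linarith
    · rw [Set.indicator_of_notMem hx]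
      have hx' : 5 * r < |x| := by
        by_contra! h
        exact hx (abs_le.1 h)
      have h1 := abs_gaussCombDeriv_le_of_far hc (by linarith) hy hx'
      have h2 := abs_gaussCombCDF_le (y := y) hc x
      have h3 : |gaussCombCDF s c y x * gaussCombDeriv s c y x| ≤
          2 * (2 * (4 * (η ^ 2 * Real.exp (-(2 / 25) * x ^ 2)))) := by
        rw [abs_mul]; gcongr
      have : 0 ≤ 1 / (72 * r ^ 2) * gaussCombDeriv s c y x ^ 2 := by positivity
      linarith [neg_abs_le (gaussCombCDF s c y x * gaussCombDeriv s c y x)]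
  have hr2 : 0 < r ^ 2 := by positivity
  have hA : Integrable fun x =>
      18 * r ^ 2 * (Set.Icc (-(5 * r)) (5 * r)).indicator (fun x => gaussCombCDF s c y x ^ 2) x +
        1 / (72 * r ^ 2) * gaussCombDeriv s c y x ^ 2 :=
    (hP'.const_mul _).add (integrable_gaussCombDeriv_sq.const_mul _)
  have hI : ∫ x, gaussComb s c y x ^ 2 ≤
      18 * r ^ 2 * (∫ x in Set.Icc (-(5 * r)) (5 * r), gaussCombCDF s c y x ^ 2) +
        1 / (72 * r ^ 2) * (∫ x, gaussCombDeriv s c y x ^ 2) +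
        16 * η ^ 2 * ∫ x : ℝ, Real.exp (-(2 / 25) * x ^ 2) := by
    rw [integral_gaussComb_sq_eq hc, ← integral_neg, ← integral_indicator measurableSet_Icc,
      ← integral_const_mul, ← integral_const_mul, ← integral_const_mul,
      ← integral_add (hP'.const_mul _) (integrable_gaussCombDeriv_sq.const_mul _),
      ← integral_add hA (hg.const_mul _)]
    refine integral_mono (integrable_gaussCombDeriv.bdd_mul
      continuous_gaussCombCDF.aestronglyMeasurable
      (Filter.Eventually.of_forall fun x => abs_gaussCombCDF_le hc x)).neg
      (hA.add (hg.const_mul _)) hpt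
  have hD := integral_gaussCombDeriv_sq_le (y := y) hc r
  -- The weight 1/(72r²) is chosen so that the Bernstein inequality returns exactly half of the
  -- left-hand side, which is then absorbed.
  have h1 : 1 / (72 * r ^ 2) * (∫ x, gaussCombDeriv s c y x ^ 2) ≤
      1 / 2 * (∫ x, gaussComb s c y x ^ 2) + 2 * η ^ 2 := by
    rw [div_mul_eq_mul_div, one_mul, div_le_iff₀ (by positivity)]
    have : η ^ 2 ≤ η ^ 2 * r ^ 2 := le_mul_of_one_le_right (sq_nonneg _) (one_le_pow₀ hr)
    nlinarith
  have h2 : 16 * η ^ 2 * ∫ x : ℝ, Real.exp (-(2 / 25) * x ^ 2) ≤ 16 * η ^ 2 * 7 :=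
    mul_le_mul_of_nonneg_left integral_exp_tail_le (by positivity)
  nlinarith [sq_nonneg η]

/-- Cauchy-Schwarz on an interval of length 10r in the form |p| ≤ τ/2 + p²/(2τ), with τ left free
for later balancing, plus the Gaussian tail. -/
theorem integral_abs_gaussComb_le (hc : ∑ j ∈ s, |c j| ≤ 2) {r τ : ℝ} (hr : 0 ≤ r) (hτ : 0 < τ)
    (hy : ∀ j ∈ s, |y j| ≤ 3 * r) :
    ∫ x, |gaussComb s c y x| ≤
      5 * r * τ + (∫ x, gaussComb s c y x ^ 2) / (2 * τ) + 14 * Real.exp (-r ^ 2) ^ 2 := by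
  set η := Real.exp (-r ^ 2) with hη
  have hg : Integrable fun x : ℝ => Real.exp (-(2 / 25) * x ^ 2) :=
    integrable_exp_neg_mul_sq (by norm_num)
  have hI : Integrable ((Set.Icc (-(5 * r)) (5 * r)).indicator fun _ => τ / 2) :=
    (integrableOn_const (by simp)).integrable_indicator measurableSet_Icc
  have hpt : ∀ x, |gaussComb s c y x| ≤ (Set.Icc (-(5 * r)) (5 * r)).indicator (fun _ => τ / 2) x +
      1 / (2 * τ) * gaussComb s c y x ^ 2 + 2 * η ^ 2 * Real.exp (-(2 / 25) * x ^ 2) := by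
    intro x
    have hpos : 0 ≤ 2 * η ^ 2 * Real.exp (-(2 / 25) * x ^ 2) := by positivity
    have hpos' : 0 ≤ 1 / (2 * τ) * gaussComb s c y x ^ 2 := by positivity
    by_cases hx : x ∈ Set.Icc (-(5 * r)) (5 * r)
    · rw [Set.indicator_of_mem hx]
      have key : τ / 2 + 1 / (2 * τ) * gaussComb s c y x ^ 2 - |gaussComb s c y x| =
          1 / (2 * τ) * (τ - |gaussComb s c y x|) ^ 2 := by
        rw [← sq_abs]; field_simp; ring
      have : 0 ≤ 1 / (2 * τ) * (τ - |gaussComb s c y x|) ^ 2 := by positivity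
      linarith
    · rw [Set.indicator_of_notMem hx]
      have hx' : 5 * r < |x| := by
        by_contra! h
        exact hx (abs_le.1 h)
      have h1 := abs_gaussComb_le_of_far hc hr hy hx'
      linarith
  have hA : Integrable fun x => (Set.Icc (-(5 * r)) (5 * r)).indicator (fun _ => τ / 2) x +
      1 / (2 * τ) * gaussComb s c y x ^ 2 := hI.add (integrable_gaussComb_sq.const_mul _)
  calc ∫ x, |gaussComb s c y x| ≤ ∫ x, ((Set.Icc (-(5 * r)) (5 * r)).indicator (fun _ => τ / 2) x +
      1 / (2 * τ) * gaussComb s c y x ^ 2 + 2 * η ^ 2 * Real.exp (-(2 / 25) * x ^ 2)) :=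
        integral_mono integrable_gaussComb.abs
          (hA.add (hg.const_mul _)) hpt
    _ = 5 * r * τ + (∫ x, gaussComb s c y x ^ 2) / (2 * τ) +
        2 * η ^ 2 * ∫ x : ℝ, Real.exp (-(2 / 25) * x ^ 2) := by
      rw [integral_add hA (hg.const_mul _),
        integral_add hI (integrable_gaussComb_sq.const_mul _), integral_const_mul,
        integral_const_mul, integral_indicator measurableSet_Icc, setIntegral_const,
        Real.volume_real_Icc_of_le (by linarith), smul_eq_mul]
      ring
    _ ≤ _ := by nlinarith [sq_nonneg η, integral_exp_tail_le]

theorem abs_gaussCombCDF_sub_le (hc : ∑ j ∈ s, |c j| ≤ 2) (x z : ℝ) :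
    |gaussCombCDF s c y x - gaussCombCDF s c y z| ≤ 2 * |x - z| :=
  Convex.norm_image_sub_le_of_norm_hasDerivWithin_le (s := Set.univ) (C := 2)
    (fun x _ => (hasDerivAt_gaussCombCDF x).hasDerivWithinAt) (fun x _ => abs_gaussComb_le hc x)
    convex_univ (Set.mem_univ z) (Set.mem_univ x)

/-- The distribution function is 2-Lipschitz and the cells have length 1/(2E), so it moves by at
most 1/E within a cell; then (a + b)² ≤ 2a² + 2b². -/
theorem integral_gaussCombCDF_sq_le (hc : ∑ j ∈ s, |c j| ≤ 2) {r N : ℕ} (hr : 1 ≤ r) (hN : 1 ≤ N) :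
    ∫ x in Set.Icc (-(5 * r : ℝ)) (5 * r), gaussCombCDF s c y x ^ 2 ≤
      (1 / scale r N) * ∑ i ∈ Finset.range (gridSize r N + 1),
        gaussCombCDF s c y (gridPoint r N i) ^ 2 + (1 / N : ℝ) ^ 2 := by
  have hE : 1 ≤ scale r N := scale_pos hr hN
  have hE0 : (0 : ℝ) < scale r N := by exact_mod_cast hE
  have hr0 : (0 : ℝ) < r := by exact_mod_cast hr
  have hN0 : (0 : ℝ) < N := by exact_mod_cast hN
  have hcont : Continuous fun x => gaussCombCDF s c y x ^ 2 := continuous_gaussCombCDF.pow 2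
  have g0 : gridPoint r N 0 = -(5 * r) := by
    rw [gridPoint]; push_cast; field_simp; ring
  have g1 : gridPoint r N (gridSize r N) = 5 * r := by
    rw [gridPoint, gridSize]; push_cast; field_simp; ring
  have glen : ∀ i, gridPoint r N (i + 1) - gridPoint r N i = 1 / (2 * scale r N) := by
    intro i; rw [gridPoint, gridPoint]; push_cast; field_simp; ring
  have hcell : ∀ i ∈ Finset.range (gridSize r N),
      ∫ x in gridPoint r N i..gridPoint r N (i + 1), gaussCombCDF s c y x ^ 2 ≤
        (2 * gaussCombCDF s c y (gridPoint r N i) ^ 2 + 2 / (scale r N : ℝ) ^ 2) *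
          (1 / (2 * scale r N)) := by
    intro i _
    have hle : gridPoint r N i ≤ gridPoint r N (i + 1) := by
      have : 0 < 1 / (2 * (scale r N : ℝ)) := by positivity
      linarith [glen i]
    rw [← glen i, mul_comm, ← smul_eq_mul, ← intervalIntegral.integral_const]
    refine intervalIntegral.integral_mono_on hle (hcont.intervalIntegrable _ _)
      (continuous_const.intervalIntegrable _ _) fun x hx => ?_
    have h1 := abs_gaussCombCDF_sub_le (y := y) hc x (gridPoint r N i)
    rw [abs_of_nonneg (sub_nonneg.2 hx.1)] at h1
    have h2 : 2 * (x - gridPoint r N i) ≤ 1 / scale r N := by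
      have := glen i
      have e : 2 * (1 / (2 * (scale r N : ℝ))) = 1 / scale r N := by field_simp
      linarith [hx.2]
    have h3 := sq_le_sq' (abs_le.1 (h1.trans h2)).1 (abs_le.1 (h1.trans h2)).2
    rw [div_pow, one_pow] at h3
    rw [show 2 / (scale r N : ℝ) ^ 2 = 2 * (1 / (scale r N : ℝ) ^ 2) by ring]
    nlinarith [sq_nonneg (gaussCombCDF s c y x - 2 * gaussCombCDF s c y (gridPoint r N i))]
  rw [integral_Icc_eq_integral_Ioc, ← intervalIntegral.integral_of_le (by linarith)]
  nth_rw 1 [← g0]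
  rw [← g1, ← intervalIntegral.sum_integral_adjacent_intervals
    (fun i _ => hcont.intervalIntegrable _ _)]
  refine (Finset.sum_le_sum hcell).trans ?_
  rw [← Finset.sum_mul, Finset.sum_add_distrib, ← Finset.mul_sum, Finset.sum_const,
    Finset.card_range, nsmul_eq_mul, add_mul]
  have hlast : ∑ i ∈ Finset.range (gridSize r N), gaussCombCDF s c y (gridPoint r N i) ^ 2 ≤
      ∑ i ∈ Finset.range (gridSize r N + 1), gaussCombCDF s c y (gridPoint r N i) ^ 2 := by
    rw [Finset.sum_range_succ]; linarith [sq_nonneg (gaussCombCDF s c y (gridPoint r N (gridSize r N)))]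
  apply add_le_add
  · calc _ = 1 / scale r N * ∑ i ∈ Finset.range (gridSize r N),
          gaussCombCDF s c y (gridPoint r N i) ^ 2 := by field_simp
      _ ≤ _ := by gcongr
  · rw [gridSize, scale]
    push_cast
    rw [div_pow, one_pow, show (20 * (r : ℝ) * (16 * r * N)) * (2 / (16 * r * N) ^ 2) *
      (1 / (2 * (16 * r * N))) = 20 / 256 / r / N ^ 2 by field_simp; norm_num]
    gcongr
    rw [div_le_one hr0]
    have : (1 : ℝ) ≤ r := by exact_mod_cast hr
    linarith

end

/-! ### Convergence of the greedy algorithm -/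

/-- Expand the square when a round is added. The cross term is controlled because the chosen
component does at least as well as the w-average of all components, and that average is within η of
the target; the last term is at most B² per grid point. No step size or projection is needed. -/
theorem sum_discrepancy_sq_le {O : Oracle} {r N t : ℕ} {idx : ℕ → ℕ} (hg : Greedy O r N idx t)
    {w : ℕ → ℝ} (h0 : ∀ j, 0 ≤ w j) (h1 : ∑ j ∈ Finset.range (6 * r * r + 1), w j = 1)
    {η B : ℝ} (hη : 0 ≤ η) (hB : 0 ≤ B)
    (hw : ∀ i ≤ gridSize r N, |∑ j ∈ Finset.range (6 * r * r + 1), w j * (feature r N j i : ℝ) -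
      answer O r N i| ≤ η)
    (hf : ∀ i ≤ gridSize r N, ∀ j ≤ 6 * r * r, |(feature r N j i : ℝ) - answer O r N i| ≤ B) :
    ∑ i ∈ Finset.range (gridSize r N + 1), (discrepancy O r N idx t i : ℝ) ^ 2 ≤
      (gridSize r N + 1) * (t * η + B * √t) ^ 2 := by
  suffices ∀ u ≤ t, ∑ i ∈ Finset.range (gridSize r N + 1), (discrepancy O r N idx u i : ℝ) ^ 2 ≤
      (gridSize r N + 1) * (u * η + B * √u) ^ 2 from this t le_rfl
  intro u
  induction u with
  | zero => intro _; simp [discrepancy]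
  | succ u ih =>
    intro hu
    have ih := ih (by omega)
    set G := Finset.range (gridSize r N + 1) with hG
    set m : ℝ := gridSize r N + 1 with hm
    set D : ℝ := u * η + B * √u with hD
    have hm0 : 0 ≤ m := by positivity
    have hD0 : 0 ≤ D := by positivity
    set S : ℕ → ℝ := fun i => discrepancy O r N idx u i with hS
    set b : ℕ → ℝ := fun i => answer O r N i with hb
    have hcard : (G.card : ℝ) = m := by rw [hG, Finset.card_range]; push_cast; rfl
    have hexp : ∑ i ∈ G, (discrepancy O r N idx (u + 1) i : ℝ) ^ 2 =
        ∑ i ∈ G, S i ^ 2 + 2 * (∑ i ∈ G, S i * (feature r N (idx u) i : ℝ) - ∑ i ∈ G, S i * b i) +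
          ∑ i ∈ G, ((feature r N (idx u) i : ℝ) - b i) ^ 2 := by
      rw [← Finset.sum_sub_distrib, Finset.mul_sum, ← Finset.sum_add_distrib,
        ← Finset.sum_add_distrib]
      refine Finset.sum_congr rfl fun i _ => ?_
      rw [discrepancy_succ]; push_cast; ring
    -- A minimum is at most a weighted average.
    have hmin : ∑ i ∈ G, S i * (feature r N (idx u) i : ℝ) ≤
        ∑ i ∈ G, S i * ∑ j ∈ Finset.range (6 * r * r + 1), w j * (feature r N j i : ℝ) := by
      have hj : ∀ j ∈ Finset.range (6 * r * r + 1), w j * ∑ i ∈ G, S i * (feature r N (idx u) i : ℝ)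
          ≤ w j * ∑ i ∈ G, S i * (feature r N j i : ℝ) := by
        intro j hj
        refine mul_le_mul_of_nonneg_left ?_ (h0 j)
        have := hg.score_le u (by omega) j (by simpa [Nat.lt_succ_iff] using hj)
        unfold score at this
        have h' := Int.cast_le (R := ℝ).2 this
        push_cast at h'
        exact h'
      have := Finset.sum_le_sum hj
      rw [← Finset.sum_mul, h1, one_mul] at this
      refine this.trans_eq ?_
      simp_rw [Finset.mul_sum]
      rw [Finset.sum_comm]
      refine Finset.sum_congr rfl fun i _ => Finset.sum_congr rfl fun j _ => by ring
    have habs : ∑ i ∈ G, |S i| ≤ m * D := by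
      apply abs_le_of_sq_le_sq' _ (by positivity) |>.2
      calc (∑ i ∈ G, |S i|) ^ 2 ≤ G.card * ∑ i ∈ G, |S i| ^ 2 := sq_sum_le_card_mul_sum_sq
        _ = m * ∑ i ∈ G, S i ^ 2 := by rw [hcard]; simp_rw [sq_abs]
        _ ≤ m * (m * D ^ 2) := by gcongr
        _ = (m * D) ^ 2 := by ring
    have hlin : ∑ i ∈ G, S i * (feature r N (idx u) i : ℝ) - ∑ i ∈ G, S i * b i ≤ m * D * η := by
      calc _ ≤ ∑ i ∈ G, S i * (∑ j ∈ Finset.range (6 * r * r + 1), w j * (feature r N j i : ℝ) -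
            b i) := by
            simp_rw [mul_sub]
            rw [Finset.sum_sub_distrib]
            linarith
        _ ≤ ∑ i ∈ G, |S i| * η := by
            refine Finset.sum_le_sum fun i hi => (le_abs_self _).trans ?_
            rw [abs_mul]
            exact mul_le_mul_of_nonneg_left
              (hw i (by simpa [hG, Nat.lt_succ_iff] using hi)) (abs_nonneg _)
        _ = (∑ i ∈ G, |S i|) * η := by rw [Finset.sum_mul]
        _ ≤ _ := by gcongr
    have hsq : ∑ i ∈ G, ((feature r N (idx u) i : ℝ) - b i) ^ 2 ≤ m * B ^ 2 := by
      rw [← hcard, ← nsmul_eq_mul]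
      refine Finset.sum_le_card_nsmul _ _ _ fun i hi => ?_
      exact sq_le_sq' (abs_le.1 (hf i (by simpa [hG, Nat.lt_succ_iff] using hi) _ (hg.index_le u))).1
        (abs_le.1 (hf i (by simpa [hG, Nat.lt_succ_iff] using hi) _ (hg.index_le u))).2
    have hs1 := Real.sq_sqrt (Nat.cast_nonneg (α := ℝ) u)
    have hs2 := Real.sq_sqrt (Nat.cast_nonneg (α := ℝ) (u + 1))
    have hs3 : √(u : ℝ) ≤ √((u + 1 : ℕ) : ℝ) := Real.sqrt_le_sqrt (by push_cast; linarith)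
    -- The recursion for D = uη + B√u closes because the cross term only grows with √u and B²(u + 1)
    -- is exactly the new square.
    have hstep : (D + η) ^ 2 + B ^ 2 ≤ (((u + 1 : ℕ) : ℝ) * η + B * √((u + 1 : ℕ) : ℝ)) ^ 2 := by
      set p := √(u : ℝ)
      set q := √((u + 1 : ℕ) : ℝ)
      have e1 : (D + η) ^ 2 + B ^ 2 = (((u : ℝ) + 1) * η) ^ 2 + 2 * (((u : ℝ) + 1) * η) * B * p +
          B ^ 2 * (p ^ 2 + 1) := by rw [hD]; ring
      have e2 : (((u + 1 : ℕ) : ℝ) * η + B * q) ^ 2 = (((u : ℝ) + 1) * η) ^ 2 +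
          2 * (((u : ℝ) + 1) * η) * B * q + B ^ 2 * q ^ 2 := by push_cast; ring
      rw [e1, e2, hs1, hs2]
      push_cast
      gcongr
    rw [hexp]
    calc _ ≤ m * D ^ 2 + 2 * (m * D * η) + m * B ^ 2 := by gcongr
      _ ≤ m * ((D + η) ^ 2 + B ^ 2) := by nlinarith [mul_nonneg hm0 (sq_nonneg η)]
      _ ≤ _ := by gcongr

theorem sum_visits_mul {idx : ℕ → ℕ} {n : ℕ} (h : ∀ u, idx u ≤ n) (t : ℕ) (f : ℕ → ℝ) :
    ∑ j ∈ Finset.range (n + 1), (visits idx t j : ℝ) * f j = ∑ u ∈ Finset.range t, f (idx u) := by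
  induction t with
  | zero => simp [visits]
  | succ t ih =>
    rw [Finset.sum_range_succ (fun u => f (idx u)), ← ih]
    simp_rw [visits_succ]
    push_cast
    simp_rw [add_mul]
    rw [Finset.sum_add_distrib]
    congr 1
    simp [h t]

theorem rounds_pos {r N : ℕ} (hr : 1 ≤ r) (hN : 1 ≤ N) : 0 < rounds r N := by
  unfold rounds; positivity

/-- The weights computed by the learner. -/
noncomputable def empiricalWeight (idx : ℕ → ℕ) (t j : ℕ) : ℝ := (visits idx t j : ℝ) / t

theorem empiricalWeight_nonneg (idx : ℕ → ℕ) (t j : ℕ) : 0 ≤ empiricalWeight idx t j := by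
  unfold empiricalWeight; positivity

theorem sum_empiricalWeight {idx : ℕ → ℕ} {n t : ℕ} (h : ∀ u, idx u ≤ n) (ht : 0 < t) :
    ∑ j ∈ Finset.range (n + 1), empiricalWeight idx t j = 1 := by
  have := sum_visits_mul h t fun _ => 1
  simp only [mul_one, Finset.sum_const, Finset.card_range, nsmul_eq_mul] at this
  have ht' : (t : ℝ) ≠ 0 := by exact_mod_cast ht.ne'
  simp_rw [empiricalWeight]
  rw [← Finset.sum_div, this, div_self ht']

/-- Identifies the error of the output mixture on the grid with the average discrepancy. -/
theorem sum_empiricalWeight_mul_feature {O : Oracle} {r N t : ℕ} {idx : ℕ → ℕ}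
    (h : ∀ u, idx u ≤ 6 * r * r) (ht : 0 < t) (i : ℕ) :
    ∑ j ∈ Finset.range (6 * r * r + 1), empiricalWeight idx t j * (feature r N j i : ℝ) =
      discrepancy O r N idx t i / t + answer O r N i := by
  have := sum_visits_mul h t fun j => (feature r N j i : ℝ)
  have ht' : (t : ℝ) ≠ 0 := by exact_mod_cast ht.ne'
  have e : ∑ j ∈ Finset.range (6 * r * r + 1), empiricalWeight idx t j * (feature r N j i : ℝ) =
      (∑ u ∈ Finset.range t, (feature r N (idx u) i : ℝ)) / t := by
    rw [← this, Finset.sum_div]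
    refine Finset.sum_congr rfl fun j _ => ?_
    rw [empiricalWeight]; ring
  rw [e, discrepancy]
  push_cast
  rw [Finset.sum_sub_distrib, Finset.sum_const, Finset.card_range, nsmul_eq_mul]
  field_simp
  ring

theorem abs_latticePoint_le {r j : ℕ} (hr : 1 ≤ r) (hj : j ≤ 6 * r * r) :
    |latticePoint r j| ≤ 3 * r := by
  have hr0 : (0 : ℝ) < r := by exact_mod_cast hr
  have hj' : (j : ℝ) ≤ 6 * r * r := by exact_mod_cast hj
  have hj0 : (0 : ℝ) ≤ j := Nat.cast_nonneg j
  rw [latticePoint, abs_div, abs_of_pos hr0, div_le_iff₀ hr0, abs_le]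
  constructor <;> linarith

/-! ### Error budget -/

theorem abs_answer_sub_le {O : Oracle} {f : Measure ℝ} (hO : GivesAccessTo O f) {r N : ℕ}
    (hr : 1 ≤ r) (hN : 1 ≤ N) (i : ℕ) :
    |f.real (Set.Iic (gridPoint r N i)) - (answer O r N i : ℝ) / (2 * scale r N)| ≤ 1 / N := by
  have hE : 1 ≤ scale r N := scale_pos hr hN
  have hN0 : (0 : ℝ) < N := by exact_mod_cast hN
  have hr1 : (1 : ℝ) ≤ r := by exact_mod_cast hr
  have h := hO (i - 10 * r * scale r N) (2 * scale r N) (by omega)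
  push_cast at h
  refine h.trans (one_div_le_one_div_of_le hN0 ?_)
  rw [scale]; push_cast
  nlinarith

theorem abs_oracle_le {O : Oracle} {f : Measure ℝ} [IsProbabilityMeasure f]
    (hO : GivesAccessTo O f) (a m : ℤ) (hm : 1 ≤ m) : |O a m| ≤ m + 1 := by
  have h := hO a m hm
  have hm0 : (0 : ℝ) < m := by exact_mod_cast hm
  have h0 : 0 ≤ f.real (Set.Iic ((a : ℝ) / m)) := measureReal_nonneg
  have h1 : f.real (Set.Iic ((a : ℝ) / m)) ≤ 1 := measureReal_le_one
  rw [abs_le] at h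
  have h2 : (O a m : ℝ) / m ≤ (1 + m) / m := by rw [add_div, div_self hm0.ne']; linarith
  have h3 : -1 / m ≤ (O a m : ℝ) / m := by rw [neg_div]; linarith
  rw [div_le_div_iff_of_pos_right hm0] at h2 h3
  rw [abs_le]
  constructor
  · have : (-1 : ℤ) ≤ O a m := by exact_mod_cast h3
    omega
  · have : O a m ≤ 1 + m := by exact_mod_cast h2
    omega

theorem abs_real_sub_le_tvDistance {μ ν : Measure ℝ} [IsProbabilityMeasure μ]
    [IsProbabilityMeasure ν] {A : Set ℝ} (hA : MeasurableSet A) :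
    |μ.real A - ν.real A| ≤ tvDistance μ ν := by
  refine le_ciSup (f := fun A : {A : Set ℝ // MeasurableSet A} => |μ.real A.1 - ν.real A.1|)
    ⟨1, ?_⟩ ⟨A, hA⟩
  rintro _ ⟨B, rfl⟩
  have h1 : 0 ≤ μ.real B.1 := measureReal_nonneg
  have h2 : μ.real B.1 ≤ 1 := measureReal_le_one
  have h3 : 0 ≤ ν.real B.1 := measureReal_nonneg
  have h4 : ν.real B.1 ≤ 1 := measureReal_le_one
  exact abs_le.2 ⟨by linarith, by linarith⟩

theorem abs_sum_mul_le_of_sum_eq_one {s : Finset ℕ} {w f : ℕ → ℝ} {b : ℝ} (h0 : ∀ j, 0 ≤ w j)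
    (h1 : ∑ j ∈ s, w j = 1) (hf : ∀ j ∈ s, |f j| ≤ b) : |∑ j ∈ s, w j * f j| ≤ b := by
  calc |∑ j ∈ s, w j * f j| ≤ ∑ j ∈ s, |w j * f j| := Finset.abs_sum_le_sum_abs _ _
    _ ≤ ∑ j ∈ s, w j * b := Finset.sum_le_sum fun j hj => by
        rw [abs_mul, abs_of_nonneg (h0 j)]; exact mul_le_mul_of_nonneg_left (hf j hj) (h0 j)
    _ = b := by rw [← Finset.sum_mul, h1, one_mul]

theorem abs_sum_mul_feature_sub_le {r N : ℕ} (hr : 1 ≤ r) (hN : 1 ≤ N) (hrN : N < 2 ^ r ^ 2)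
    {w : ℕ → ℝ} (h0 : ∀ j, 0 ≤ w j) (h1 : ∑ j ∈ Finset.range (6 * r * r + 1), w j = 1) {i : ℕ}
    (hi : i ≤ gridSize r N) :
    |(∑ j ∈ Finset.range (6 * r * r + 1), w j * (feature r N j i : ℝ)) / (2 * scale r N) -
      (latticeMixture r w h0 h1).toMeasure.real (Set.Iic (gridPoint r N i))| ≤ 36 * r / N := by
  rw [latticeMixture_real, Finset.sum_div, ← Finset.sum_sub_distrib]
  have := abs_sum_mul_le_of_sum_eq_one h0 h1 fun j hj =>
    abs_feature_sub_le hr hN hrN hi (by simpa [Nat.lt_succ_iff] using hj : j ≤ 6 * r * r)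
  convert this using 3 with j
  ring

theorem gaussComb_latticePoint_eq {r : ℕ} {v w : ℕ → ℝ} (hv0 : ∀ j, 0 ≤ v j)
    (hv1 : ∑ j ∈ Finset.range (6 * r * r + 1), v j = 1) (hw0 : ∀ j, 0 ≤ w j)
    (hw1 : ∑ j ∈ Finset.range (6 * r * r + 1), w j = 1) (x : ℝ) :
    gaussComb (Finset.range (6 * r * r + 1)) (fun j => v j - w j) (latticePoint r) x =
      (latticeMixture r v hv0 hv1).density x - (latticeMixture r w hw0 hw1).density x := by
  rw [latticeMixture_density, latticeMixture_density, ← Finset.sum_sub_distrib]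
  refine Finset.sum_congr rfl fun j _ => ?_
  rw [← sub_mul, gaussianPDFReal_eq_gaussDensity]
  norm_num

theorem gaussCombCDF_latticePoint_eq {r : ℕ} {v w : ℕ → ℝ} (hv0 : ∀ j, 0 ≤ v j)
    (hv1 : ∑ j ∈ Finset.range (6 * r * r + 1), v j = 1) (hw0 : ∀ j, 0 ≤ w j)
    (hw1 : ∑ j ∈ Finset.range (6 * r * r + 1), w j = 1) (x : ℝ) :
    gaussCombCDF (Finset.range (6 * r * r + 1)) (fun j => v j - w j) (latticePoint r) x =
      (latticeMixture r v hv0 hv1).toMeasure.real (Set.Iic x) -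
        (latticeMixture r w hw0 hw1).toMeasure.real (Set.Iic x) := by
  rw [latticeMixture_real, latticeMixture_real, ← Finset.sum_sub_distrib]
  refine Finset.sum_congr rfl fun j _ => ?_
  rw [← sub_mul, gaussianReal_real_Iic]

/-- Chains the grid bound, the inverse inequality and the passage to L¹. The powers of r accumulate
as r³ε² for ∫P², r⁵ε² for ∫p² and r³ε for ∫|p|. -/
theorem integral_abs_density_sub_le {r N : ℕ} (hr : 1 ≤ r) (hN : 1 ≤ N) (hrN : N < 2 ^ r ^ 2)
    {v w : ℕ → ℝ} (hv0 : ∀ j, 0 ≤ v j)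
    (hv1 : ∑ j ∈ Finset.range (6 * r * r + 1), v j = 1) (hw0 : ∀ j, 0 ≤ w j)
    (hw1 : ∑ j ∈ Finset.range (6 * r * r + 1), w j = 1) {ε : ℝ} (hε : 0 < ε) (hNε : 1 / N ≤ ε)
    (h : ∑ i ∈ Finset.range (gridSize r N + 1),
      ((latticeMixture r v hv0 hv1).toMeasure.real (Set.Iic (gridPoint r N i)) -
        (latticeMixture r w hw0 hw1).toMeasure.real (Set.Iic (gridPoint r N i))) ^ 2 ≤
          (gridSize r N + 1) * (86696 * (r * ε) ^ 2)) :
    ∫ x, |(latticeMixture r v hv0 hv1).density x - (latticeMixture r w hw0 hw1).density x| ≤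
      40000000 * r ^ 3 * ε := by
  have hE : 1 ≤ scale r N := scale_pos hr hN
  have hE0 : (0 : ℝ) < scale r N := by exact_mod_cast hE
  have hr1 : (1 : ℝ) ≤ r := by exact_mod_cast hr
  have hE1 : (1 : ℝ) ≤ scale r N := by exact_mod_cast hE
  have hη : Real.exp (-(r : ℝ) ^ 2) ≤ ε := (exp_neg_sq_le hN hrN).trans hNε
  have hη0 := Real.exp_pos (-(r : ℝ) ^ 2)
  have hη1 : Real.exp (-(r : ℝ) ^ 2) ≤ 1 := Real.exp_le_one_iff.2 (by nlinarith)
  have hy : ∀ j ∈ Finset.range (6 * r * r + 1), |latticePoint r j| ≤ 3 * (r : ℝ) := fun j hj =>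
    abs_latticePoint_le hr (by simpa [Nat.lt_succ_iff] using hj)
  have hc : ∑ j ∈ Finset.range (6 * r * r + 1), |v j - w j| ≤ 2 := by
    calc _ ≤ ∑ j ∈ Finset.range (6 * r * r + 1), (v j + w j) := Finset.sum_le_sum fun j _ =>
          abs_le.2 ⟨by linarith [hv0 j, hw0 j], by linarith [hv0 j, hw0 j]⟩
      _ = 2 := by rw [Finset.sum_add_distrib, hv1, hw1]; norm_num
  have h1 := integral_gaussCombCDF_sq_le (y := latticePoint r) hc hr hN
  have h2 := integral_gaussComb_sq_le hc hr1 hy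
  -- With ∫p² of order r⁵ε², the choice τ = r²ε makes both rτ and ∫p²/τ of order r³ε.
  have h3 := integral_abs_gaussComb_le hc (by linarith) (τ := r ^ 2 * ε) (by positivity) hy
  simp_rw [gaussCombCDF_latticePoint_eq hv0 hv1 hw0 hw1] at h1 h2
  simp_rw [gaussComb_latticePoint_eq hv0 hv1 hw0 hw1] at h2 h3
  set D := ∫ x in Set.Icc (-(5 * r : ℝ)) (5 * r),
    ((latticeMixture r v hv0 hv1).toMeasure.real (Set.Iic x) -
      (latticeMixture r w hw0 hw1).toMeasure.real (Set.Iic x)) ^ 2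
  set I := ∫ x, ((latticeMixture r v hv0 hv1).density x -
    (latticeMixture r w hw0 hw1).density x) ^ 2
  set η := Real.exp (-(r : ℝ) ^ 2)
  have hr3 : (1 : ℝ) ≤ r ^ 3 := one_le_pow₀ hr1
  have hr5 : (1 : ℝ) ≤ r ^ 5 := one_le_pow₀ hr1
  have hD : D ≤ 2000000 * (r ^ 3 * ε ^ 2) := by
    have hm : ((gridSize r N : ℝ) + 1) ≤ 21 * r * scale r N := by
      rw [gridSize]; push_cast
      nlinarith [mul_le_mul hr1 hE1 zero_le_one (by linarith)]
    have a1 : 1 / (scale r N : ℝ) * ((gridSize r N + 1) * (86696 * (r * ε) ^ 2)) ≤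
        1820616 * (r ^ 3 * ε ^ 2) := by
      calc _ ≤ 1 / (scale r N : ℝ) * (21 * r * scale r N * (86696 * (r * ε) ^ 2)) := by gcongr
        _ = _ := by field_simp; norm_num
    have a2 : (1 / N : ℝ) ^ 2 ≤ ε ^ 2 := by gcongr
    have a3 : ε ^ 2 ≤ r ^ 3 * ε ^ 2 := le_mul_of_one_le_left (sq_nonneg _) hr3
    have a4 : 1 / (scale r N : ℝ) * ∑ i ∈ Finset.range (gridSize r N + 1),
      ((latticeMixture r v hv0 hv1).toMeasure.real (Set.Iic (gridPoint r N i)) -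
        (latticeMixture r w hw0 hw1).toMeasure.real (Set.Iic (gridPoint r N i))) ^ 2 ≤
        1 / (scale r N : ℝ) * ((gridSize r N + 1) * (86696 * (r * ε) ^ 2)) := by gcongr
    linarith [sq_nonneg ε]
  have hI : I ≤ 73000000 * (r ^ 5 * ε ^ 2) := by
    have a1 : 36 * (r : ℝ) ^ 2 * D ≤ 36 * r ^ 2 * (2000000 * (r ^ 3 * ε ^ 2)) := by gcongr
    have a2 : η ^ 2 ≤ ε ^ 2 := by gcongr
    have a3 : ε ^ 2 ≤ r ^ 5 * ε ^ 2 := le_mul_of_one_le_left (sq_nonneg _) hr5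
    have a4 : 36 * (r : ℝ) ^ 2 * (2000000 * (r ^ 3 * ε ^ 2)) = 72000000 * (r ^ 5 * ε ^ 2) := by ring
    linarith [sq_nonneg ε]
  have b1 : I / (2 * (r ^ 2 * ε)) ≤ 36500000 * (r ^ 3 * ε) := by
    rw [div_le_iff₀ (by positivity)]
    refine hI.trans_eq ?_
    ring
  have b2 : η ^ 2 ≤ r ^ 3 * ε := by
    calc η ^ 2 ≤ η := by nlinarith
      _ ≤ 1 * ε := by linarith
      _ ≤ _ := by gcongr
  have b3 : 5 * (r : ℝ) * (r ^ 2 * ε) = 5 * (r ^ 3 * ε) := by ring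
  have b4 : 0 ≤ r ^ 3 * ε := by positivity
  linarith

/-- An ideal lattice mixture close to M exists and serves only as a competitor of the greedy
algorithm and as an intermediate point of the triangle inequality; the algorithm never sees it. -/
theorem tvDistance_latticeMixture_le {O : Oracle} {f : Measure ℝ} [IsProbabilityMeasure f]
    (hO : GivesAccessTo O f) {k : ℕ} {M : GaussianMixture k} (hM : M.WellConditioned 0.5) {ε : ℝ}
    (hε : 0 < ε) (hf : tvDistance f M.toMeasure ≤ ε) {r N : ℕ} (hr : 1 ≤ r) (hN : 1 ≤ N)
    (hrN : N < 2 ^ r ^ 2) (hNε : 1 / N ≤ ε) {idx : ℕ → ℕ} (hg : Greedy O r N idx (rounds r N)) :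
    tvDistance M.toMeasure (latticeMixture r (empiricalWeight idx (rounds r N))
      (empiricalWeight_nonneg idx _)
      (sum_empiricalWeight hg.index_le (rounds_pos hr hN))).toMeasure ≤ 50000000 * r ^ 3 * ε := by
  obtain ⟨w, hw0, hw1, hw⟩ := exists_latticeMixture hM hr
  have ht := rounds_pos hr hN
  have hE : 1 ≤ scale r N := scale_pos hr hN
  have hE0 : (0 : ℝ) < scale r N := by exact_mod_cast hE
  have hE1 : (1 : ℝ) ≤ scale r N := by exact_mod_cast hE
  have hr1 : (1 : ℝ) ≤ r := by exact_mod_cast hr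
  have hN0 : (0 : ℝ) < N := by exact_mod_cast hN
  have hT0 : (0 : ℝ) < rounds r N := by exact_mod_cast ht
  have hη : Real.exp (-(r : ℝ) ^ 2) ≤ ε := (exp_neg_sq_le hN hrN).trans hNε
  have hεr : ε ≤ r * ε := le_mul_of_one_le_left hε.le hr1
  have hrNε : 36 * r / (N : ℝ) ≤ 36 * (r * ε) := by
    calc 36 * r / (N : ℝ) = 36 * (r * (1 / N)) := by ring
      _ ≤ _ := by gcongr
  -- Contributions to 106: 36 for the table, 68 for the lattice, 1 for the distance of f from M, and
  -- 1 for the oracle.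
  have happ : ∀ i ≤ gridSize r N,
      |(∑ j ∈ Finset.range (6 * r * r + 1), w j * (feature r N j i : ℝ)) - answer O r N i| ≤
        2 * scale r N * (106 * (r * ε)) := by
    intro i hi
    have a1 := abs_sum_mul_feature_sub_le hr hN hrN hw0 hw1 hi
    have a2 := (M.abs_real_sub_le (latticeMixture r w hw0 hw1) (Set.Iic (gridPoint r N i))).trans hw
    have a3 := (abs_real_sub_le_tvDistance (μ := f) (ν := M.toMeasure)
      (measurableSet_Iic (a := gridPoint r N i))).trans hf
    have a4 := abs_answer_sub_le hO hr hN i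
    have e : (∑ j ∈ Finset.range (6 * r * r + 1), w j * (feature r N j i : ℝ)) - answer O r N i =
        2 * scale r N * ((∑ j ∈ Finset.range (6 * r * r + 1), w j * (feature r N j i : ℝ)) /
          (2 * scale r N) - answer O r N i / (2 * scale r N)) := by
      field_simp
    rw [e, abs_mul, abs_of_pos (by positivity : (0 : ℝ) < 2 * scale r N)]
    refine mul_le_mul_of_nonneg_left ?_ (by positivity)
    rw [abs_le] at *
    constructor <;> linarith [a1.1, a1.2, a2.1, a2.2, a3.1, a3.2, a4.1, a4.2]
  have hfeat : ∀ i ≤ gridSize r N, ∀ j ≤ 6 * r * r,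
      |(feature r N j i : ℝ) - answer O r N i| ≤ 2 * scale r N * 3 := by
    intro i hi j hj
    have := abs_feature_sub_answer_le (abs_oracle_le hO) hr hN hi hj
    have h' := Int.cast_le (R := ℝ).2 this
    push_cast at h'
    linarith
  have hS := sum_discrepancy_sq_le hg hw0 hw1 (by positivity) (by positivity) happ hfeat
  -- This is what the number 4rN² of rounds is for: Tε² ≥ 4, so 1/√T ≤ ε/2.
  have hsqrt : √(rounds r N : ℝ) ≤ rounds r N * (ε / 2) := by
    rw [Real.sqrt_le_left (by positivity), mul_pow]
    have h4 : 4 ≤ (rounds r N : ℝ) * ε ^ 2 := by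
      rw [rounds]; push_cast
      have h5 : 1 ≤ N * ε := by rwa [div_le_iff₀ hN0, mul_comm] at hNε
      nlinarith [mul_le_mul hr1 (mul_le_mul h5 h5 zero_le_one (by linarith)) (by norm_num)
        (by linarith)]
    nlinarith
  have hS' : ∑ i ∈ Finset.range (gridSize r N + 1),
      ((discrepancy O r N idx (rounds r N) i : ℝ) / (rounds r N * (2 * scale r N))) ^ 2 ≤
        (gridSize r N + 1) * (108 * (r * ε)) ^ 2 := by
    simp_rw [div_pow]
    rw [← Finset.sum_div, div_le_iff₀ (by positivity)]
    refine hS.trans ?_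
    rw [mul_assoc _ (_ ^ 2) (_ ^ 2), ← mul_pow]
    gcongr
    have : 2 * (scale r N : ℝ) * 3 * √(rounds r N : ℝ) ≤
        2 * scale r N * 3 * (rounds r N * (ε / 2)) := by gcongr
    have h2 : 2 * (scale r N : ℝ) * rounds r N * (3 / 2 * ε) ≤
        2 * (scale r N : ℝ) * rounds r N * (2 * (r * ε)) := by gcongr; linarith
    linarith
  have hv0 := empiricalWeight_nonneg idx (rounds r N)
  have hv1 := sum_empiricalWeight hg.index_le ht
  set M' := latticeMixture r (empiricalWeight idx (rounds r N)) hv0 hv1 with hM'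
  have hpt : ∀ i ∈ Finset.range (gridSize r N + 1),
      (M'.toMeasure.real (Set.Iic (gridPoint r N i)) -
        (latticeMixture r w hw0 hw1).toMeasure.real (Set.Iic (gridPoint r N i))) ^ 2 ≤
      2 * ((discrepancy O r N idx (rounds r N) i : ℝ) / (rounds r N * (2 * scale r N))) ^ 2 +
        2 * (178 * (r * ε)) ^ 2 := by
    intro i hi
    have hi' : i ≤ gridSize r N := by simpa [Nat.lt_succ_iff] using hi
    have a1 := abs_sum_mul_feature_sub_le hr hN hrN hw0 hw1 hi'
    have a2 := abs_sum_mul_feature_sub_le hr hN hrN hv0 hv1 hi'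
    have a3 := happ i hi'
    rw [sum_empiricalWeight_mul_feature (O := O) hg.index_le ht] at a2
    have a4 : |(∑ j ∈ Finset.range (6 * r * r + 1), w j * (feature r N j i : ℝ)) / (2 * scale r N) -
        answer O r N i / (2 * scale r N)| ≤ 106 * (r * ε) := by
      rw [← sub_div, abs_div, abs_of_pos (by positivity : (0 : ℝ) < 2 * scale r N),
        div_le_iff₀ (by positivity)]
      linarith
    rw [add_div, div_div] at a2
    set F := M'.toMeasure.real (Set.Iic (gridPoint r N i))
    set G := (latticeMixture r w hw0 hw1).toMeasure.real (Set.Iic (gridPoint r N i))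
    set d := (discrepancy O r N idx (rounds r N) i : ℝ) / (rounds r N * (2 * scale r N))
    have a5 : |F - G - d| ≤ 178 * (r * ε) := by
      rw [abs_le] at *
      constructor <;> linarith [a1.1, a1.2, a2.1, a2.2, a4.1, a4.2]
    have a6 := sq_le_sq' (abs_le.1 a5).1 (abs_le.1 a5).2
    nlinarith [sq_nonneg (F - G - 2 * d)]
  have hsum := Finset.sum_le_sum hpt
  rw [Finset.sum_add_distrib, ← Finset.mul_sum, Finset.sum_const, Finset.card_range,
    nsmul_eq_mul] at hsum
  push_cast at hsum
  -- The constant is 2·108² + 2·178²: the greedy error 108 = 106 + 2, and 178 = 36 + 36 + 106 from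
  -- the two tables and the competitor.
  have hL := integral_abs_density_sub_le hr hN hrN hv0 hv1 hw0 hw1 hε hNε (by
    refine hsum.trans ?_
    linarith)
  refine (M.tvDistance_le _).trans ?_
  have htri : ∫ x, |M.density x - M'.density x| ≤
      (∫ x, |M.density x - (latticeMixture r w hw0 hw1).density x|) +
      ∫ x, |M'.density x - (latticeMixture r w hw0 hw1).density x| := by
    have i1 : Integrable fun x => |M.density x - (latticeMixture r w hw0 hw1).density x| :=
      (M.integrable_density.sub (latticeMixture r w hw0 hw1).integrable_density).abs
    have i2 : Integrable fun x => |M'.density x - (latticeMixture r w hw0 hw1).density x| := (M'.integrable_density.sub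
      (latticeMixture r w hw0 hw1).integrable_density).abs
    rw [← integral_add i1 i2]
    refine integral_mono (M.integrable_density.sub
      M'.integrable_density).abs (i1.add i2) fun x => ?_
    have := abs_sub_le (M.density x) ((latticeMixture r w hw0 hw1).density x)
      (M'.density x)
    rw [abs_sub_comm ((latticeMixture r w hw0 hw1).density x)] at this
    exact this
  have hr3 : ε ≤ r ^ 3 * ε := le_mul_of_one_le_left hε.le (one_le_pow₀ hr1)
  linarith

/-! ### Time bound and assembly -/

/-- Both the number of steps and the cost of a step are bounded through the cell bound of order N¹⁰:
one factor for the steps and 50 for their cost, hence 51·10 = 510. -/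
theorem exists_time_bound : ∃ C : ℝ, 0 ≤ C ∧ ∀ N : ℕ, 1 ≤ N →
    ((cellBound N * stepTime (cellBound N) : ℕ) : ℝ) ≤ C * (N : ℝ) ^ 510 := by
  refine ⟨400 * ((100 : ℝ) ^ 10) ^ 51, by positivity, fun N hN => ?_⟩
  have h1 : (1 : ℝ) ≤ cellBound N := by
    exact_mod_cast (show 1 ≤ 100 by norm_num).trans (hundred_le_cellBound hN)
  have h2 : (1 : ℝ) ≤ (cellBound N : ℝ) ^ 50 := one_le_pow₀ h1
  have h3 : ((cellBound N : ℕ) : ℝ) = (100 : ℝ) ^ 10 * (N : ℝ) ^ 10 := by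
    rw [cellBound, Nat.cast_pow, Nat.cast_mul, mul_pow]; rfl
  have h4 : ((N : ℝ) ^ 10) ^ 51 = (N : ℝ) ^ 510 := by rw [← pow_mul]
  calc ((cellBound N * stepTime (cellBound N) : ℕ) : ℝ)
      = (cellBound N : ℝ) * (200 * (1 + (cellBound N : ℝ) ^ 50)) := by
        rw [stepTime]
        simp only [Nat.cast_mul, Nat.cast_add, Nat.cast_pow, Nat.cast_one, Nat.cast_ofNat]
    _ ≤ (cellBound N : ℝ) * (200 * ((cellBound N : ℝ) ^ 50 + (cellBound N : ℝ) ^ 50)) := by gcongr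
    _ = 400 * (cellBound N : ℝ) ^ 51 := by rw [pow_succ _ 50]; ring
    _ = _ := by rw [h3, mul_pow, h4, mul_assoc]

/-- Minimality of r gives (r - 1)²·log 2 ≤ log N up to rounding. With log 2 ≥ 2/3 and r² ≤ 2(r - 1)²
+ 2, each summand is at most 3·log(2 + x). -/
theorem sq_resolution_le {r N : ℕ} (hr : 1 ≤ r) (h : 2 ^ (r - 1) ^ 2 ≤ N) {x : ℝ} (hx : 0 < x)
    (hN : (N : ℝ) ≤ 2 + x) : (r : ℝ) ^ 2 ≤ 6 * Real.log (2 + x) := by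
  have h2 := Real.log_two_gt_d9
  have h1 : ((r : ℝ) - 1) ^ 2 * Real.log 2 ≤ Real.log (2 + x) := by
    have : ((2 : ℝ) ^ (r - 1) ^ 2) ≤ 2 + x := le_trans (by exact_mod_cast h) hN
    have := Real.log_le_log (by positivity) this
    rw [Real.log_pow] at this
    push_cast [Nat.cast_sub hr] at this
    exact this
  have h3 : Real.log 2 ≤ Real.log (2 + x) := Real.log_le_log (by norm_num) (by linarith)
  have h4 : (r : ℝ) ^ 2 ≤ 2 * ((r : ℝ) - 1) ^ 2 + 2 := by nlinarith [sq_nonneg ((r : ℝ) - 2)]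
  have h5 : ((r : ℝ) - 1) ^ 2 * (2 / 3) ≤ Real.log (2 + x) := by
    nlinarith [sq_nonneg ((r : ℝ) - 1)]
  linarith

theorem LearnerOutput.outputs {O : Oracle} {N r : ℕ} {idx : ℕ → ℕ} {s : Memory}
    (h : LearnerOutput O N r idx s) (hN : 1 ≤ N) :
    Outputs s (latticeMixture r (empiricalWeight idx (rounds r N)) (empiricalWeight_nonneg idx _)
      (sum_empiricalWeight h.greedy.index_le (rounds_pos h.one_le hN))) := by
  have ht := rounds_pos h.one_le hN
  have hN0 : (N : ℝ) ≠ 0 := by exact_mod_cast (by omega : N ≠ 0)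
  have hr0 : (r : ℝ) ≠ 0 := by exact_mod_cast (by have := h.one_le; omega : r ≠ 0)
  refine ⟨by rw [h.size]; push_cast; ring, by rw [h.denominator]; exact_mod_cast ht, fun i => ?_⟩
  have hi : (i : ℕ) ≤ 6 * r * r := by have := i.2; omega
  rw [h.denominator, h.weight, h.mean i hi, h.variance i hi]
  refine ⟨?_, ?_, ?_⟩
  · simp [latticeMixture, empiricalWeight]
  · simp only [latticeMixture, latticePoint, rounds]
    push_cast
    field_simp
  · simp only [latticeMixture, rounds]
    push_cast
    field_simp

theorem mainTheorem7 :
    ∃ (P : Program) (C : ℝ) (a b : ℕ),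
      ∀ (ε : ℝ), 0 < ε →
      ∀ (f : Measure ℝ) [IsProbabilityMeasure f] (O : Oracle), GivesAccessTo O f →
        ∃ (s : Memory) (t : ℕ),
          (∀ (k : ℕ) (M : GaussianMixture k), M.WellConditioned 0.5 →
            tvDistance f M.toMeasure ≤ ε →
              Exec O P (inputMemory ⌈1 / ε⌉) s t ∧
              (t : ℝ) ≤ C * (1 + 1 / ε) ^ b ∧
              ∃ (m : ℕ) (M' : GaussianMixture m), Outputs s M' ∧
                (m : ℝ) ≤ C * Real.log (2 + 1 / ε) ∧
                tvDistance M.toMeasure M'.toMeasure ≤ C * ε * Real.log (2 + 1 / ε) ^ a) := by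
  obtain ⟨C, hC, hT⟩ := exists_time_bound
  refine ⟨learner, C + 1800000000, 2, 510, fun ε hε f _ O hO => ?_⟩
  have hx : 0 < 1 / ε := by positivity
  obtain ⟨N, hNe⟩ : ∃ N : ℕ, ⌈1 / ε⌉ = (N : ℤ) :=
    ⟨⌈1 / ε⌉.toNat, (Int.toNat_of_nonneg (Int.ceil_nonneg hx.le)).symm⟩
  have hN : 1 ≤ N := by
    have := Int.ceil_pos.2 hx
    omega
  have hNl : 1 / ε ≤ N := by
    have := Int.le_ceil (1 / ε)
    rw [hNe] at this
    exact_mod_cast this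
  have hNu : (N : ℝ) ≤ 1 + 1 / ε := by
    have := Int.ceil_lt_add_one (1 / ε)
    rw [hNe] at this
    push_cast at this
    linarith
  have hN0 : (0 : ℝ) < N := by exact_mod_cast hN
  have hNε : 1 / (N : ℝ) ≤ ε := by
    rw [div_le_iff₀ hN0]
    rwa [div_le_iff₀ hε, mul_comm] at hNl
  -- The run is fixed before any mixture is introduced, so the same output is valid for all of them.
  obtain ⟨r, idx, s, ⟨-, t, ht, hex⟩, hout⟩ := learner_runs hN (abs_oracle_le hO)
  refine ⟨s, t, fun k M hM hf => ⟨hNe ▸ hex, ?_, 6 * r * r + 1, _, hout.outputs hN, ?_, ?_⟩⟩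
  · have ht' : (t : ℝ) ≤ ((cellBound N * stepTime (cellBound N) : ℕ) : ℝ) := Nat.cast_le.2 ht
    calc (t : ℝ) ≤ C * (N : ℝ) ^ 510 := ht'.trans (hT N hN)
      _ ≤ (C + 1800000000) * (1 + 1 / ε) ^ 510 := by gcongr; linarith
  all_goals
    have hr1 : (1 : ℝ) ≤ r := by exact_mod_cast hout.one_le
    have hL := sq_resolution_le hout.one_le hout.two_pow_le hx (by linarith)
    have hL0 : 0 ≤ Real.log (2 + 1 / ε) := by nlinarith
    set L := Real.log (2 + 1 / ε)
  · have : (1 : ℝ) ≤ r ^ 2 := one_le_pow₀ hr1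
    have hCL : 0 ≤ C * L := by positivity
    push_cast
    nlinarith
  · refine (tvDistance_latticeMixture_le hO hM hε hf hout.one_le hN hout.lt_two_pow hNε
      hout.greedy).trans ?_
    -- Rounding r³ up to r⁴ gives an integral power of the logarithm; 50000000·36 = 1800000000.
    have h4 : (r : ℝ) ^ 3 ≤ 36 * L ^ 2 := by
      calc (r : ℝ) ^ 3 ≤ r ^ 4 := pow_le_pow_right₀ hr1 (by norm_num)
        _ = (r ^ 2) ^ 2 := by ring
        _ ≤ (6 * L) ^ 2 := by gcongr
        _ = _ := by ring
    calc 50000000 * (r : ℝ) ^ 3 * ε ≤ 50000000 * (36 * L ^ 2) * ε := by gcongr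
      _ = 1800000000 * ε * L ^ 2 := by ring
      _ ≤ _ := by gcongr; linarith
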